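/- Let $m\ge 3$, let $S^{2m+3}\subset\mathbb{C}^m\times\mathbb{C}^2$ be the unit sphere with its round metric $g_0$, and write its points as $(u,v)$. Let $G=S^1$ act by $\sigma(u,v)=(\sigma u,v)$ and $T=S^1\times S^1$ by $(\sigma_1,\sigma_2)(u,v_1,v_2)=(u,\sigma_1v_1,\sigma_2v_2)$. Identify the Lie algebra $\mathfrak t$ of $T$ with $\mathbb{R}^2$, with canonical basis $Z_1,Z_2$. Let $M_{\rm princ}\subset S^{2m+3}$ be the set of points with trivial $G$-stabilizer and $\widehat M\subset M_{\rm princ}$ the set of those $x$ for which $[x]\in G\backslash M_{\rm princ}$ has trivial $T$-stabilizer. Let $h_0$ be the Riemannian submersion metric on $G\backslash M_{\rm princ}$ induced by $g_0$, let $\pi\colon G\backslash\widehat M\to T\backslash(G\backslash\widehat M)$ be the projection, and let $h_0^T$ be the submersion metric on $T\backslash(G\backslash\widehat M)$ induced by $h_0$. For $Z\in\mathfrak t$ let $Z^*$ be the fundamental vector field on $G\backslash M_{\rm princ}$. Let $\mathrm{Aut}$ be the group of all diffeomorphisms $F$ of $G\backslash M_{\rm princ}$ such that $F\circ z\circ F^{-1}\in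 T$ for all $z\in T$, such that $F$ preserves the $h_0$-norm of vectors tangent to the $T$-orbits in $G\backslash\widehat M$, and such that $F$ induces an isometry of $(T\backslash(G\backslash\widehat M),h_0^T)$. Let $\overline{\mathrm{Aut}}$ be the group of the induced isometries, and let $\mathcal D=\{\Psi_F : F\in\mathrm{Aut}\}$, where $\Psi_F$ is the automorphism of $\mathfrak t$ which is the differential of $z\mapsto F\circ z\circ F^{-1}$. For a linear map $j\colon\mathfrak t\simeq\mathbb{R}^2\to\mathfrak{su}(m)$ let $\kappa=(\kappa^1,\kappa^2)$ be the $\mathfrak t$-valued $1$-form on $S^{2m+3}$ obtained by pulling back $$\kappa^k_{(u,v)}(U,V)=\|u\|^2\langle j_{Z_k}u,U\rangle-\langle U,iu\rangle\langle j_{Z_k}u,iu\rangle ,$$ where $\langle\cdot,\cdot\rangle$ is the canonical real inner product. Let $\lambda$ be the $1$-form on $G\backslash M_{\rm princ}$ induced by $\kappa$ (its pullback to $M_{\rm princ}$ is $\kappa$). Let $\omega_0$ be the connection form of the principal $T$-bundle $\pi$ whose kernel is the $h_0$-orthogonal complement of the vertical spaces $\{Z^*:Z\in\mathfrak t\}$,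 put $\omega_\lambda=\omega_0+\lambda$, and let $\Omega_\lambda$ be the curvature form on $T\backslash(G\backslash\widehat M)$, i.e. $\pi^*\Omega_\lambda=d\omega_\lambda$. Let $\mathcal E$ be the set of automorphisms $\phi$ of $\mathfrak t$ with $\phi(Z_k)\in\{\pm Z_1,\pm Z_2\}$ for $k=1,2$. Linear maps $j,j'\colon\mathfrak t\to\mathfrak{su}(m)$ are called equivalent if there are $A\in SU(m)\cup SU(m)\circ\mathrm{conj}$ (where $\mathrm{conj}$ is complex conjugation on $\mathbb{C}^m$) and $\Psi\in\mathcal E$ with $j'_Z=Aj_{\Psi(Z)}A^{-1}$ for all $Z\in\mathfrak t$; and $j$ is called generic if no nonzero element of $\mathfrak{su}(m)$ commutes with both $j_{Z_1}$ and $j_{Z_2}$. **Proposition.** Let $j,j'\colon\mathfrak t\to\mathfrak{su}(m)$ be linear maps, with associated forms $\lambda,\lambda'$ and curvature forms $\Omega_\lambda,\Omega_{\lambda'}$. 1. If $j$ and $j'$ are not equivalent, then condition (N) holds: there are no $\Psi\in\mathcal D$ and $\Phi\in\overline{\mathrm{Aut}}$ with $\Omega_\lambda=\Psi\circ\Phi^*\Omega_{\lambda'}$.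 2. If $j'$ is generic, then $\Omega_{\lambda'}$ has property (G): no nontrivial one-parameter group in $\overline{\mathrm{Aut}}$ preserves $\Omega_{\lambda'}$. -/

import Mathlib

open scoped Manifold ContDiff Matrix

noncomputable section

namespace SphereQuotient

/-! ## The round sphere `S^{2m+3} ⊆ ℂ^{m+2}` and the actions of `G = S¹` and `T = S¹ × S¹` -/

/-- `ℂ^{m+2} = ℂ^m × ℂ²`; the coordinates `x (.inl k)` form the component `u ∈ ℂ^m` of `x = (u, v)`
and the coordinates `x (.inr l)` form `v ∈ ℂ²`. Its real inner product is the canonical one. -/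
abbrev Amb (m : ℕ) : Type := EuclideanSpace ℂ (Fin m ⊕ Fin 2)

instance finrank_amb (m : ℕ) : Fact (Module.finrank ℝ (Amb m) = (2 * m + 3) + 1) := ⟨by
  have h := Module.finrank_mul_finrank ℝ ℂ (Amb m)
  simp at h
  omega⟩

/-- The sphere `S^{2m+3}`, with Mathlib's structure of a smooth manifold. -/
abbrev Sph (m : ℕ) : Type := Metric.sphere (0 : Amb m) 1

/-- The torus `T = S¹ × S¹`. -/
abbrev Torus : Type := Circle × Circle

/-- The action `σ (u, v) = (σ u, v)` of `G = S¹`. -/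
def actG {m : ℕ} (s : Circle) (x : Amb m) : Amb m :=
  WithLp.toLp 2 (Sum.elim (fun k => (s : ℂ) * x (.inl k)) (fun l => x (.inr l)))

/-- The action `(σ₁, σ₂) (u, v₁, v₂) = (u, σ₁ v₁, σ₂ v₂)` of `T`. -/
def actT {m : ℕ} (t : Torus) (x : Amb m) : Amb m :=
  WithLp.toLp 2 (Sum.elim (fun k => x (.inl k)) ![(t.1 : ℂ) * x (.inr 0), (t.2 : ℂ) * x (.inr 1)])

@[simp] theorem actG_inl {m : ℕ} (s : Circle) (x : Amb m) (k : Fin m) :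
    actG s x (.inl k) = s * x (.inl k) := rfl

@[simp] theorem actG_inr {m : ℕ} (s : Circle) (x : Amb m) (l : Fin 2) :
    actG s x (.inr l) = x (.inr l) := rfl

@[simp] theorem actT_inl {m : ℕ} (t : Torus) (x : Amb m) (k : Fin m) :
    actT t x (.inl k) = x (.inl k) := rfl

@[simp] theorem actT_inr_zero {m : ℕ} (t : Torus) (x : Amb m) :
    actT t x (.inr 0) = t.1 * x (.inr 0) := rfl

@[simp] theorem actT_inr_one {m : ℕ} (t : Torus) (x : Amb m) :
    actT t x (.inr 1) = t.2 * x (.inr 1) := rfl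

theorem amb_ext {m : ℕ} {x y : Amb m} (hu : ∀ k, x (.inl k) = y (.inl k))
    (h0 : x (.inr 0) = y (.inr 0)) (h1 : x (.inr 1) = y (.inr 1)) : x = y := by
  ext i
  rcases i with k | l
  · exact hu k
  · fin_cases l
    · exact h0
    · exact h1

theorem norm_actG {m : ℕ} (s : Circle) (x : Amb m) : ‖actG s x‖ = ‖x‖ := by
  simp [EuclideanSpace.norm_eq, Circle.norm_coe]

theorem norm_actT {m : ℕ} (t : Torus) (x : Amb m) : ‖actT t x‖ = ‖x‖ := by
  simp [EuclideanSpace.norm_eq, Circle.norm_coe]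

instance (m : ℕ) : MulAction Circle (Sph m) where
  smul s x := ⟨actG s x.1, by simp [norm_actG]⟩
  one_smul x := Subtype.ext (amb_ext (fun k => one_mul _) rfl rfl)
  mul_smul s t x := Subtype.ext (amb_ext (fun k => mul_assoc _ _ _) rfl rfl)

instance (m : ℕ) : MulAction Torus (Sph m) where
  smul t x := ⟨actT t x.1, by simp [norm_actT]⟩
  one_smul x := Subtype.ext (amb_ext (fun k => rfl) (one_mul _) (one_mul _))
  mul_smul s t x := Subtype.ext (amb_ext (fun k => rfl) (mul_assoc _ _ _) (mul_assoc _ _ _))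

theorem coe_smulG {m : ℕ} (s : Circle) (x : Sph m) : ((s • x : Sph m) : Amb m) = actG s x := rfl

theorem coe_smulT {m : ℕ} (t : Torus) (x : Sph m) : ((t • x : Sph m) : Amb m) = actT t x := rfl

instance (m : ℕ) : SMulCommClass Torus Circle (Sph m) where
  smul_comm _ _ _ := Subtype.ext (amb_ext (fun _ => rfl) rfl rfl)

/-! ## The principal part of the sphere and its quotient by `G` -/

theorem stabilizer_eq_bot_iff {m : ℕ} (x : Sph m) :
    MulAction.stabilizer Circle x = ⊥ ↔ ∃ k, (x : Amb m) (.inl k) ≠ 0 := by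
  constructor
  · intro h
    by_contra hx
    push Not at hx
    have h1 : (-1 : Circle) ∈ MulAction.stabilizer Circle x := by
      rw [MulAction.mem_stabilizer_iff]
      exact Subtype.ext (amb_ext (fun k => by simp [coe_smulG, hx k]) rfl rfl)
    rw [h, Subgroup.mem_bot] at h1
    have h2 : ((-1 : Circle) : ℂ) = 1 := by rw [h1]; rfl
    norm_num at h2
  · rintro ⟨k, hk⟩
    rw [eq_bot_iff]
    intro s hs
    rw [MulAction.mem_stabilizer_iff] at hs
    have h1 : (s : ℂ) * (x : Amb m) (.inl k) = (x : Amb m) (.inl k) :=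
      congrArg (fun y : Sph m => (y : Amb m) (.inl k)) hs
    rw [Subgroup.mem_bot]
    exact Circle.ext (by simpa using (mul_eq_right₀ hk).1 h1)

theorem continuous_coord {m : ℕ} (i : Fin m ⊕ Fin 2) :
    Continuous fun x : Sph m => (x : Amb m) i := by fun_prop

/-- The union of the principal `G`-orbits: the points with trivial stabilizer (`G` is abelian). -/
def princ (m : ℕ) : TopologicalSpace.Opens (Sph m) where
  carrier := {x | MulAction.stabilizer Circle x = ⊥}
  is_open' := by
    simp only [stabilizer_eq_bot_iff, Set.ofPred_exists]
    exact isOpen_iUnion fun k => isOpen_ne_fun (continuous_coord _) continuous_const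

theorem mem_princ_iff {m : ℕ} (x : Sph m) : x ∈ princ m ↔ ∃ k, (x : Amb m) (.inl k) ≠ 0 :=
  stabilizer_eq_bot_iff x

/-- The inclusion of the principal part into `ℂ^{m+2}`. -/
def incl {m : ℕ} (x : princ m) : Amb m := ((x : Sph m) : Amb m)

theorem incl_injective {m : ℕ} : Function.Injective (incl (m := m)) := fun _ _ h =>
  Subtype.ext (Subtype.ext h)

instance (m : ℕ) : MulAction Circle (princ m) where
  smul s x := ⟨s • (x : Sph m), by
    obtain ⟨k, hk⟩ := (mem_princ_iff _).1 x.2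
    exact (mem_princ_iff _).2 ⟨k, by simpa [coe_smulG] using hk⟩⟩
  one_smul x := Subtype.ext (one_smul Circle (x : Sph m))
  mul_smul s t x := Subtype.ext (mul_smul s t (x : Sph m))

instance (m : ℕ) : MulAction Torus (princ m) where
  smul t x := ⟨t • (x : Sph m), by
    obtain ⟨k, hk⟩ := (mem_princ_iff _).1 x.2
    exact (mem_princ_iff _).2 ⟨k, by simpa [coe_smulT] using hk⟩⟩
  one_smul x := Subtype.ext (one_smul Torus (x : Sph m))
  mul_smul s t x := Subtype.ext (mul_smul s t (x : Sph m))

theorem incl_smulG {m : ℕ} (s : Circle) (x : princ m) : incl (s • x) = actG s (incl x) := rfl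

theorem incl_smulT {m : ℕ} (t : Torus) (x : princ m) : incl (t • x) = actT t (incl x) := rfl

instance (m : ℕ) : SMulCommClass Torus Circle (princ m) where
  smul_comm t s x := Subtype.ext (smul_comm t s (x : Sph m))

/-- The quotient `G \ M_princ`. -/
def Quo (m : ℕ) : Type := MulAction.orbitRel.Quotient Circle (princ m)

instance (m : ℕ) : TopologicalSpace (Quo m) :=
  inferInstanceAs (TopologicalSpace (Quotient (MulAction.orbitRel Circle (princ m))))

/-- The projection `ξ : M_princ → G \ M_princ`. -/
def projG {m : ℕ} (x : princ m) : Quo m := Quotient.mk (MulAction.orbitRel Circle (princ m)) x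

theorem isQuotientMap_projG (m : ℕ) : Topology.IsQuotientMap (projG (m := m)) :=
  isQuotientMap_quotient_mk'

theorem projG_eq_iff {m : ℕ} {x y : princ m} : projG x = projG y ↔ ∃ s : Circle, s • y = x :=
  Quotient.eq.trans (MulAction.orbitRel_apply.trans Iff.rfl)

theorem projG_smul {m : ℕ} (s : Circle) (x : princ m) : projG (s • x) = projG x :=
  projG_eq_iff.2 ⟨s, rfl⟩

/-- The induced action of `T` on `G \ M_princ`. -/
instance (m : ℕ) : MulAction Torus (Quo m) where
  smul t := Quotient.map' (fun x => t • x) (by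
    rintro x y ⟨s, rfl⟩
    exact ⟨s, (smul_comm t s y).symm⟩)
  one_smul q := by
    obtain ⟨x, rfl⟩ := (isQuotientMap_projG m).surjective q
    exact congrArg projG (one_smul Torus x)
  mul_smul s t q := by
    obtain ⟨x, rfl⟩ := (isQuotientMap_projG m).surjective q
    exact congrArg projG (mul_smul s t x)

theorem smul_projG {m : ℕ} (t : Torus) (x : princ m) : t • projG x = projG (t • x) := rfl

/-! ## The smooth structure of `G \ M_princ`

The atlas consists of the charts `[(u, v)] ↦ ((u_k / u_i)_{k ≠ i}, v / |u_i|)` on `{u_i ≠ 0}`. It is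
the one for which the projection `ξ` is a smooth submersion: see `contMDiff_projG`, and
`contMDiff_secG` for the smooth local sections. -/

/-- The model space `ℂ^{m-1} × ℂ²` of `G \ M_princ`. -/
abbrev ModQ (m : ℕ) : Type := (Fin (m - 1) → ℂ) × (Fin 2 → ℂ)

/-- An enumeration of the indices different from `i`. -/
def others {m : ℕ} (i : Fin m) : Fin (m - 1) ≃ {k : Fin m // k ≠ i} :=
  (Fintype.equivFinOfCardEq (by simp [Fintype.card_subtype_compl])).symm

/-- The vector of `ℂ^m` with `i`-th entry `1` and remaining entries `z`. -/
def homog {m : ℕ} (i : Fin m) (z : Fin (m - 1) → ℂ) (k : Fin m) : ℂ :=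
  if h : k = i then 1 else z ((others i).symm ⟨k, h⟩)

@[simp] theorem homog_self {m : ℕ} (i : Fin m) (z : Fin (m - 1) → ℂ) : homog i z i = 1 := by
  simp [homog]

@[simp] theorem homog_others {m : ℕ} (i : Fin m) (z : Fin (m - 1) → ℂ) (l : Fin (m - 1)) :
    homog i z (others i l) = z l := by
  have h := (others i l).2
  simp [homog, h]

/-- The vector `((1, z), w)`. -/
def affine {m : ℕ} (i : Fin m) (h : ModQ m) : Amb m := WithLp.toLp 2 (Sum.elim (homog i h.1) h.2)

@[simp] theorem affine_inl {m : ℕ} (i : Fin m) (h : ModQ m) (k : Fin m) :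
    affine i h (.inl k) = homog i h.1 k := rfl

@[simp] theorem affine_inr {m : ℕ} (i : Fin m) (h : ModQ m) (l : Fin 2) :
    affine i h (.inr l) = h.2 l := rfl

theorem affine_ne_zero {m : ℕ} (i : Fin m) (h : ModQ m) : affine i h ≠ 0 := by
  intro h0
  have := congrArg (fun x : Amb m => x (.inl i)) h0
  simp at this

theorem norm_affine_pos {m : ℕ} (i : Fin m) (h : ModQ m) : 0 < ‖affine i h‖ :=
  norm_pos_iff.2 (affine_ne_zero i h)

/-- The section `(z, w) ↦ ((1, z), w) / ‖((1, z), w)‖` of `ξ` over the domain of the `i`-th chart. -/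
def secG {m : ℕ} (i : Fin m) (h : ModQ m) : princ m :=
  ⟨⟨‖affine i h‖⁻¹ • affine i h, by
      have := norm_affine_pos i h
      simp [norm_smul, this.ne']⟩,
    (mem_princ_iff _).2 ⟨i, by simp [affine_ne_zero]⟩⟩

theorem incl_secG {m : ℕ} (i : Fin m) (h : ModQ m) :
    incl (secG i h) = ‖affine i h‖⁻¹ • affine i h := rfl

/-- The coordinates `((u_k / u_i)_{k ≠ i}, v / |u_i|)`. -/
def coordQ {m : ℕ} (i : Fin m) (x : Amb m) : ModQ m :=
  (fun l => x (.inl (others i l)) / x (.inl i), fun l => x (.inr l) / (‖x (.inl i)‖ : ℂ))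

theorem coordQ_actG {m : ℕ} (i : Fin m) (s : Circle) (x : Amb m) :
    coordQ i (actG s x) = coordQ i x := by
  refine Prod.ext (funext fun l => ?_) (funext fun l => ?_)
  · simp [coordQ, mul_div_mul_left]
  · simp [coordQ, Circle.norm_coe]

theorem coordQ_smul {m : ℕ} (i : Fin m) {r : ℝ} (hr : 0 < r) (x : Amb m) :
    coordQ i (r • x) = coordQ i x := by
  have hr' : (r : ℂ) ≠ 0 := by exact_mod_cast hr.ne'
  refine Prod.ext (funext fun l => ?_) (funext fun l => ?_)
  · simp [coordQ, mul_div_mul_left, hr']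
  · simp [coordQ, abs_of_pos hr, mul_div_mul_left, hr']

theorem coordQ_affine {m : ℕ} (i : Fin m) (h : ModQ m) : coordQ i (affine i h) = h := by
  refine Prod.ext (funext fun l => ?_) (funext fun l => ?_) <;> simp [coordQ]

theorem coordQ_secG {m : ℕ} (i j : Fin m) (h : ModQ m) :
    coordQ j (incl (secG i h)) = coordQ j (affine i h) := by
  rw [incl_secG, coordQ_smul _ (inv_pos.2 (norm_affine_pos i h))]

theorem homog_coordQ {m : ℕ} (i : Fin m) (x : Amb m) (hx : x (.inl i) ≠ 0) (k : Fin m) :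
    homog i (coordQ i x).1 k = x (.inl k) / x (.inl i) := by
  by_cases h : k = i
  · subst h; simp [hx]
  · simp [homog, h, coordQ]

/-- The domain `{u_i ≠ 0}` of the `i`-th chart. -/
def domQ {m : ℕ} (i : Fin m) : Set (Quo m) :=
  {q | Quotient.liftOn' q (fun x : princ m => incl x (.inl i) ≠ 0) (by
    rintro x y ⟨s, rfl⟩
    simp [incl_smulG])}

theorem projG_mem_domQ {m : ℕ} (i : Fin m) (x : princ m) :
    projG x ∈ domQ i ↔ incl x (.inl i) ≠ 0 := Iff.rfl

theorem continuous_incl {m : ℕ} : Continuous (incl (m := m)) :=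
  continuous_subtype_val.comp continuous_subtype_val

theorem isOpen_domQ {m : ℕ} (i : Fin m) : IsOpen (domQ i) := by
  rw [← (isQuotientMap_projG m).isOpen_preimage]
  have h : Continuous fun x : princ m => incl x (.inl i) :=
    (continuous_coord _).comp continuous_subtype_val
  exact isOpen_ne_fun h continuous_const

/-- The coordinates of the `i`-th chart as a function on the quotient. -/
def mapQ {m : ℕ} (i : Fin m) (q : Quo m) : ModQ m :=
  Quotient.liftOn' q (fun x : princ m => coordQ i (incl x)) (by
    rintro x y ⟨s, rfl⟩
    exact coordQ_actG i s (incl y))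

theorem mapQ_projG {m : ℕ} (i : Fin m) (x : princ m) : mapQ i (projG x) = coordQ i (incl x) := rfl

theorem continuous_affine {m : ℕ} (i : Fin m) : Continuous (affine i) := by
  refine (PiLp.continuous_toLp 2 _).comp (continuous_pi fun k => ?_)
  rcases k with k | l
  · by_cases h : k = i
    · simpa [homog, h] using continuous_const
    · simp only [Sum.elim_inl, homog, h, dite_false]
      fun_prop
  · simp only [Sum.elim_inr]
    fun_prop

theorem continuous_secG {m : ℕ} (i : Fin m) : Continuous (secG i) := by
  refine Continuous.subtype_mk (Continuous.subtype_mk ?_ _) _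
  exact ((continuous_affine i).norm.inv₀ fun h => (norm_affine_pos i h).ne').smul
    (continuous_affine i)

theorem projG_secG_mapQ {m : ℕ} (i : Fin m) (q : Quo m) (hq : q ∈ domQ i) :
    projG (secG i (mapQ i q)) = q := by
  obtain ⟨x, rfl⟩ := (isQuotientMap_projG m).surjective q
  rw [projG_mem_domQ] at hq
  set y := incl x with hy
  have hyn : ‖y‖ = 1 := by simp [hy, incl]
  have ha : (‖y (.inl i)‖ : ℂ) ≠ 0 := by simpa using hq
  let c : ℂ := (‖y (.inl i)‖ : ℂ) / y (.inl i)
  have hc : ‖c‖ = 1 := by simp [c, hq]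
  let s : Circle := ⟨c, mem_sphere_zero_iff_norm.2 hc⟩
  have h1 : affine i (mapQ i (projG x)) = (‖y (.inl i)‖⁻¹ : ℝ) • actG s y := by
    have hu : ∀ k, affine i (mapQ i (projG x)) (.inl k)
        = ((‖y (.inl i)‖⁻¹ : ℝ) • actG s y) (.inl k) := by
      intro k
      have : (s : ℂ) = c := rfl
      rw [affine_inl, mapQ_projG, homog_coordQ i _ hq]
      simp only [PiLp.smul_apply, actG_inl, this, Complex.real_smul, c]
      push_cast
      field_simp
    have hv : ∀ l, affine i (mapQ i (projG x)) (.inr l)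
        = ((‖y (.inl i)‖⁻¹ : ℝ) • actG s y) (.inr l) := by
      intro l
      simp [mapQ_projG, coordQ, ← hy, div_eq_inv_mul]
    exact amb_ext hu (hv 0) (hv 1)
  rw [projG_eq_iff]
  refine ⟨s, incl_injective ?_⟩
  rw [incl_secG, incl_smulG, h1, norm_smul, norm_actG, hyn]
  have hq' : ‖y (.inl i)‖ ≠ 0 := by simpa using hq
  simp [smul_smul, hq', ← hy]

/-- A chart with values in the whole model space, from a map with a continuous inverse. -/
def chartOfSection {P Q H : Type*} [TopologicalSpace P] [TopologicalSpace Q] [TopologicalSpace H]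
    (p : P → Q) (hp : Topology.IsQuotientMap p) (dom : Set Q) (hdom : IsOpen dom) (f : Q → H)
    (hf : ContinuousOn (fun x => f (p x)) (p ⁻¹' dom)) (s : H → Q) (hs : Continuous s)
    (hsd : ∀ h, s h ∈ dom) (hl : ∀ q ∈ dom, s (f q) = q) (hr : ∀ h, f (s h) = h) :
    OpenPartialHomeomorph Q H where
  toFun := f
  invFun := s
  source := dom
  target := Set.univ
  map_source' _ _ := Set.mem_univ _
  map_target' h _ := hsd h
  left_inv' := hl
  right_inv' h _ := hr h
  open_source := hdom
  open_target := isOpen_univ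
  continuousOn_toFun := (hp.continuousOn_isOpen_iff hdom).2 hf
  continuousOn_invFun := hs.continuousOn

theorem continuousOn_coordQ {m : ℕ} (i : Fin m) :
    ContinuousOn (coordQ i) {x : Amb m | x (.inl i) ≠ 0} := by
  refine ContinuousOn.prodMk (continuousOn_pi.2 fun l => ?_) (continuousOn_pi.2 fun l => ?_)
  · exact ContinuousOn.div (by fun_prop) (by fun_prop) fun x hx => hx
  · exact ContinuousOn.div (by fun_prop) (by fun_prop) fun x hx => by simpa using hx

/-- The `i`-th chart of `G \ M_princ`. -/
def chartQ {m : ℕ} (i : Fin m) : OpenPartialHomeomorph (Quo m) (ModQ m) :=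
  chartOfSection projG (isQuotientMap_projG m) (domQ i) (isOpen_domQ i) (mapQ i)
    ((continuousOn_coordQ i).comp continuous_incl.continuousOn fun _ hx => hx)
    (fun h => projG (secG i h)) ((isQuotientMap_projG m).continuous.comp (continuous_secG i))
    (fun h => by simp [projG_mem_domQ, incl_secG, affine_ne_zero])
    (projG_secG_mapQ i)
    (fun h => by rw [mapQ_projG, coordQ_secG, coordQ_affine])

theorem exists_mem_domQ {m : ℕ} (q : Quo m) : ∃ i, q ∈ domQ i := by
  obtain ⟨x, rfl⟩ := (isQuotientMap_projG m).surjective q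
  exact (mem_princ_iff _).1 x.2

instance (m : ℕ) : ChartedSpace (ModQ m) (Quo m) where
  atlas := Set.range chartQ
  chartAt q := chartQ (exists_mem_domQ q).choose
  mem_chart_source q := (exists_mem_domQ q).choose_spec
  chart_mem_atlas _ := ⟨_, rfl⟩

theorem contDiff_homog {m : ℕ} (i k : Fin m) :
    ContDiff ℝ ∞ fun z : Fin (m - 1) → ℂ => homog i z k := by
  by_cases h : k = i
  · simpa [homog, h] using contDiff_const
  · simp only [homog, h, dite_false]
    fun_prop

theorem contDiffOn_coordQ_affine {m : ℕ} (i j : Fin m) :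
    ContDiffOn ℝ ∞ (fun h : ModQ m => coordQ j (affine i h)) {h | homog i h.1 j ≠ 0} := by
  have hom : ∀ k, ContDiff ℝ ∞ fun h : ModQ m => homog i h.1 k :=
    fun k => (contDiff_homog i k).comp contDiff_fst
  refine ContDiffOn.prodMk (contDiffOn_pi.2 fun l => ?_) (contDiffOn_pi.2 fun l => ?_)
  · simp only [affine_inl, div_eq_mul_inv]
    exact (hom _).contDiffOn.mul ((hom j).contDiffOn.inv fun h hh => hh)
  · simp only [affine_inl, affine_inr, div_eq_mul_inv]
    refine ContDiffOn.mul (by fun_prop) (ContDiffOn.inv ?_ fun h hh => by simpa using hh)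
    exact Complex.ofRealCLM.contDiff.comp_contDiffOn
      (((hom j).contDiffOn).norm ℝ fun h hh => hh)

instance (m : ℕ) : IsManifold 𝓘(ℝ, ModQ m) ∞ (Quo m) := by
  refine isManifold_of_contDiffOn _ _ _ ?_
  rintro _ _ ⟨i, rfl⟩ ⟨j, rfl⟩
  refine ((contDiffOn_coordQ_affine i j).congr fun h _ => coordQ_secG i j h).mono ?_
  rintro h ⟨⟨-, h2⟩, -⟩
  have h3 : incl (secG i h) (.inl j) ≠ 0 := h2
  intro h4
  exact h3 (by simp [incl_secG, h4])

/-- The model space of the sphere `S^{2m+3}`. -/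
abbrev ModS (m : ℕ) : Type := EuclideanSpace ℝ (Fin (2 * m + 3))

theorem contMDiff_incl {m : ℕ} : ContMDiff 𝓘(ℝ, ModS m) 𝓘(ℝ, Amb m) ∞ (incl (m := m)) :=
  contMDiff_coe_sphere.comp contMDiff_subtype_val

theorem contMDiff_projG {m : ℕ} : ContMDiff 𝓘(ℝ, ModS m) 𝓘(ℝ, ModQ m) ∞ (projG (m := m)) := by
  intro x
  rw [contMDiffAt_iff_target]
  refine ⟨(isQuotientMap_projG m).continuous.continuousAt, ?_⟩
  have h := (exists_mem_domQ (projG x)).choose_spec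
  rw [projG_mem_domQ] at h
  set i := (exists_mem_domQ (projG x)).choose with hi
  have h1 : ContDiffAt ℝ ∞ (coordQ i) (incl x) := by
    have hc : ∀ k, ContDiffAt ℝ ∞ (fun y : Amb m => y k) (incl x) := fun k => by fun_prop
    refine ContDiffAt.prodMk (contDiffAt_pi.2 fun l => ?_) (contDiffAt_pi.2 fun l => ?_)
    · simp only [div_eq_mul_inv]
      exact (hc _).mul ((hc _).inv h)
    · simp only [div_eq_mul_inv]
      refine (hc _).mul (ContDiffAt.inv ?_ (by simpa using h))
      exact Complex.ofRealCLM.contDiff.contDiffAt.comp _ ((hc _).norm ℝ h)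
  exact h1.contMDiffAt.comp x contMDiff_incl.contMDiffAt

theorem contMDiff_secG {m : ℕ} (i : Fin m) :
    ContMDiff 𝓘(ℝ, ModQ m) 𝓘(ℝ, ModS m) ∞ (secG i) := by
  rw [← ContMDiff.subtypeVal_comp_iff]
  have h : ContDiff ℝ ∞ (affine i) := by
    refine (PiLp.contDiff_toLp (p := 2)).comp (contDiff_pi.2 fun k => ?_)
    rcases k with k | l
    · exact (contDiff_homog i k).comp contDiff_fst
    · simp only [Sum.elim_inr]
      fun_prop
  have h2 : ContDiff ℝ ∞ fun h => incl (secG i h) := by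
    simp only [incl_secG]
    exact ((h.norm ℝ (affine_ne_zero i)).inv fun z => (norm_affine_pos i z).ne').smul h
  exact h2.contMDiff.codRestrict_sphere fun z => ((secG i z : princ m) : Sph m).2

/-! ## The set `M̂` and the quotient `T \ (G \ M̂)` -/

theorem stabilizer_projG_eq_bot_iff {m : ℕ} (x : princ m) :
    MulAction.stabilizer Torus (projG x) = ⊥ ↔ ∀ l, incl x (.inr l) ≠ 0 := by
  constructor
  · intro h l hl
    have key : ∀ t : Torus, t • x = x → t = 1 := by
      intro t ht
      have h1 : t ∈ MulAction.stabilizer Torus (projG x) := by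
        rw [MulAction.mem_stabilizer_iff, smul_projG, ht]
      rwa [h, Subgroup.mem_bot] at h1
    have hne : (-1 : Circle) ≠ 1 := by
      intro h1
      have h2 : ((-1 : Circle) : ℂ) = 1 := by rw [h1]; rfl
      norm_num at h2
    fin_cases l
    · refine hne (congrArg Prod.fst (key (-1, 1) (incl_injective ?_)))
      refine amb_ext (fun k => rfl) ?_ ?_
      · have h0 : incl x (.inr 0) = 0 := hl
        simp [incl_smulT, h0]
      · simp [incl_smulT]
    · refine hne (congrArg Prod.snd (key (1, -1) (incl_injective ?_)))
      refine amb_ext (fun k => rfl) ?_ ?_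
      · simp [incl_smulT]
      · have h0 : incl x (.inr 1) = 0 := hl
        simp [incl_smulT, h0]
  · intro h
    rw [eq_bot_iff]
    intro t ht
    rw [MulAction.mem_stabilizer_iff, smul_projG, projG_eq_iff] at ht
    obtain ⟨s, hs⟩ := ht
    have h0 : incl x (.inr 0) = t.1 * incl x (.inr 0) :=
      congrArg (fun y : princ m => incl y (.inr 0)) hs
    have h1 : incl x (.inr 1) = t.2 * incl x (.inr 1) :=
      congrArg (fun y : princ m => incl y (.inr 1)) hs
    rw [Subgroup.mem_bot]
    refine Prod.ext (Circle.ext ?_) (Circle.ext ?_)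
    · simpa using (mul_eq_right₀ (h 0)).1 h0.symm
    · simpa using (mul_eq_right₀ (h 1)).1 h1.symm

/-- The open subset `G \ M̂` of `G \ M_princ`: the points with trivial `T`-stabilizer. -/
def hat (m : ℕ) : TopologicalSpace.Opens (Quo m) where
  carrier := {q | MulAction.stabilizer Torus q = ⊥}
  is_open' := by
    rw [← (isQuotientMap_projG m).isOpen_preimage]
    have h : projG ⁻¹' {q : Quo m | MulAction.stabilizer Torus q = ⊥} =
        ⋂ l : Fin 2, {x : princ m | incl x (.inr l) ≠ 0} := by
      ext x
      simpa using stabilizer_projG_eq_bot_iff x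
    rw [h]
    refine isOpen_iInter_of_finite fun l => ?_
    have hc : Continuous fun x : princ m => incl x (.inr l) :=
      (continuous_coord _).comp continuous_subtype_val
    exact isOpen_ne_fun hc continuous_const

theorem projG_mem_hat {m : ℕ} (x : princ m) : projG x ∈ hat m ↔ ∀ l, incl x (.inr l) ≠ 0 :=
  stabilizer_projG_eq_bot_iff x

theorem smul_mem_hat {m : ℕ} (t : Torus) {q : Quo m} (hq : q ∈ hat m) : t • q ∈ hat m := by
  obtain ⟨x, rfl⟩ := (isQuotientMap_projG m).surjective q
  rw [projG_mem_hat] at hq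
  rw [smul_projG, projG_mem_hat]
  intro l
  fin_cases l
  · simpa [incl_smulT] using hq 0
  · simpa [incl_smulT] using hq 1

instance (m : ℕ) : MulAction Torus (hat m) where
  smul t q := ⟨t • (q : Quo m), smul_mem_hat t q.2⟩
  one_smul q := Subtype.ext (one_smul Torus (q : Quo m))
  mul_smul s t q := Subtype.ext (mul_smul s t (q : Quo m))

/-- The quotient `T \ (G \ M̂)`. -/
def Base (m : ℕ) : Type := MulAction.orbitRel.Quotient Torus (hat m)

instance (m : ℕ) : TopologicalSpace (Base m) :=
  inferInstanceAs (TopologicalSpace (Quotient (MulAction.orbitRel Torus (hat m))))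

/-- The projection `π : G \ M̂ → T \ (G \ M̂)`. -/
def projT {m : ℕ} (q : hat m) : Base m := Quotient.mk (MulAction.orbitRel Torus (hat m)) q

theorem isQuotientMap_projT (m : ℕ) : Topology.IsQuotientMap (projT (m := m)) :=
  isQuotientMap_quotient_mk'

theorem projT_eq_iff {m : ℕ} {p q : hat m} : projT p = projT q ↔ ∃ t : Torus, t • q = p :=
  Quotient.eq.trans (MulAction.orbitRel_apply.trans Iff.rfl)

/-! The atlas of `T \ (G \ M̂)` consists of the charts
`[(u, v)] ↦ ((u_k / u_i)_{k ≠ i}, (log (|v_l| / |u_i|))_l)` on `{u_i ≠ 0}`. Again it is the one for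
which `π` is a smooth submersion: see `contMDiff_projT` and `contMDiff_secT`. -/

/-- The model space `ℂ^{m-1} × ℝ²` of `T \ (G \ M̂)`. -/
abbrev ModB (m : ℕ) : Type := (Fin (m - 1) → ℂ) × (Fin 2 → ℝ)

/-- The map between the model spaces that expresses `π` in coordinates. -/
def logMod {m : ℕ} (h : ModQ m) : ModB m := (h.1, fun l => Real.log ‖h.2 l‖)

/-- A right inverse of `logMod`. -/
def expMod {m : ℕ} (h : ModB m) : ModQ m := (h.1, fun l => (Real.exp (h.2 l) : ℂ))

theorem logMod_expMod {m : ℕ} (h : ModB m) : logMod (expMod h) = h := by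
  refine Prod.ext rfl (funext fun l => ?_)
  simp only [logMod, expMod, Complex.norm_real, Real.norm_eq_abs, Real.abs_exp, Real.log_exp]

theorem coordQ_actT_fst {m : ℕ} (i : Fin m) (t : Torus) (x : Amb m) :
    (coordQ i (actT t x)).1 = (coordQ i x).1 := rfl

theorem logMod_coordQ_actT {m : ℕ} (i : Fin m) (t : Torus) (x : Amb m) :
    logMod (coordQ i (actT t x)) = logMod (coordQ i x) := by
  refine Prod.ext rfl (funext fun l => ?_)
  fin_cases l <;> simp [logMod, coordQ, Circle.norm_coe]

theorem actT_smul {m : ℕ} (t : Torus) (r : ℝ) (x : Amb m) : actT t (r • x) = r • actT t x := by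
  refine amb_ext (fun k => rfl) ?_ ?_
  · simp [mul_left_comm]
  · simp [mul_left_comm]

/-- The domain `{u_i ≠ 0}` of the `i`-th chart. -/
def domB {m : ℕ} (i : Fin m) : Set (Base m) :=
  {b | Quotient.liftOn' b (fun q : hat m => (q : Quo m) ∈ domQ i) (by
    rintro p ⟨q, hq⟩ ⟨t, rfl⟩
    obtain ⟨x, rfl⟩ := (isQuotientMap_projG m).surjective q
    exact propext Iff.rfl)}

theorem projT_mem_domB {m : ℕ} (i : Fin m) (q : hat m) :
    projT q ∈ domB i ↔ (q : Quo m) ∈ domQ i := Iff.rfl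

theorem isOpen_domB {m : ℕ} (i : Fin m) : IsOpen (domB i) := by
  rw [← (isQuotientMap_projT m).isOpen_preimage]
  exact (isOpen_domQ i).preimage continuous_subtype_val

/-- The coordinates of the `i`-th chart as a function on the quotient. -/
def mapB {m : ℕ} (i : Fin m) (b : Base m) : ModB m :=
  Quotient.liftOn' b (fun q : hat m => logMod (mapQ i q)) (by
    rintro p ⟨q, hq⟩ ⟨t, rfl⟩
    obtain ⟨x, rfl⟩ := (isQuotientMap_projG m).surjective q
    exact logMod_coordQ_actT i t (incl x))

theorem mapB_projT {m : ℕ} (i : Fin m) (q : hat m) : mapB i (projT q) = logMod (mapQ i q) := rfl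

/-- The section of `π` over the domain of the `i`-th chart. -/
def secT {m : ℕ} (i : Fin m) (h : ModB m) : hat m :=
  ⟨projG (secG i (expMod h)), by
    rw [projG_mem_hat]
    intro l
    simp [incl_secG, expMod, affine_ne_zero]⟩

theorem coe_secT {m : ℕ} (i : Fin m) (h : ModB m) :
    (secT i h : Quo m) = projG (secG i (expMod h)) := rfl

theorem continuous_expMod {m : ℕ} : Continuous (expMod (m := m)) := by
  refine continuous_fst.prodMk (continuous_pi fun l => ?_)
  fun_prop

theorem continuous_secT {m : ℕ} (i : Fin m) : Continuous (secT i) :=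
  Continuous.subtype_mk ((isQuotientMap_projG m).continuous.comp
    ((continuous_secG i).comp continuous_expMod)) _

theorem mapQ_snd_ne_zero {m : ℕ} (i : Fin m) (q : hat m) (hq : (q : Quo m) ∈ domQ i) (l : Fin 2) :
    (mapQ i (q : Quo m)).2 l ≠ 0 := by
  obtain ⟨q, hh⟩ := q
  obtain ⟨x, rfl⟩ := (isQuotientMap_projG m).surjective q
  rw [projG_mem_hat] at hh
  rw [projG_mem_domQ] at hq
  simpa [mapQ_projG, coordQ, hh l] using hq

theorem continuousOn_chartQ {m : ℕ} (i : Fin m) : ContinuousOn (mapQ i) (domQ i) :=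
  (chartQ i).continuousOn

theorem continuousOn_mapB {m : ℕ} (i : Fin m) :
    ContinuousOn (fun q : hat m => mapB i (projT q)) (projT ⁻¹' domB i) := by
  have h : ContinuousOn (fun q : hat m => mapQ i (q : Quo m)) (projT ⁻¹' domB i) :=
    (continuousOn_chartQ i).comp continuous_subtype_val.continuousOn fun _ hq => hq
  refine ContinuousOn.prodMk (continuous_fst.comp_continuousOn h) (continuousOn_pi.2 fun l => ?_)
  refine ContinuousOn.log ?_ fun q hq => norm_ne_zero_iff.2 (mapQ_snd_ne_zero i q hq l)
  exact ((continuous_apply l).comp continuous_snd).norm.comp_continuousOn h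

/-- The phase of a nonzero complex number. -/
def phase (c : ℂ) (hc : c ≠ 0) : Circle :=
  ⟨c / (‖c‖ : ℂ), mem_sphere_zero_iff_norm.2 (by simp [hc])⟩

theorem phase_mul {c : ℂ} (hc : c ≠ 0) : (phase c hc : ℂ) * (‖c‖ : ℂ) = c :=
  div_mul_cancel₀ _ (by simpa using hc)

theorem projT_secT_mapB {m : ℕ} (i : Fin m) (b : Base m) (hb : b ∈ domB i) :
    projT (secT i (mapB i b)) = b := by
  obtain ⟨q, rfl⟩ := (isQuotientMap_projT m).surjective b
  rw [projT_mem_domB] at hb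
  have hv := mapQ_snd_ne_zero i q hb
  set h := mapQ i (q : Quo m) with hh
  let t : Torus := (phase (h.2 0) (hv 0), phase (h.2 1) (hv 1))
  have hexp : ∀ l, ((Real.exp (Real.log ‖h.2 l‖) : ℝ) : ℂ) = (‖h.2 l‖ : ℂ) := fun l => by
    rw [Real.exp_log (norm_pos_iff.2 (hv l))]
  have h1 : actT t (affine i (expMod (logMod h))) = affine i h := by
    refine amb_ext (fun k => rfl) ?_ ?_
    · simp only [actT_inr_zero, affine_inr, expMod, logMod, hexp]
      exact phase_mul (hv 0)
    · simp only [actT_inr_one, affine_inr, expMod, logMod, hexp]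
      exact phase_mul (hv 1)
  have h2 : t • secG i (expMod (logMod h)) = secG i h := by
    apply incl_injective
    have h3 : ‖affine i (expMod (logMod h))‖ = ‖affine i h‖ := by rw [← h1, norm_actT]
    rw [incl_smulT, incl_secG, incl_secG, h3, ← h1]
    exact actT_smul _ _ _
  refine Eq.symm (projT_eq_iff.2 ⟨t, Subtype.ext ?_⟩)
  change t • projG (secG i (expMod (logMod h))) = q
  rw [smul_projG, h2, hh, projG_secG_mapQ i _ hb]

/-- The `i`-th chart of `T \ (G \ M̂)`. -/
def chartB {m : ℕ} (i : Fin m) : OpenPartialHomeomorph (Base m) (ModB m) :=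
  chartOfSection projT (isQuotientMap_projT m) (domB i) (isOpen_domB i) (mapB i)
    (continuousOn_mapB i) (fun h => projT (secT i h))
    ((isQuotientMap_projT m).continuous.comp (continuous_secT i))
    (fun h => by simp [projT_mem_domB, coe_secT, projG_mem_domQ, incl_secG, affine_ne_zero])
    (projT_secT_mapB i)
    (fun h => by rw [mapB_projT, coe_secT, mapQ_projG, coordQ_secG, coordQ_affine, logMod_expMod])

theorem exists_mem_domB {m : ℕ} (b : Base m) : ∃ i, b ∈ domB i := by
  obtain ⟨q, rfl⟩ := (isQuotientMap_projT m).surjective b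
  exact exists_mem_domQ (q : Quo m)

instance (m : ℕ) : ChartedSpace (ModB m) (Base m) where
  atlas := Set.range chartB
  chartAt b := chartB (exists_mem_domB b).choose
  mem_chart_source b := (exists_mem_domB b).choose_spec
  chart_mem_atlas _ := ⟨_, rfl⟩

theorem contDiff_expMod {m : ℕ} : ContDiff ℝ ∞ (expMod (m := m)) := by
  refine contDiff_fst.prodMk (contDiff_pi.2 fun l => ?_)
  refine Complex.ofRealCLM.contDiff.comp (Real.contDiff_exp.comp ?_)
  fun_prop

theorem contDiffAt_logMod {m : ℕ} {h : ModQ m} (hh : ∀ l, h.2 l ≠ 0) :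
    ContDiffAt ℝ ∞ (logMod (m := m)) h := by
  refine contDiffAt_fst.prodMk (contDiffAt_pi.2 fun l => ?_)
  refine ContDiffAt.log (ContDiffAt.norm ℝ ?_ (hh l)) (norm_ne_zero_iff.2 (hh l))
  fun_prop

instance (m : ℕ) : IsManifold 𝓘(ℝ, ModB m) ∞ (Base m) := by
  refine isManifold_of_contDiffOn _ _ _ ?_
  rintro _ _ ⟨i, rfl⟩ ⟨j, rfl⟩
  have h1 : ContDiffOn ℝ ∞ (fun h : ModB m => logMod (coordQ j (affine i (expMod h))))
      {h | homog i h.1 j ≠ 0} := by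
    intro h hh
    refine ContDiffAt.comp_contDiffWithinAt h (contDiffAt_logMod fun l => ?_)
      ((contDiffOn_coordQ_affine i j).comp contDiff_expMod.contDiffOn (fun _ hz => hz) h hh)
    have : homog i (expMod h).1 j ≠ 0 := hh
    simp only [coordQ, affine_inl, affine_inr]
    refine div_ne_zero ?_ (by simpa using this)
    simp [expMod]
  refine (h1.congr fun h _ => congrArg logMod (coordQ_secG i j (expMod h))).mono ?_
  rintro h ⟨⟨-, h2⟩, -⟩
  have h3 : incl (secG i (expMod h)) (.inl j) ≠ 0 := h2
  intro h4
  have h5 : homog i (expMod h).1 j = 0 := h4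
  exact h3 (by simp [incl_secG, h5])

theorem contMDiff_projT {m : ℕ} : ContMDiff 𝓘(ℝ, ModQ m) 𝓘(ℝ, ModB m) ∞ (projT (m := m)) := by
  intro q
  rw [contMDiffAt_iff_target]
  refine ⟨(isQuotientMap_projT m).continuous.continuousAt, ?_⟩
  have h := (exists_mem_domB (projT q)).choose_spec
  rw [projT_mem_domB] at h
  set i := (exists_mem_domB (projT q)).choose with hi
  have h1 : ContMDiffAt 𝓘(ℝ, ModQ m) 𝓘(ℝ, ModQ m) ∞ (mapQ i) (q : Quo m) :=
    contMDiffAt_of_mem_maximalAtlas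
      (IsManifold.subset_maximalAtlas (I := 𝓘(ℝ, ModQ m)) (n := ∞) ⟨i, rfl⟩ :
        chartQ i ∈ IsManifold.maximalAtlas 𝓘(ℝ, ModQ m) ∞ (Quo m)) h
  have h2 : ContMDiffAt 𝓘(ℝ, ModQ m) 𝓘(ℝ, ModQ m) ∞ (fun q : hat m => mapQ i (q : Quo m)) q :=
    h1.comp q contMDiff_subtype_val.contMDiffAt
  have h3 : ContMDiffAt 𝓘(ℝ, ModQ m) 𝓘(ℝ, ModB m) ∞
      (fun q : hat m => logMod (mapQ i (q : Quo m))) q :=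
    (contDiffAt_logMod (mapQ_snd_ne_zero i q h)).contMDiffAt.comp q h2
  exact h3

theorem contMDiff_secT {m : ℕ} (i : Fin m) :
    ContMDiff 𝓘(ℝ, ModB m) 𝓘(ℝ, ModQ m) ∞ (secT i) := by
  rw [← ContMDiff.subtypeVal_comp_iff]
  exact contMDiff_projG.comp ((contMDiff_secG i).comp contDiff_expMod.contMDiff)

/-! ## Differential forms and Riemannian submersions

The manifolds below are modelled on normed spaces and have no boundary. -/

section Generic

variable {E : Type*} [NormedAddCommGroup E] [NormedSpace ℝ E]
  {E' : Type*} [NormedAddCommGroup E'] [NormedSpace ℝ E']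
  {F : Type*} [NormedAddCommGroup F] [NormedSpace ℝ F]
  {N : Type*} [TopologicalSpace N] [ChartedSpace E N]
  {N' : Type*} [TopologicalSpace N'] [ChartedSpace E' N']

variable (E N) in
/-- `F`-valued differential `k`-forms on `N`. -/
abbrev DiffForm (k : ℕ) (F : Type*) [NormedAddCommGroup F] [NormedSpace ℝ F] : Type _ :=
  (q : N) → TangentSpace 𝓘(ℝ, E) q [⋀^Fin k]→L[ℝ] F

/-- The pullback `f^* η`. -/
def DiffForm.pullback {k : ℕ} (f : N → N') (η : DiffForm E' N' k F) : DiffForm E N k F :=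
  fun q => (η (f q)).compContinuousLinearMap (mfderiv 𝓘(ℝ, E) 𝓘(ℝ, E') f q)

/-- The exterior derivative, computed in the preferred chart at each point. -/
def DiffForm.d {k : ℕ} (η : DiffForm E N k F) : DiffForm E N (k + 1) F :=
  fun q => (extDeriv (DiffForm.pullback (E := E) (chartAt E q).symm η)
    (chartAt E q q)).compContinuousLinearMap (mfderiv 𝓘(ℝ, E) 𝓘(ℝ, E) (chartAt E q) q)

/-- The composition `Ψ ∘ η` with a linear automorphism of the space of values. -/
def DiffForm.postcomp {k : ℕ} (Ψ : F ≃L[ℝ] F) (η : DiffForm E N k F) : DiffForm E N k F :=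
  fun q => (Ψ : F →L[ℝ] F).compContinuousAlternatingMap (η q)

variable (E N) in
/-- Families of bilinear forms on the tangent spaces, such as Riemannian metrics. -/
abbrev MetricTensor : Type _ := (q : N) → LinearMap.BilinForm ℝ (TangentSpace 𝓘(ℝ, E) q)

/-- The pullback of a family of bilinear forms. -/
def MetricTensor.pullback (f : N → N') (h : MetricTensor E' N') : MetricTensor E N :=
  fun q => (h (f q)).compl₁₂ (mfderiv 𝓘(ℝ, E) 𝓘(ℝ, E') f q).toLinearMap
    (mfderiv 𝓘(ℝ, E) 𝓘(ℝ, E') f q).toLinearMap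

/-- `h` turns `p : (N, g) → (N', h)` into a Riemannian submersion: `dp` is isometric on the
horizontal vectors, i.e. on the orthogonal complement of the kernel of `dp`. -/
def IsSubmersionMetric (p : N → N') (g : MetricTensor E N) (h : MetricTensor E' N') : Prop :=
  ∀ (x : N) (X Y : TangentSpace 𝓘(ℝ, E) x),
    (∀ K : TangentSpace 𝓘(ℝ, E) x, mfderiv 𝓘(ℝ, E) 𝓘(ℝ, E') p x K = 0 → g x X K = 0) →
    (∀ K : TangentSpace 𝓘(ℝ, E) x, mfderiv 𝓘(ℝ, E) 𝓘(ℝ, E') p x K = 0 → g x Y K = 0) →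
    h (p x) (mfderiv 𝓘(ℝ, E) 𝓘(ℝ, E') p x X) (mfderiv 𝓘(ℝ, E) 𝓘(ℝ, E') p x Y) = g x X Y

/-- The Riemannian submersion metric induced by `g`; it is unique when `p` is a surjective
submersion, and exists when `p` is the projection onto the quotient by a free isometric action. -/
def submersionMetric (p : N → N') (g : MetricTensor E N) : MetricTensor E' N' :=
  Classical.epsilon (IsSubmersionMetric p g)

/-- The form `η'` on `N'` with `p^* η' = η`; it is unique when `p` is a surjective submersion, and
exists when `p` is the projection onto a quotient by a free action and `η` is invariant and
horizontal. -/
def inducedForm {k : ℕ} (p : N → N') (η : DiffForm E N k F) : DiffForm E' N' k F :=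
  Classical.epsilon fun η' : DiffForm E' N' k F => η'.pullback p = η

end Generic

/-! ## The metrics `g₀`, `h₀`, `h₀^T` -/

/-- The Lie algebra `𝔱` of `T`, identified with `ℝ²` via `(i t₁, i t₂) ↦ (t₁, t₂)`. -/
abbrev LieT : Type := Fin 2 → ℝ

/-- The exponential map `𝔱 → T`. -/
def expT (Z : LieT) : Torus := (Circle.exp (Z 0), Circle.exp (Z 1))

/-- The canonical basis `Z₁, Z₂` of `𝔱`. -/
def basisZ (k : Fin 2) : LieT := Pi.single k 1

/-- The round metric `g₀` on `M_princ`. -/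
def metricG0 (m : ℕ) : MetricTensor (ModS m) (princ m) :=
  MetricTensor.pullback (E' := Amb m) (N' := Amb m) incl fun _ => innerₗ (Amb m)

/-- The metric `h₀` on `G \ M_princ`. -/
def metricH0 (m : ℕ) : MetricTensor (ModQ m) (Quo m) := submersionMetric projG (metricG0 m)

/-- The restriction of `h₀` to `G \ M̂`. -/
def metricH0Hat (m : ℕ) : MetricTensor (ModQ m) (hat m) :=
  (metricH0 m).pullback (Subtype.val : hat m → Quo m)

/-- The metric `h₀^T` on `T \ (G \ M̂)`. -/
def metricH0T (m : ℕ) : MetricTensor (ModB m) (Base m) := submersionMetric projT (metricH0Hat m)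

/-- The fundamental vector field `Z^*` on `G \ M_princ`. -/
def fundField {m : ℕ} (Z : LieT) (q : Quo m) : TangentSpace 𝓘(ℝ, ModQ m) q :=
  (mfderiv 𝓘(ℝ, ℝ) 𝓘(ℝ, ModQ m) (fun t : ℝ => expT (t • Z) • q) 0 (1 : ℝ) : ModQ m)

/-- The fundamental vector field `Z^*` on `G \ M̂`. -/
def fundFieldHat {m : ℕ} (Z : LieT) (q : hat m) : TangentSpace 𝓘(ℝ, ModQ m) q :=
  (mfderiv 𝓘(ℝ, ℝ) 𝓘(ℝ, ModQ m) (fun t : ℝ => expT (t • Z) • q) 0 (1 : ℝ) : ModQ m)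

/-! ## The groups `Aut^T_{h₀}(G \ M_princ)`, its image in the isometry group, and the set `𝒟` -/

/-- The diffeomorphisms of `G \ M_princ`. -/
abbrev DiffeoQuo (m : ℕ) : Type := Quo m ≃ₘ^∞⟮𝓘(ℝ, ModQ m), 𝓘(ℝ, ModQ m)⟯ Quo m

/-- The diffeomorphisms of `T \ (G \ M̂)`. -/
abbrev DiffeoBase (m : ℕ) : Type := Base m ≃ₘ^∞⟮𝓘(ℝ, ModB m), 𝓘(ℝ, ModB m)⟯ Base m

/-- `F` is `T`-preserving: conjugation by `F` maps `T` to `T`. -/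
def IsTPreserving {m : ℕ} (F : DiffeoQuo m) : Prop :=
  ∀ z : Torus, ∃ z' : Torus, ∀ q : Quo m, F (z • F.symm q) = z' • q

/-- `Ψ = Ψ_F`: the automorphism of `𝔱` is the differential of the automorphism
`z ↦ F ∘ z ∘ F⁻¹` of `T`, i.e. it corresponds to it under the exponential map of `T`. -/
def IsDifferentialOfConj {m : ℕ} (F : DiffeoQuo m) (Ψ : LieT ≃L[ℝ] LieT) : Prop :=
  ∀ (Z : LieT) (q : Quo m), F (expT Z • F.symm q) = expT (Ψ Z) • q

/-- The diffeomorphism `Φ` of `T \ (G \ M̂)` is induced by `F`, which maps `G \ M̂` to itself. -/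
def IsInducedBy {m : ℕ} (F : DiffeoQuo m) (Φ : DiffeoBase m) : Prop :=
  ∀ q : hat m, ∃ h : F q ∈ hat m, Φ (projT q) = projT ⟨F q, h⟩

/-- `Φ` is an isometry of `(T \ (G \ M̂), h₀^T)`. -/
def IsIsometryBase {m : ℕ} (Φ : DiffeoBase m) : Prop :=
  (metricH0T m).pullback Φ = metricH0T m

/-- The group `Aut^T_{h₀}(G \ M_princ)`: the `T`-preserving diffeomorphisms of `G \ M_princ` that
preserve the `h₀`-norm of vectors tangent to the `T`-orbits in `G \ M̂` and induce an isometry of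
`(T \ (G \ M̂), h₀^T)`. -/
def AutT (m : ℕ) : Set (DiffeoQuo m) :=
  {F | IsTPreserving F ∧
    (∀ q ∈ hat m, ∀ Z : LieT,
      metricH0 m (F q) (mfderiv 𝓘(ℝ, ModQ m) 𝓘(ℝ, ModQ m) F q (fundField Z q))
        (mfderiv 𝓘(ℝ, ModQ m) 𝓘(ℝ, ModQ m) F q (fundField Z q)) =
      metricH0 m q (fundField Z q) (fundField Z q)) ∧
    ∃ Φ : DiffeoBase m, IsInducedBy F Φ ∧ IsIsometryBase Φ}

/-- The group of isometries of `(T \ (G \ M̂), h₀^T)` induced by the elements of `AutT m`. -/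
def AutTBar (m : ℕ) : Set (DiffeoBase m) :=
  {Φ | ∃ F ∈ AutT m, IsInducedBy F Φ}

/-- The set `𝒟 = {Ψ_F | F ∈ Aut^T_{h₀}(G \ M_princ)}` of automorphisms of `𝔱`. -/
def setD (m : ℕ) : Set (LieT ≃L[ℝ] LieT) :=
  {Ψ | ∃ F ∈ AutT m, IsDifferentialOfConj F Ψ}

/-! ## The linear maps `j : 𝔱 → 𝔰𝔲(m)` -/

/-- The Lie algebra `𝔰𝔲(m)` of trace-free skew-Hermitian matrices. -/
def su (m : ℕ) : Submodule ℝ (Matrix (Fin m) (Fin m) ℂ) where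
  carrier := {A | Aᴴ = -A ∧ A.trace = 0}
  add_mem' := by
    rintro A B ⟨hA, hA'⟩ ⟨hB, hB'⟩
    exact ⟨by rw [Matrix.conjTranspose_add, hA, hB, neg_add], by
      rw [Matrix.trace_add, hA', hB', add_zero]⟩
  zero_mem' := by simp
  smul_mem' := by
    rintro c A ⟨hA, hA'⟩
    exact ⟨by rw [Matrix.conjTranspose_smul, hA]; simp, by rw [Matrix.trace_smul, hA', smul_zero]⟩

/-- The group `ℰ` of automorphisms of `𝔱` with `φ Z_k ∈ {± Z₁, ± Z₂}` for `k = 1, 2`. -/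
def setE : Set (LieT ≃L[ℝ] LieT) :=
  {φ | ∀ k, φ (basisZ k) ∈
    ({basisZ 0, -basisZ 0, basisZ 1, -basisZ 1} : Set LieT)}

/-- The maps `ℂ^m → ℂ^m` in `SU(m) ∪ SU(m) ∘ conj`. -/
def IsUnitaryOrAnti {m : ℕ} (a : (Fin m → ℂ) → (Fin m → ℂ)) : Prop :=
  ∃ A ∈ Matrix.specialUnitaryGroup (Fin m) ℂ, (∀ u, a u = A *ᵥ u) ∨ (∀ u, a u = A *ᵥ star u)

/-- `j` and `j'` are equivalent: `j'_Z = a j_{Ψ(Z)} a⁻¹` for some `a ∈ SU(m) ∪ SU(m) ∘ conj` and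
some `Ψ ∈ ℰ`. -/
def AreEquivalent {m : ℕ} (j j' : LieT →ₗ[ℝ] su m) : Prop :=
  ∃ a : (Fin m → ℂ) → (Fin m → ℂ), IsUnitaryOrAnti a ∧ ∃ Ψ ∈ setE, ∀ (Z : LieT) (u : Fin m → ℂ),
    (j' Z : Matrix (Fin m) (Fin m) ℂ) *ᵥ a u = a ((j (Ψ Z) : Matrix (Fin m) (Fin m) ℂ) *ᵥ u)

/-- `j` is generic: no nonzero element of `𝔰𝔲(m)` commutes with both `j_{Z₁}` and `j_{Z₂}`. -/
def IsGeneric {m : ℕ} (j : LieT →ₗ[ℝ] su m) : Prop :=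
  ∀ X ∈ su m, (∀ k, Commute X (j (basisZ k) : Matrix (Fin m) (Fin m) ℂ)) → X = 0

/-! ## The forms `κ`, `λ`, `ω_λ`, `Ω_λ` -/

/-- The component `u` of `(u, v)`. -/
def partU {m : ℕ} (x : Amb m) : Fin m → ℂ := fun k => x (.inl k)

/-- The vector `(u, 0)`. -/
def ofU {m : ℕ} (u : Fin m → ℂ) : Amb m := WithLp.toLp 2 (Sum.elim u 0)

/-- The `k`-th component
`κ^k_{(u,v)}(U, V) = ‖u‖² ⟨j_{Z_k} u, U⟩ - ⟨U, i u⟩ ⟨j_{Z_k} u, i u⟩`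
of the `1`-form `κ` on `ℂ^{m+2}`, with real inner products. -/
def kappaComp {m : ℕ} (j : LieT →ₗ[ℝ] su m) (k : Fin 2) (x : Amb m) : Amb m →L[ℝ] ℝ :=
  let ju : Amb m := ofU ((j (basisZ k) : Matrix (Fin m) (Fin m) ℂ) *ᵥ partU x)
  let iu : Amb m := ofU (Complex.I • partU x)
  ‖ofU (partU x)‖ ^ 2 • innerSL ℝ ju - inner ℝ ju iu • innerSL ℝ iu

/-- The `𝔱`-valued `1`-form `κ` on `ℂ^{m+2}`. -/
def kappaAmb {m : ℕ} (j : LieT →ₗ[ℝ] su m) : DiffForm (Amb m) (Amb m) 1 LieT :=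
  fun x => ContinuousAlternatingMap.ofSubsingleton ℝ (Amb m) LieT 0
    (ContinuousLinearMap.pi fun k => kappaComp j k x)

/-- The admissible `𝔱`-valued `1`-form `κ` on the sphere. -/
def kappa {m : ℕ} (j : LieT →ₗ[ℝ] su m) : DiffForm (ModS m) (Sph m) 1 LieT :=
  (kappaAmb j).pullback (Subtype.val : Sph m → Amb m)

/-- The `1`-form `λ` on `G \ M_princ` induced by `κ`. -/
def lam {m : ℕ} (j : LieT →ₗ[ℝ] su m) : DiffForm (ModQ m) (Quo m) 1 LieT :=
  inducedForm (E := ModS m) (N := princ m) projG ((kappa j).pullback (Subtype.val : princ m → Sph m))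

/-- `θ` is the connection form of the principal `T`-bundle `π` associated with `h₀`: it maps `Z^*`
to `Z`, and its kernel is the `h₀`-orthogonal complement of the vertical space. -/
def IsConnectionForm {m : ℕ} (θ : DiffForm (ModQ m) (hat m) 1 LieT) : Prop :=
  ∀ q : hat m, (∀ Z : LieT, θ q (fun _ => fundFieldHat Z q) = Z) ∧
    ∀ X : TangentSpace 𝓘(ℝ, ModQ m) q,
      θ q (fun _ => X) = 0 ↔ ∀ Z : LieT, metricH0Hat m q X (fundFieldHat Z q) = 0

/-- The connection form `ω₀` associated with `h₀`; there is exactly one form as required. -/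
def omegaZero (m : ℕ) : DiffForm (ModQ m) (hat m) 1 LieT := Classical.epsilon IsConnectionForm

/-- The connection form `ω_λ = ω₀ + λ` on `G \ M̂`. -/
def omegaLam {m : ℕ} (j : LieT →ₗ[ℝ] su m) : DiffForm (ModQ m) (hat m) 1 LieT :=
  omegaZero m + (lam j).pullback (Subtype.val : hat m → Quo m)

/-- The curvature form `Ω_λ` on `T \ (G \ M̂)`, defined by `π^* Ω_λ = d ω_λ`. -/
def curvature {m : ℕ} (j : LieT →ₗ[ℝ] su m) : DiffForm (ModB m) (Base m) 2 LieT :=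
  inducedForm projT (omegaLam j).d

/-! ## The conditions (N) and (G) -/

/-- Condition (N): `Ω` is not of the form `Ψ ∘ Φ^* Ω'` with `Ψ ∈ 𝒟` and `Φ` in the group of induced
isometries. -/
def ConditionN {m : ℕ} (Ω Ω' : DiffForm (ModB m) (Base m) 2 LieT) : Prop :=
  ¬ ∃ Ψ ∈ setD m, ∃ Φ ∈ AutTBar m, Ω = (Ω'.pullback Φ).postcomp Ψ

/-- `Φ` is a one-parameter group in the group of induced isometries, i.e. a continuous
homomorphism from `ℝ`. -/
def IsOneParameterGroup {m : ℕ} (Φ : ℝ → DiffeoBase m) : Prop :=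
  (∀ t, Φ t ∈ AutTBar m) ∧ (∀ s t b, Φ (s + t) b = Φ s (Φ t b)) ∧
    Continuous fun p : ℝ × Base m => Φ p.1 p.2

/-- Property (G): no nontrivial one-parameter group in the group of induced isometries
preserves `Ω`. -/
def PropertyG {m : ℕ} (Ω : DiffForm (ModB m) (Base m) 2 LieT) : Prop :=
  ∀ Φ : ℝ → DiffeoBase m, IsOneParameterGroup Φ → (∀ t, Ω.pullback (Φ t) = Ω) →
    ∀ t b, Φ t b = b

end SphereQuotient

end

noncomputable section

namespace SphereQuotient

set_option linter.unusedSectionVars false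

section

/-! ## Block-diagonal maps and the differentials of the coordinates -/

/-! All computations take place on the open cone `{u ≠ 0}` of `ℂ^m × ℂ²`. The metrics, forms and
projections lift to it as expressions invariant under positive scaling. `h₀` is the Euclidean
product over `‖y‖²` with the directions `y` and `(iu, 0)` removed, `h₀^T` loses the directions `(0,
i v_l)` as well, `ω₀` is `Im (dv_l / v_l)`, and `λ` is `κ / ‖y‖⁴`. The components of `ω₀` are
closed, so the curvature is just `dλ` (`curvature_apply`).

An element `F` of `Aut` carries `Z^*` to `(Ψ_F Z)^*`, and `|Z^*|² = ∑ Z_l² |v_l|² / ‖y‖²`.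
Preservation of these lengths at points of all orbit types, together with the integrality of `Ψ_F`,
makes `Ψ_F` a signed permutation of `Z₁, Z₂`, and `F` permutes the orbit lengths accordingly
(`exists_perm`). Hence an induced isometry `Φ` permutes the levels `{|v_l| = s_l ‖u‖}`. Each level
is a copy of `ℂP^{m-1}` on which `h₀^T` is a constant multiple of the Fubini–Study metric
(`formT_level`).

If `Φ` maps a level to itself, it preserves Fubini–Study speed there. Along a curve of unit speed
the transition probability `f` with a fixed line satisfies `|f'| ≤ 2 √(f (1 - f))`. Comparison with
`cos²` along a geodesic shows that `Φ` cannot decrease transition probabilities, and neither can its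
inverse (`transB_map`). By Wigner's theorem (`wigner`), `Φ` is given on the level by a unitary or
antiunitary map `B`.

On tangent vectors `U, W ⊥ u` of a level, with `‖u‖ = 1`, the `k`-th component of the curvature is a
constant times `⟨j_k U, W⟩ - ⟨j_k u, iu⟩ ⟨iU, W⟩` (`curvature_level`), and this expression
determines a trace-free skew-Hermitian matrix (`eq_zero_of_levelCurv`). Thus `Ω_λ = Ψ ∘ Φ^* Ω_λ'`
turns into `j'_k B = B (± j_{σ k})` (`intertwines`). On the level `s = (1, 1)`, which every induced
isometry preserves, this is an equivalence of `j` and `j'`, which proves (N).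

For (G), the square of a permutation of two indices is trivial, so each member of a one-parameter
group preserves every level. If the group preserves the curvature, the map `B` of `Φ_{t/2}` on the
level of a point commutes with both `j_k`. Its square is complex linear with the same property,
hence scalar when `j` is generic, so `Φ_t` fixes the point. -/

/-- The real-linear map `(u, v) ↦ (c u, d₁ v₁, d₂ v₂)`. -/
def blockMul {m : ℕ} (c : ℂ) (d : Fin 2 → ℂ) : Amb m →L[ℝ] Amb m :=
  LinearMap.toContinuousLinearMap
    { toFun := fun x => WithLp.toLp 2
        (Sum.elim (fun k => c * x (.inl k)) (fun l => d l * x (.inr l)))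
      map_add' := fun x y => by
        ext i; rcases i with k | l <;> simp [mul_add]
      map_smul' := fun r x => by
        ext i; rcases i with k | l <;> simp [mul_left_comm] }

@[simp] theorem blockMul_inl {m : ℕ} (c : ℂ) (d : Fin 2 → ℂ) (x : Amb m) (k : Fin m) :
    blockMul c d x (.inl k) = c * x (.inl k) := rfl

@[simp] theorem blockMul_inr {m : ℕ} (c : ℂ) (d : Fin 2 → ℂ) (x : Amb m) (l : Fin 2) :
    blockMul c d x (.inr l) = d l * x (.inr l) := rfl

theorem amb_ext' {m : ℕ} {x y : Amb m} (hu : ∀ k, x (.inl k) = y (.inl k))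
    (hv : ∀ l, x (.inr l) = y (.inr l)) : x = y := amb_ext hu (hv 0) (hv 1)

theorem blockMul_comm {m : ℕ} (c c' : ℂ) (d d' : Fin 2 → ℂ) (x : Amb m) :
    blockMul c d (blockMul c' d' x) = blockMul c' d' (blockMul c d x) :=
  amb_ext' (fun k => by simp; ring) (fun l => by simp; ring)

theorem actT_eq_blockMul {m : ℕ} (t : Torus) (x : Amb m) :
    actT t x = blockMul 1 ![(t.1 : ℂ), (t.2 : ℂ)] x := by
  refine amb_ext (fun k => by simp) ?_ ?_ <;> simp

/-- Scalings and the actions of `G` and `T` are all block multiplications with entries of one common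
modulus. Such a map is a multiple of an isometry, which is what makes normalised tensors invariant.
-/
theorem inner_blockMul {m : ℕ} {c : ℂ} {d : Fin 2 → ℂ} {r : ℝ} (hc : ‖c‖ = r) (hd : ∀ l, ‖d l‖ = r)
    (x y : Amb m) : inner ℝ (blockMul c d x) (blockMul c d y) = r ^ 2 * inner ℝ x y := by
  have h : ∀ a z w : ℂ, ‖a‖ = r →
      inner ℝ (a * z) (a * w) = r ^ 2 * inner ℝ z w := by
    intro a z w ha
    rw [Complex.inner, Complex.inner, ← ha, ← Complex.normSq_eq_norm_sq, Complex.normSq_apply]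
    simp only [map_mul, Complex.mul_re, Complex.mul_im, Complex.conj_re, Complex.conj_im]
    ring
  have key : ∀ z w : Amb m, inner ℝ z w = ∑ i, inner ℝ (z i) (w i) := fun z w => by
    exact PiLp.inner_apply z w
  rw [key, key, Finset.mul_sum]
  refine Finset.sum_congr rfl fun i _ => ?_
  rcases i with k | l
  · exact h _ _ _ hc
  · exact h _ _ _ (hd l)

/-- The cone over `M_princ`. -/
def coneG (m : ℕ) : Set (Amb m) := {y | ∃ k, y (.inl k) ≠ 0}

/-- The cone over `M̂`. -/
def coneT (m : ℕ) : Set (Amb m) := {y | y ∈ coneG m ∧ ∀ l, y (.inr l) ≠ 0}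

theorem isOpen_coneG (m : ℕ) : IsOpen (coneG m) := by
  have : coneG m = ⋃ k, {y : Amb m | y (.inl k) ≠ 0} := by ext; simp [coneG]
  rw [this]
  exact isOpen_iUnion fun k => isOpen_ne_fun (by fun_prop) continuous_const

theorem isOpen_coneT (m : ℕ) : IsOpen (coneT m) := by
  have : coneT m = coneG m ∩ ⋂ l, {y : Amb m | y (.inr l) ≠ 0} := by ext; simp [coneT, -Fin.forall_fin_two]
  rw [this]
  exact (isOpen_coneG m).inter
    (isOpen_iInter_of_finite fun l => isOpen_ne_fun (by fun_prop) continuous_const)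

theorem ne_zero_of_mem_coneG {m : ℕ} {y : Amb m} (hy : y ∈ coneG m) : y ≠ 0 := by
  rintro rfl
  obtain ⟨k, hk⟩ := hy
  simp at hk

theorem blockMul_mem_coneG {m : ℕ} {c : ℂ} (hc : c ≠ 0) (d : Fin 2 → ℂ) {y : Amb m}
    (hy : y ∈ coneG m) : blockMul c d y ∈ coneG m := by
  obtain ⟨k, hk⟩ := hy
  exact ⟨k, by simp [hc, hk]⟩

theorem blockMul_mem_coneT {m : ℕ} {c : ℂ} (hc : c ≠ 0) {d : Fin 2 → ℂ} (hd : ∀ l, d l ≠ 0)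
    {y : Amb m} (hy : y ∈ coneT m) : blockMul c d y ∈ coneT m :=
  ⟨blockMul_mem_coneG hc d hy.1, fun l => by simp [hd l, hy.2 l]⟩

theorem contDiffAt_coordQ {m : ℕ} {i : Fin m} {y : Amb m} (hy : y (.inl i) ≠ 0) :
    ContDiffAt ℝ ∞ (coordQ i) y := by
  have hc : ∀ k, ContDiffAt ℝ ∞ (fun y : Amb m => y k) y := fun k => by fun_prop
  refine ContDiffAt.prodMk (contDiffAt_pi.2 fun l => ?_) (contDiffAt_pi.2 fun l => ?_)
  · simp only [div_eq_mul_inv]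
    exact (hc _).mul ((hc _).inv hy)
  · simp only [div_eq_mul_inv]
    refine (hc _).mul (ContDiffAt.inv ?_ (by simpa using hy))
    exact Complex.ofRealCLM.contDiff.contDiffAt.comp _ ((hc _).norm ℝ hy)

theorem contDiff_affine {m : ℕ} (i : Fin m) : ContDiff ℝ ∞ (affine i) := by
  refine (PiLp.contDiff_toLp (p := 2)).comp (contDiff_pi.2 fun k => ?_)
  rcases k with k | l
  · exact (contDiff_homog i k).comp contDiff_fst
  · simp only [Sum.elim_inr]
    fun_prop

/-- The coordinates of the `i`-th chart of `T \ (G \ M̂)`. -/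
def coordB {m : ℕ} (i : Fin m) (y : Amb m) : ModB m := logMod (coordQ i y)

/-- The section of `coordB i`. -/
def affineB {m : ℕ} (i : Fin m) (h : ModB m) : Amb m := affine i (expMod h)

theorem coordQ_inr_ne_zero {m : ℕ} {i : Fin m} {y : Amb m} (hy : y (.inl i) ≠ 0)
    (hv : ∀ l, y (.inr l) ≠ 0) (l : Fin 2) : (coordQ i y).2 l ≠ 0 := by
  simp [coordQ, hy, hv l]

theorem contDiffAt_coordB {m : ℕ} {i : Fin m} {y : Amb m} (hy : y (.inl i) ≠ 0)
    (hv : ∀ l, y (.inr l) ≠ 0) : ContDiffAt ℝ ∞ (coordB i) y :=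
  (contDiffAt_logMod (coordQ_inr_ne_zero hy hv)).comp y (contDiffAt_coordQ hy)

theorem contDiff_affineB {m : ℕ} (i : Fin m) : ContDiff ℝ ∞ (affineB i) :=
  (contDiff_affine i).comp contDiff_expMod

theorem coordB_affineB {m : ℕ} (i : Fin m) (h : ModB m) : coordB i (affineB i h) = h := by
  rw [coordB, affineB, coordQ_affine, logMod_expMod]

theorem affine_mem_coneG {m : ℕ} (i : Fin m) (h : ModQ m) : affine i h ∈ coneG m := ⟨i, by simp⟩

theorem affineB_mem_coneT {m : ℕ} (i : Fin m) (h : ModB m) : affineB i h ∈ coneT m :=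
  ⟨affine_mem_coneG i _, fun l => by simp [affineB, expMod]⟩

/-! ### Derivatives along lines -/

theorem hasDerivAt_coord {m : ℕ} (y X : Amb m) (k : Fin m ⊕ Fin 2) :
    HasDerivAt (fun t : ℝ => (y + t • X) k) (X k) 0 := by
  have : HasDerivAt (fun t : ℝ => y k + (t : ℂ) * X k) (1 * X k) 0 :=
    ((Complex.ofRealCLM.hasDerivAt (x := (0 : ℝ))).mul_const (X k)).const_add (y k)
  simpa using this

theorem hasDerivAt_comp_line {V W : Type*} [NormedAddCommGroup V] [NormedSpace ℝ V]
    [NormedAddCommGroup W] [NormedSpace ℝ W] {f : V → W} {y : V} (hf : DifferentiableAt ℝ f y)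
    (X : V) : HasDerivAt (fun t : ℝ => f (y + t • X)) (fderiv ℝ f y X) 0 := by
  have h1 : HasDerivAt (fun t : ℝ => y + t • X) X 0 := by
    simpa using ((hasDerivAt_id (0 : ℝ)).smul_const X).const_add y
  have h2 : HasFDerivAt f (fderiv ℝ f y) (y + (0 : ℝ) • X) := by simpa using hf.hasFDerivAt
  exact h2.comp_hasDerivAt (0 : ℝ) h1

/-- `log ‖f‖` is half of `log ‖f‖²`, and the squared norm is differentiable with an explicit
derivative. -/
theorem hasDerivAt_log_norm {f : ℝ → ℂ} {f' : ℂ} {t : ℝ} (hf : HasDerivAt f f' t) (h0 : f t ≠ 0) :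
    HasDerivAt (fun s => Real.log ‖f s‖) (f' / f t).re t := by
  have h1 : HasDerivAt (fun s => ‖f s‖ ^ 2) (2 * inner ℝ (f t) f') t := hf.norm_sq
  have h2 := (h1.log (by simpa using h0)).const_mul (1 / 2 : ℝ)
  have h3 : (fun s => (1 / 2 : ℝ) * Real.log (‖f s‖ ^ 2)) = fun s => Real.log ‖f s‖ := by
    funext s
    rw [Real.log_pow]
    push_cast
    ring
  rw [h3] at h2
  convert! h2 using 1
  rw [← Complex.normSq_eq_norm_sq, Complex.inner, Complex.div_re]
  have : Complex.normSq (f t) ≠ 0 := by simpa using h0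
  field_simp
  simp

theorem hasDerivAt_norm_of_ne {f : ℝ → ℂ} {f' : ℂ} {t : ℝ} (hf : HasDerivAt f f' t)
    (h0 : f t ≠ 0) : HasDerivAt (fun s => ‖f s‖) (‖f t‖ * (f' / f t).re) t := by
  have h := (hasDerivAt_log_norm hf h0).exp
  have h3 : (fun s => Real.exp (Real.log ‖f s‖)) =ᶠ[nhds t] fun s => ‖f s‖ := by
    filter_upwards [hf.continuousAt.eventually_ne h0] with s hs
    exact Real.exp_log (norm_pos_iff.2 hs)
  rw [Real.exp_log (norm_pos_iff.2 h0)] at h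
  exact h.congr_of_eventuallyEq h3.symm

theorem fderiv_coordQ_fst {m : ℕ} {i : Fin m} {y : Amb m} (hy : y (.inl i) ≠ 0) (X : Amb m)
    (l : Fin (m - 1)) : (fderiv ℝ (coordQ i) y X).1 l =
      (X (.inl (others i l)) * y (.inl i) - y (.inl (others i l)) * X (.inl i)) /
        y (.inl i) ^ 2 := by
  have h := hasDerivAt_comp_line ((contDiffAt_coordQ hy).differentiableAt (by simp)) X
  have h1 : HasDerivAt (fun t : ℝ => (coordQ i (y + t • X)).1 l) _ 0 :=
    hasDerivAt_pi.1 ((ContinuousLinearMap.fst ℝ _ _).hasFDerivAt.comp_hasDerivAt (0 : ℝ) h) l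
  refine h1.unique ?_
  have h2 := (hasDerivAt_coord y X (.inl (others i l))).div (hasDerivAt_coord y X (.inl i))
    (by simpa using hy)
  convert! h2 using 1
  simp

theorem fderiv_coordQ_snd {m : ℕ} {i : Fin m} {y : Amb m} (hy : y (.inl i) ≠ 0) (X : Amb m)
    (l : Fin 2) : (fderiv ℝ (coordQ i) y X).2 l =
      (X (.inr l) - y (.inr l) * (X (.inl i) / y (.inl i)).re) / (‖y (.inl i)‖ : ℂ) := by
  have h := hasDerivAt_comp_line ((contDiffAt_coordQ hy).differentiableAt (by simp)) X
  have h1 : HasDerivAt (fun t : ℝ => (coordQ i (y + t • X)).2 l) _ 0 :=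
    hasDerivAt_pi.1 ((ContinuousLinearMap.snd ℝ _ _).hasFDerivAt.comp_hasDerivAt (0 : ℝ) h) l
  refine h1.unique ?_
  have hn := (hasDerivAt_norm_of_ne (hasDerivAt_coord y X (.inl i)) (by simpa using hy)).ofReal_comp
  have h2 := (hasDerivAt_coord y X (.inr l)).div hn (by simpa using hy)
  have hy' : (‖y (.inl i)‖ : ℂ) ≠ 0 := by simpa using hy
  convert! h2 using 1
  simp
  field_simp

theorem fderiv_coordB_fst {m : ℕ} {i : Fin m} {y : Amb m} (hy : y (.inl i) ≠ 0)
    (hv : ∀ l, y (.inr l) ≠ 0) (X : Amb m) :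
    (fderiv ℝ (coordB i) y X).1 = (fderiv ℝ (coordQ i) y X).1 := by
  have h := hasDerivAt_comp_line ((contDiffAt_coordB hy hv).differentiableAt (by simp)) X
  have h' := hasDerivAt_comp_line ((contDiffAt_coordQ hy).differentiableAt (by simp)) X
  exact ((ContinuousLinearMap.fst ℝ _ _).hasFDerivAt.comp_hasDerivAt (0 : ℝ) h).unique
    ((ContinuousLinearMap.fst ℝ _ _).hasFDerivAt.comp_hasDerivAt (0 : ℝ) h')

theorem fderiv_coordB_snd {m : ℕ} {i : Fin m} {y : Amb m} (hy : y (.inl i) ≠ 0)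
    (hv : ∀ l, y (.inr l) ≠ 0) (X : Amb m) (l : Fin 2) : (fderiv ℝ (coordB i) y X).2 l =
      (X (.inr l) / y (.inr l)).re - (X (.inl i) / y (.inl i)).re := by
  have h := hasDerivAt_comp_line ((contDiffAt_coordB hy hv).differentiableAt (by simp)) X
  have h1 : HasDerivAt (fun t : ℝ => (coordB i (y + t • X)).2 l) _ 0 :=
    hasDerivAt_pi.1 ((ContinuousLinearMap.snd ℝ _ _).hasFDerivAt.comp_hasDerivAt (0 : ℝ) h) l
  refine h1.unique ?_
  have h2 := (hasDerivAt_log_norm (hasDerivAt_coord y X (.inr l)) (by simpa using hv l)).sub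
    (hasDerivAt_log_norm (hasDerivAt_coord y X (.inl i)) (by simpa using hy))
  have h3 : (fun t : ℝ => Real.log ‖(y + t • X) (.inr l)‖ - Real.log ‖(y + t • X) (.inl i)‖)
      =ᶠ[nhds 0] fun t : ℝ => (coordB i (y + t • X)).2 l := by
    filter_upwards [(hasDerivAt_coord y X (.inr l)).continuousAt.eventually_ne
      (by simpa using hv l), (hasDerivAt_coord y X (.inl i)).continuousAt.eventually_ne
      (by simpa using hy)] with t h4 h5
    simp only [coordB, logMod, coordQ, norm_div, Complex.norm_real, norm_norm]
    rw [Real.log_div (norm_ne_zero_iff.2 h4) (norm_ne_zero_iff.2 h5)]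
  convert! h2.congr_of_eventuallyEq h3.symm using 1
  simp

/-! ### The kernels -/

theorem exists_others {m : ℕ} {i k : Fin m} (h : k ≠ i) : ∃ l, (others i l : Fin m) = k :=
  ⟨(others i).symm ⟨k, h⟩, by simp⟩

theorem inl_eq_of_fderiv_fst_eq_zero {m : ℕ} {i : Fin m} {y : Amb m} (hy : y (.inl i) ≠ 0)
    {X : Amb m} (hX : (fderiv ℝ (coordQ i) y X).1 = 0) (k : Fin m) :
    X (.inl k) = X (.inl i) / y (.inl i) * y (.inl k) := by
  by_cases hk : k = i
  · subst hk; field_simp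
  · obtain ⟨l, rfl⟩ := exists_others hk
    have h := fderiv_coordQ_fst hy X l
    rw [hX, Pi.zero_apply, eq_comm, div_eq_zero_iff] at h
    rcases h with h | h
    · field_simp
      linear_combination h
    · exact absurd h (pow_ne_zero 2 hy)

/-- The fibres of the chart are the orbits of positive scaling and of `G`. With `c = a + ib` the
displayed vector is `a y + b (iu, 0)`. -/
theorem fderiv_coordQ_eq_zero_iff {m : ℕ} {i : Fin m} {y : Amb m} (hy : y (.inl i) ≠ 0)
    (X : Amb m) : fderiv ℝ (coordQ i) y X = 0 ↔ ∃ c : ℂ, X = blockMul c (fun _ => c.re) y := by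
  constructor
  · intro h
    refine ⟨X (.inl i) / y (.inl i), amb_ext' (fun k => ?_) fun l => ?_⟩
    · exact inl_eq_of_fderiv_fst_eq_zero hy (by rw [h]; rfl) k
    · have h1 := fderiv_coordQ_snd hy X l
      rw [h] at h1
      have hy' : (‖y (.inl i)‖ : ℂ) ≠ 0 := by simpa using hy
      have h2 := (div_eq_zero_iff.1 h1.symm).resolve_right hy'
      simp only [blockMul_inr]
      linear_combination h2
  · rintro ⟨c, rfl⟩
    refine Prod.ext (funext fun l => ?_) (funext fun l => ?_)
    · rw [fderiv_coordQ_fst hy]; simp; left; ring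
    · rw [fderiv_coordQ_snd hy]; simp [hy]; ring

/-- The torus adds two independent rotations of `v₁, v₂`. The real parts still agree because the
only radial freedom is the common scaling. -/
theorem fderiv_coordB_eq_zero_iff {m : ℕ} {i : Fin m} {y : Amb m} (hy : y (.inl i) ≠ 0)
    (hv : ∀ l, y (.inr l) ≠ 0) (X : Amb m) : fderiv ℝ (coordB i) y X = 0 ↔
      ∃ (c : ℂ) (d : Fin 2 → ℂ), (∀ l, (d l).re = c.re) ∧ X = blockMul c d y := by
  constructor
  · intro h
    refine ⟨X (.inl i) / y (.inl i), fun l => X (.inr l) / y (.inr l), fun l => ?_,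
      amb_ext' (fun k => ?_) fun l => ?_⟩
    · have h1 := fderiv_coordB_snd hy hv X l
      rw [h] at h1
      have h2 : (0 : ℝ) = _ := h1
      linarith
    · exact inl_eq_of_fderiv_fst_eq_zero hy (by rw [← fderiv_coordB_fst hy hv, h]; rfl) k
    · simp [hv l]
  · rintro ⟨c, d, hcd, rfl⟩
    refine Prod.ext ?_ (funext fun l => ?_)
    · rw [fderiv_coordB_fst hy hv]
      refine funext fun l => ?_
      rw [fderiv_coordQ_fst hy]; simp; left; ring
    · rw [fderiv_coordB_snd hy hv]; simp [hy, hv l, hcd l]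

end

section

/-! ## The projections from the cones -/

variable {m : ℕ}

/-- The point of `M_princ` on the ray through `y`. -/
def coneProj (y : Amb m) (hy : y ∈ coneG m) : princ m :=
  ⟨⟨‖y‖⁻¹ • y, by
      have := norm_pos_iff.2 (ne_zero_of_mem_coneG hy)
      simp [norm_smul, this.ne']⟩,
    (mem_princ_iff _).2 (by
      obtain ⟨k, hk⟩ := hy
      exact ⟨k, by simp [hk, ne_zero_of_mem_coneG ⟨k, hk⟩]⟩)⟩

theorem incl_coneProj (y : Amb m) (hy : y ∈ coneG m) : incl (coneProj y hy) = ‖y‖⁻¹ • y := rfl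

theorem incl_mem_coneG (x : princ m) : incl x ∈ coneG m := (mem_princ_iff _).1 x.2

theorem norm_incl (x : princ m) : ‖incl x‖ = 1 := by simp [incl]

theorem coneProj_incl (x : princ m) : coneProj (incl x) (incl_mem_coneG x) = x :=
  incl_injective (by rw [incl_coneProj, norm_incl]; simp)

variable [NeZero m]

/-- The projection from the cone over `M_princ` to `G \ M_princ`. -/
def qG (y : Amb m) : Quo m :=
  -- Off the cone the value is an arbitrary base point. It needs an index `0`, hence `m ≠ 0`.
  open Classical in if h : y ∈ coneG m then projG (coneProj y h) else projG (secG 0 0)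

theorem qG_of_mem {y : Amb m} (hy : y ∈ coneG m) : qG y = projG (coneProj y hy) := by
  simp [qG, hy]

theorem qG_incl (x : princ m) : qG (incl x) = projG x := by
  rw [qG_of_mem (incl_mem_coneG x), coneProj_incl]

theorem qG_surjective (q : Quo m) : ∃ x : princ m, qG (incl x) = q := by
  obtain ⟨x, rfl⟩ := (isQuotientMap_projG m).surjective q
  exact ⟨x, qG_incl x⟩

theorem qG_mem_domQ {y : Amb m} (hy : y ∈ coneG m) (i : Fin m) :
    qG y ∈ domQ i ↔ y (.inl i) ≠ 0 := by
  rw [qG_of_mem hy, projG_mem_domQ, incl_coneProj]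
  simp [ne_zero_of_mem_coneG hy]

theorem mapQ_qG {y : Amb m} (hy : y ∈ coneG m) (i : Fin m) : mapQ i (qG y) = coordQ i y := by
  rw [qG_of_mem hy, mapQ_projG, incl_coneProj,
    coordQ_smul _ (inv_pos.2 (norm_pos_iff.2 (ne_zero_of_mem_coneG hy)))]

theorem eq_of_mapQ_eq {i : Fin m} {p q : Quo m} (hp : p ∈ domQ i) (hq : q ∈ domQ i)
    (h : mapQ i p = mapQ i q) : p = q := (chartQ i).injOn hp hq h

theorem qG_affine (i : Fin m) (h : ModQ m) : qG (affine i h) = projG (secG i h) := by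
  refine eq_of_mapQ_eq (i := i) ((qG_mem_domQ (affine_mem_coneG i h) i).2 (by simp)) ?_ ?_
  · simp [projG_mem_domQ, incl_secG, affine_ne_zero]
  · rw [mapQ_qG (affine_mem_coneG i h), mapQ_projG, coordQ_secG]

theorem qG_affine_coordQ {y : Amb m} {i : Fin m} (hy : y (.inl i) ≠ 0) :
    qG (affine i (coordQ i y)) = qG y := by
  have h : y ∈ coneG m := ⟨i, hy⟩
  refine eq_of_mapQ_eq ((qG_mem_domQ (affine_mem_coneG i _) i).2 (by simp))
    ((qG_mem_domQ h i).2 hy) ?_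
  rw [mapQ_qG h, mapQ_qG (affine_mem_coneG i _), coordQ_affine]

theorem continuousAt_qG {y : Amb m} (hy : y ∈ coneG m) : ContinuousAt qG y := by
  obtain ⟨i, hi⟩ := hy
  have h1 : ContinuousAt (fun z => projG (secG i (coordQ i z))) y :=
    ((isQuotientMap_projG m).continuous.comp (continuous_secG i)).continuousAt.comp
      (contDiffAt_coordQ hi).continuousAt
  refine h1.congr ?_
  have : ContinuousAt (fun z : Amb m => z (.inl i)) y := by fun_prop
  filter_upwards [this.eventually_ne hi] with z hz
  rw [← qG_affine, qG_affine_coordQ hz]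

/-- The index of the preferred chart at a point of `G \ M_princ`. -/
def idxQ (q : Quo m) : Fin m := (exists_mem_domQ q).choose

theorem mem_domQ_idxQ (q : Quo m) : q ∈ domQ (idxQ q) := (exists_mem_domQ q).choose_spec

theorem inl_idxQ_ne_zero {y : Amb m} (hy : y ∈ coneG m) : y (.inl (idxQ (qG y))) ≠ 0 :=
  (qG_mem_domQ hy _).1 (mem_domQ_idxQ _)

/-- The differential of `qG` in the preferred chart. -/
def dQ (y : Amb m) : Amb m →L[ℝ] ModQ m := fderiv ℝ (coordQ (idxQ (qG y))) y

/-- Tangent spaces are identified with the model space through the preferred chart at the point, so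
differentials of the projections from the cone are ordinary derivatives of coordinate functions. -/
theorem hasMFDerivAt_iff_of_vectorSpace {V H : Type*} [NormedAddCommGroup V] [NormedSpace ℝ V]
    [NormedAddCommGroup H] [NormedSpace ℝ H] {M : Type*} [TopologicalSpace M] [ChartedSpace H M]
    {f : V → M} {y : V} {D : V →L[ℝ] H} :
    HasMFDerivAt 𝓘(ℝ, V) 𝓘(ℝ, H) f y D ↔
      ContinuousAt f y ∧ HasFDerivAt (fun z => chartAt H (f y) (f z)) D y := by
  unfold HasMFDerivAt
  simp only [writtenInExtChartAt, mfld_simps]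
  exact and_congr_right fun _ => hasFDerivWithinAt_univ (𝕜 := ℝ) (E := V) (F := H)
    (f := fun z => chartAt H (f y) (f z)) (f' := D)

theorem hasMFDerivAt_qG {y : Amb m} (hy : y ∈ coneG m) :
    HasMFDerivAt 𝓘(ℝ, Amb m) 𝓘(ℝ, ModQ m) qG y (dQ y) := by
  refine hasMFDerivAt_iff_of_vectorSpace.2 ⟨continuousAt_qG hy, ?_⟩
  have h := ((contDiffAt_coordQ (inl_idxQ_ne_zero hy)).differentiableAt (by simp)).hasFDerivAt
  refine h.congr_of_eventuallyEq ?_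
  filter_upwards [(isOpen_coneG m).mem_nhds hy] with z hz
  exact mapQ_qG hz _

/-- The projection from the cone over `M̂` to `G \ M̂`. -/
def qHat (y : Amb m) : hat m :=
  open Classical in if h : y ∈ coneT m then ⟨qG y, by
    rw [qG_of_mem h.1, projG_mem_hat]
    intro l
    simp [incl_coneProj, h.2 l, ne_zero_of_mem_coneG h.1]⟩ else secT 0 0

theorem coe_qHat {y : Amb m} (hy : y ∈ coneT m) : (qHat y : Quo m) = qG y := by
  simp [qHat, hy]

theorem qHat_surjective (q : hat m) : ∃ x : princ m, incl x ∈ coneT m ∧ qHat (incl x) = q := by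
  obtain ⟨q, hq⟩ := q
  obtain ⟨x, rfl⟩ := (isQuotientMap_projG m).surjective q
  have h : incl x ∈ coneT m := ⟨incl_mem_coneG x, (projG_mem_hat x).1 hq⟩
  exact ⟨x, h, Subtype.ext ((coe_qHat h).trans (qG_incl x))⟩

theorem continuousAt_qHat {y : Amb m} (hy : y ∈ coneT m) : ContinuousAt qHat y := by
  rw [Topology.IsInducing.subtypeVal.continuousAt_iff]
  refine (continuousAt_qG hy.1).congr ?_
  filter_upwards [(isOpen_coneT m).mem_nhds hy] with z hz
  exact (coe_qHat hz).symm

theorem hasMFDerivAt_qHat {y : Amb m} (hy : y ∈ coneT m) :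
    HasMFDerivAt 𝓘(ℝ, Amb m) 𝓘(ℝ, ModQ m) qHat y (dQ y) := by
  refine hasMFDerivAt_iff_of_vectorSpace.2 ⟨continuousAt_qHat hy, ?_⟩
  have h := ((contDiffAt_coordQ (inl_idxQ_ne_zero hy.1)).differentiableAt (by simp)).hasFDerivAt
  refine h.congr_of_eventuallyEq ?_
  filter_upwards [(isOpen_coneT m).mem_nhds hy] with z hz
  have : chartAt (ModQ m) (qHat y) (qHat z) = mapQ (idxQ (qHat y : Quo m)) (qHat z : Quo m) := rfl
  rw [this, coe_qHat hy, coe_qHat hz, mapQ_qG hz.1]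

/-- The preferred chart of an open subset is the restriction of the one of the ambient manifold, so
the inclusion reads as the identity. -/
theorem hasMFDerivAt_opens_val {E M : Type*} [NormedAddCommGroup E] [NormedSpace ℝ E]
    [TopologicalSpace M] [ChartedSpace E M] {U : TopologicalSpace.Opens M} (q : U) :
    HasMFDerivAt 𝓘(ℝ, E) 𝓘(ℝ, E) (Subtype.val : U → M) q (ContinuousLinearMap.id ℝ E) := by
  refine ⟨continuous_subtype_val.continuousAt, ?_⟩
  simp only [mfld_simps]
  refine HasFDerivAt.hasFDerivWithinAt (𝕜 := ℝ) (E := E) (F := E)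
    ((hasFDerivAt_id (chartAt E q q)).congr_of_eventuallyEq ?_)
  have h : (chartAt E q).target ∈ nhds (chartAt E q q) :=
    (chartAt E q).open_target.mem_nhds ((chartAt E q).map_source (mem_chart_source _ q))
  filter_upwards [h] with z hz
  exact (chartAt E q).right_inv hz

/-- The projection from the cone over `M̂` to `T \ (G \ M̂)`. -/
def qT (y : Amb m) : Base m := projT (qHat y)

theorem qT_mem_domB {y : Amb m} (hy : y ∈ coneT m) (i : Fin m) :
    qT y ∈ domB i ↔ y (.inl i) ≠ 0 := by
  rw [qT, projT_mem_domB, coe_qHat hy, qG_mem_domQ hy.1]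

theorem mapB_qT {y : Amb m} (hy : y ∈ coneT m) (i : Fin m) : mapB i (qT y) = coordB i y := by
  rw [qT, mapB_projT, coe_qHat hy, mapQ_qG hy.1, coordB]

theorem eq_of_mapB_eq {i : Fin m} {p q : Base m} (hp : p ∈ domB i) (hq : q ∈ domB i)
    (h : mapB i p = mapB i q) : p = q := (chartB i).injOn hp hq h

/-- The index of the preferred chart at a point of `T \ (G \ M̂)`. -/
def idxB (b : Base m) : Fin m := (exists_mem_domB b).choose

theorem mem_domB_idxB (b : Base m) : b ∈ domB (idxB b) := (exists_mem_domB b).choose_spec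

theorem inl_idxB_ne_zero {y : Amb m} (hy : y ∈ coneT m) : y (.inl (idxB (qT y))) ≠ 0 :=
  (qT_mem_domB hy _).1 (mem_domB_idxB _)

theorem qT_affineB (i : Fin m) (h : ModB m) : qT (affineB i h) = projT (secT i h) := by
  rw [qT]
  congr 1
  exact Subtype.ext ((coe_qHat (affineB_mem_coneT i h)).trans (qG_affine i (expMod h)))

theorem qT_affineB_mapB {b : Base m} {i : Fin m} (hb : b ∈ domB i) :
    qT (affineB i (mapB i b)) = b := by
  rw [qT_affineB, projT_secT_mapB i b hb]

theorem continuousAt_qT {y : Amb m} (hy : y ∈ coneT m) : ContinuousAt qT y :=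
  (isQuotientMap_projT m).continuous.continuousAt.comp (continuousAt_qHat hy)

/-- The differential of `qT` in the preferred chart. -/
def dB (y : Amb m) : Amb m →L[ℝ] ModB m := fderiv ℝ (coordB (idxB (qT y))) y

theorem hasMFDerivAt_qT {y : Amb m} (hy : y ∈ coneT m) :
    HasMFDerivAt 𝓘(ℝ, Amb m) 𝓘(ℝ, ModB m) qT y (dB y) := by
  refine hasMFDerivAt_iff_of_vectorSpace.2 ⟨continuousAt_qT hy, ?_⟩
  have h := ((contDiffAt_coordB (inl_idxB_ne_zero hy) hy.2).differentiableAt (by simp)).hasFDerivAt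
  refine h.congr_of_eventuallyEq ?_
  filter_upwards [(isOpen_coneT m).mem_nhds hy] with z hz
  exact mapB_qT hz _

/-- Chain rule for `qT = projT ∘ qHat`. Every tangent vector of `G \ M̂` has the form `dQ y X`, so
this determines the differential of `π` completely. -/
theorem mfderiv_projT {y : Amb m} (hy : y ∈ coneT m) (X : Amb m) :
    mfderiv 𝓘(ℝ, ModQ m) 𝓘(ℝ, ModB m) projT (qHat y) (dQ y X : ModQ m) = (dB y X : ModB m) := by
  have h1 := ((contMDiff_projT (m := m)).mdifferentiableAt (by simp) (x := qHat y)).hasMFDerivAt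
  have h2 := (h1.comp y (hasMFDerivAt_qHat hy)).mfderiv
  have h3 := (hasMFDerivAt_qT hy).mfderiv
  exact congrArg (fun L : Amb m →L[ℝ] ModB m => L X) (h2.symm.trans h3)

theorem mfderiv_projG (x : princ m) (K : TangentSpace 𝓘(ℝ, ModS m) x) :
    mfderiv 𝓘(ℝ, ModS m) 𝓘(ℝ, ModQ m) projG x K =
      (dQ (incl x) (mfderiv 𝓘(ℝ, ModS m) 𝓘(ℝ, Amb m) incl x K : Amb m) : ModQ m) := by
  have h1 := ((contMDiff_incl (m := m)).mdifferentiableAt (by simp) (x := x)).hasMFDerivAt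
  have h2 := ((hasMFDerivAt_qG (incl_mem_coneG x)).comp x h1).mfderiv
  have h3 : (qG ∘ incl : princ m → Quo m) = projG := funext fun x => qG_incl x
  have h4 := congrArg (fun f : princ m → Quo m =>
    (mfderiv 𝓘(ℝ, ModS m) 𝓘(ℝ, ModQ m) f x : ModS m →L[ℝ] ModQ m) K) h3
  exact h4.symm.trans (congrArg (fun L : ModS m →L[ℝ] ModQ m => L K) h2)

end

section

/-! ## Descent of invariant tensors -/

variable {m : ℕ}

theorem coordQ_blockMul (i : Fin m) {c : ℂ} {r : ℝ} (hr : 0 < r) (hc : ‖c‖ = r) (y : Amb m) :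
    coordQ i (blockMul c (fun _ => r) y) = coordQ i y := by
  have hc0 : c ≠ 0 := norm_pos_iff.1 (hc ▸ hr)
  have hr' : (r : ℂ) ≠ 0 := by exact_mod_cast hr.ne'
  refine Prod.ext (funext fun l => ?_) (funext fun l => ?_)
  · simp [coordQ, mul_div_mul_left, hc0]
  · simp [coordQ, hc, mul_div_mul_left, hr']

theorem coordB_blockMul (i : Fin m) {c : ℂ} {d : Fin 2 → ℂ} {r : ℝ} (hr : 0 < r) (hc : ‖c‖ = r)
    (hd : ∀ l, ‖d l‖ = r) (y : Amb m) : coordB i (blockMul c d y) = coordB i y := by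
  have hc0 : c ≠ 0 := norm_pos_iff.1 (hc ▸ hr)
  refine Prod.ext (funext fun l => ?_) (funext fun l => ?_)
  · simp [coordB, logMod, coordQ, mul_div_mul_left, hc0]
  · simp [coordB, logMod, coordQ, hc, hd l, abs_of_pos hr, mul_div_mul_left _ _ hr.ne']

theorem affine_coordQ {i : Fin m} {y : Amb m} (hy : y (.inl i) ≠ 0) :
    affine i (coordQ i y) =
      blockMul (y (.inl i))⁻¹ (fun _ => (‖y (.inl i)‖⁻¹ : ℝ)) y := by
  refine amb_ext' (fun k => ?_) fun l => ?_
  · rw [affine_inl, homog_coordQ i y hy, blockMul_inl, div_eq_inv_mul]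
  · simp [coordQ, div_eq_inv_mul]

theorem affineB_coordB {i : Fin m} {y : Amb m} (hy : y (.inl i) ≠ 0) (hv : ∀ l, y (.inr l) ≠ 0) :
    affineB i (coordB i y) =
      blockMul (y (.inl i))⁻¹ (fun l => (‖y (.inr l)‖ : ℂ) / y (.inr l) * (‖y (.inl i)‖⁻¹ : ℝ))
        y := by
  refine amb_ext' (fun k => ?_) fun l => ?_
  · rw [blockMul_inl, ← div_eq_inv_mul, ← homog_coordQ i y hy]
    rfl
  · have := hv l
    have h : 0 < ‖y (.inr l)‖ / ‖y (.inl i)‖ :=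
      div_pos (norm_pos_iff.2 this) (norm_pos_iff.2 hy)
    simp only [affineB, affine_inr, expMod, coordB, logMod, coordQ, norm_div, Complex.norm_real,
      norm_norm, Real.exp_log h, blockMul_inr]
    push_cast
    field_simp

theorem fderiv_comp_section {V H : Type*} [NormedAddCommGroup V] [NormedSpace ℝ V]
    [NormedAddCommGroup H] [NormedSpace ℝ H] {f : V → H} {s : H → V} (hfs : ∀ h, f (s h) = h)
    {h : H} (hf : DifferentiableAt ℝ f (s h)) (hs : DifferentiableAt ℝ s h) (ξ : H) :
    fderiv ℝ f (s h) (fderiv ℝ s h ξ) = ξ := by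
  have h1 := (hf.hasFDerivAt.comp h hs.hasFDerivAt).fderiv
  have h2 : f ∘ s = id := funext hfs
  rw [h2, fderiv_id] at h1
  exact congrArg (fun L : H →L[ℝ] H => L ξ) h1.symm

theorem fderiv_invariant {V H : Type*} [NormedAddCommGroup V] [NormedSpace ℝ V]
    [NormedAddCommGroup H] [NormedSpace ℝ H] {f : V → H} {g : V →L[ℝ] V} (hfg : ∀ y, f (g y) = f y)
    {y : V} (hf : DifferentiableAt ℝ f (g y)) (X : V) :
    fderiv ℝ f (g y) (g X) = fderiv ℝ f y X := by
  have h1 := (hf.hasFDerivAt.comp y g.hasFDerivAt).fderiv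
  have h2 : f ∘ g = f := funext hfg
  rw [h2] at h1
  exact congrArg (fun L : V →L[ℝ] H => L X) h1.symm

/-- Up to a symmetry and a vertical vector, the differential of `affine i ∘ coordQ i` is the
identity. -/
theorem exists_symmetry_affine {i : Fin m} {y : Amb m} (hy : y (.inl i) ≠ 0) :
    ∃ (c : ℂ) (r : ℝ), 0 < r ∧ ‖c‖ = r ∧ affine i (coordQ i y) = blockMul c (fun _ => r) y ∧
      ∀ X, ∃ κ : ℂ, fderiv ℝ (affine i) (coordQ i y) (fderiv ℝ (coordQ i) y X) =
        blockMul c (fun _ => r) X + blockMul κ (fun _ => κ.re) (affine i (coordQ i y)) := by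
  have hr : 0 < ‖y (.inl i)‖⁻¹ := inv_pos.2 (norm_pos_iff.2 hy)
  have hc : ‖(y (.inl i))⁻¹‖ = ‖y (.inl i)‖⁻¹ := norm_inv _
  refine ⟨(y (.inl i))⁻¹, ‖y (.inl i)‖⁻¹, hr, hc, affine_coordQ hy, fun X => ?_⟩
  set h := coordQ i y with hh
  have hd := (contDiffAt_coordQ (y := affine i h) (i := i) (by simp)).differentiableAt
    (by simp : (∞ : WithTop ℕ∞) ≠ 0)
  have h1 := fderiv_comp_section (coordQ_affine i) hd
    ((contDiff_affine i).differentiable (by simp) h) (fderiv ℝ (coordQ i) y X)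
  have h3 := affine_coordQ hy
  rw [← hh] at h3
  have h2 := fderiv_invariant (coordQ_blockMul i hr hc) (y := y) (by rw [← h3]; exact hd) X
  rw [← h3, ← h1] at h2
  -- The lift of the coordinate vector through the section and the transported vector `X` have the
  -- same image under the differential of the chart, so they differ by a vector tangent to the
  -- fibre.
  obtain ⟨κ, hκ⟩ := (fderiv_coordQ_eq_zero_iff (i := i) (y := affine i h) (by simp) _).1
    ((map_sub _ _ _).trans (sub_eq_zero.2 h2.symm))
  exact ⟨κ, by rw [← hκ]; abel⟩

theorem exists_symmetry_affineB {i : Fin m} {y : Amb m} (hy : y (.inl i) ≠ 0)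
    (hv : ∀ l, y (.inr l) ≠ 0) :
    ∃ (c : ℂ) (d : Fin 2 → ℂ) (r : ℝ), 0 < r ∧ ‖c‖ = r ∧ (∀ l, ‖d l‖ = r) ∧
      affineB i (coordB i y) = blockMul c d y ∧
      ∀ X, ∃ (κ : ℂ) (μ : Fin 2 → ℂ), (∀ l, (μ l).re = κ.re) ∧
        fderiv ℝ (affineB i) (coordB i y) (fderiv ℝ (coordB i) y X) =
          blockMul c d X + blockMul κ μ (affineB i (coordB i y)) := by
  have hr : 0 < ‖y (.inl i)‖⁻¹ := inv_pos.2 (norm_pos_iff.2 hy)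
  have hc : ‖(y (.inl i))⁻¹‖ = ‖y (.inl i)‖⁻¹ := norm_inv _
  have hd : ∀ l, ‖(‖y (.inr l)‖ : ℂ) / y (.inr l) * (‖y (.inl i)‖⁻¹ : ℝ)‖ = ‖y (.inl i)‖⁻¹ := by
    intro l
    simp [hv l]
  refine ⟨(y (.inl i))⁻¹, _, ‖y (.inl i)‖⁻¹, hr, hc, hd, affineB_coordB hy hv, fun X => ?_⟩
  have h3 := affineB_coordB hy hv
  set d : Fin 2 → ℂ := fun l => (‖y (.inr l)‖ : ℂ) / y (.inr l) * (‖y (.inl i)‖⁻¹ : ℝ)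
  set h := coordB i y with hh
  have hi : affineB i h (.inl i) ≠ 0 := by simp [affineB]
  have hD := (contDiffAt_coordB (y := affineB i h) (i := i) hi
    (affineB_mem_coneT i h).2).differentiableAt (by simp : (∞ : WithTop ℕ∞) ≠ 0)
  have h1 := fderiv_comp_section (coordB_affineB i) hD
    ((contDiff_affineB i).differentiable (by simp) h) (fderiv ℝ (coordB i) y X)
  have h2 := fderiv_invariant (coordB_blockMul i hr hc hd) (y := y) (by rw [← h3]; exact hD) X
  rw [← h3, ← h1] at h2
  obtain ⟨κ, μ, hμ, hκ⟩ := (fderiv_coordB_eq_zero_iff hi (affineB_mem_coneT i h).2 _).1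
    ((map_sub _ _ _).trans (sub_eq_zero.2 h2.symm))
  exact ⟨κ, μ, hμ, by rw [← hκ]; abel⟩

theorem fderiv_coordQ_surjective {i : Fin m} {y : Amb m} (hy : y (.inl i) ≠ 0) :
    Function.Surjective (fderiv ℝ (coordQ i) y) := by
  intro ξ
  have h3 := affine_coordQ hy
  have hr : 0 < ‖y (.inl i)‖⁻¹ := inv_pos.2 (norm_pos_iff.2 hy)
  have hc : ‖(y (.inl i))⁻¹‖ = ‖y (.inl i)‖⁻¹ := norm_inv _
  set h := coordQ i y with hh
  have hd := (contDiffAt_coordQ (y := affine i h) (i := i) (by simp)).differentiableAt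
    (by simp : (∞ : WithTop ℕ∞) ≠ 0)
  refine ⟨blockMul (y (.inl i)) (fun _ => ‖y (.inl i)‖) (fderiv ℝ (affine i) h ξ), ?_⟩
  rw [← fderiv_invariant (coordQ_blockMul i hr hc) (y := y) (by rw [← h3]; exact hd), ← h3]
  have h4 : ∀ Z : Amb m, blockMul (y (.inl i))⁻¹ (fun _ => ((‖y (.inl i)‖⁻¹ : ℝ) : ℂ))
      (blockMul (y (.inl i)) (fun _ => (‖y (.inl i)‖ : ℂ)) Z) = Z := by
    intro Z
    refine amb_ext' (fun k => ?_) fun l => ?_ <;> simp [hy]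
  rw [h4]
  exact fderiv_comp_section (coordQ_affine i) hd ((contDiff_affine i).differentiable (by simp) h) ξ

theorem fderiv_coordB_surjective {i : Fin m} {y : Amb m} (hy : y (.inl i) ≠ 0)
    (hv : ∀ l, y (.inr l) ≠ 0) : Function.Surjective (fderiv ℝ (coordB i) y) := by
  intro ξ
  -- The differential of `log |w|` at `w` takes `w ξ` to `Re ξ`, hence the factor `w_l` in the
  -- prescribed second component.
  obtain ⟨X, hX⟩ := fderiv_coordQ_surjective hy (ξ.1, fun l => (coordQ i y).2 l * ξ.2 l)
  refine ⟨X, Prod.ext ?_ (funext fun l => ?_)⟩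
  · rw [fderiv_coordB_fst hy hv, hX]
  · rw [fderiv_coordB_snd hy hv]
    have h := fderiv_coordQ_snd hy X l
    rw [hX] at h
    have hy' : (‖y (.inl i)‖ : ℂ) ≠ 0 := by simpa using hy
    have h5 : X (.inr l) / y (.inr l) = ((ξ.2 l + (X (.inl i) / y (.inl i)).re : ℝ) : ℂ) := by
      simp only [coordQ] at h
      have := hv l
      rw [div_eq_iff this]
      field_simp at h
      push_cast
      linear_combination -h
    rw [h5, Complex.ofReal_re]
    ring

/-! ## The metrics in terms of the ambient space -/

/-- The vector `(i u, 0)`. -/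
def vertU (y : Amb m) : Amb m := blockMul Complex.I 0 y

/-- The vector `(0, i v_l)`. -/
def vertV (l : Fin 2) (y : Amb m) : Amb m := blockMul 0 (Pi.single l Complex.I) y

theorem inner_amb (x y : Amb m) : inner ℝ x y =
    (∑ k, inner ℝ (x (.inl k)) (y (.inl k))) + ∑ l, inner ℝ (x (.inr l)) (y (.inr l)) := by
  rw [PiLp.inner_apply, Fintype.sum_sum_type]

theorem inner_I_mul (z : ℂ) : inner ℝ z (Complex.I * z) = 0 := by
  rw [Complex.inner]; simp; ring

theorem inner_self_vertU (y : Amb m) : inner ℝ y (vertU y) = 0 := by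
  simp only [inner_amb, vertU, blockMul_inl, blockMul_inr, inner_I_mul]; simp

theorem inner_self_vertV (l : Fin 2) (y : Amb m) : inner ℝ y (vertV l y) = 0 := by
  simp only [inner_amb, vertV, blockMul_inl, blockMul_inr]
  simp only [zero_mul, inner_zero_right, Finset.sum_const_zero, zero_add]
  refine Finset.sum_eq_zero fun l' _ => ?_
  by_cases h : l' = l
  · subst h; simp only [Pi.single_eq_same, inner_I_mul]
  · simp [h]

theorem inner_vertU_vertV (l : Fin 2) (y z : Amb m) : inner ℝ (vertU y) (vertV l z) = 0 := by
  simp [inner_amb, vertV, vertU]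

theorem inner_vertV_vertV {l l' : Fin 2} (h : l ≠ l') (y z : Amb m) :
    inner ℝ (vertV l y) (vertV l' z) = 0 := by
  simp only [inner_amb, vertV, blockMul_inl, blockMul_inr]
  simp only [zero_mul, inner_zero_right, Finset.sum_const_zero, zero_add]
  refine Finset.sum_eq_zero fun k _ => ?_
  by_cases hk : k = l
  · have : k ≠ l' := fun h' => h (hk ▸ h')
    simp [this]
  · simp [hk]

/-- The vertical space is spanned by the radial direction and three circle directions, which are
mutually orthogonal, so tensors need only be tested on these. -/
theorem blockMul_eq_add (c : ℂ) (d : Fin 2 → ℂ) (hd : ∀ l, (d l).re = c.re) (y : Amb m) :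
    blockMul c d y = c.re • y + c.im • vertU y + ∑ l, (d l).im • vertV l y := by
  have hre : ∀ z : ℂ, z = z.re + z.im * Complex.I := fun z => (Complex.re_add_im z).symm
  refine amb_ext' (fun k => ?_) fun l => ?_
  · simp [vertU, vertV]
    nth_rewrite 1 [hre c]; ring
  · simp [vertU, vertV]
    nth_rewrite 1 [hre (d l)]
    rw [hd l]
    fin_cases l <;> simp <;> ring

theorem blockMul_eq_add' (c : ℂ) (y : Amb m) :
    blockMul c (fun _ => (c.re : ℂ)) y = c.re • y + c.im • vertU y := by
  rw [blockMul_eq_add c _ (fun _ => Complex.ofReal_re _)]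
  simp

theorem vertU_ne_zero {y : Amb m} (hy : y ∈ coneG m) : vertU y ≠ 0 := by
  obtain ⟨k, hk⟩ := hy
  intro h
  have := congrArg (fun z : Amb m => z (.inl k)) h
  simp [vertU, hk] at this

theorem vertV_ne_zero {l : Fin 2} {y : Amb m} (hy : y (.inr l) ≠ 0) : vertV l y ≠ 0 := by
  intro h
  have := congrArg (fun z : Amb m => z (.inr l)) h
  simp [vertV, hy] at this

/-- The symmetric bilinear form on the ambient space that induces `h₀`. -/
def formG (y : Amb m) : LinearMap.BilinForm ℝ (Amb m) :=
  -- Powers of `‖y‖` make each term invariant under scaling. The two subtracted terms remove the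
  -- radial component and the component along the `G`-orbit.
  LinearMap.mk₂ ℝ (fun X Y => inner ℝ X Y / ‖y‖ ^ 2 - inner ℝ y X * inner ℝ y Y / ‖y‖ ^ 4 -
      inner ℝ (vertU y) X * inner ℝ (vertU y) Y / (‖vertU y‖ ^ 2 * ‖y‖ ^ 2))
    (fun X X' Y => by simp only [inner_add_left, inner_add_right]; ring)
    (fun c X Y => by simp only [inner_smul_left, inner_smul_right, smul_eq_mul]; simp; ring)
    (fun X Y Y' => by simp only [inner_add_right]; ring)
    (fun c X Y => by simp only [inner_smul_right, smul_eq_mul]; ring)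

theorem formG_apply (y X Y : Amb m) : formG y X Y =
    inner ℝ X Y / ‖y‖ ^ 2 - inner ℝ y X * inner ℝ y Y / ‖y‖ ^ 4 -
      inner ℝ (vertU y) X * inner ℝ (vertU y) Y / (‖vertU y‖ ^ 2 * ‖y‖ ^ 2) := rfl

/-- The symmetric bilinear form on the ambient space that induces `h₀^T`. -/
def formT (y : Amb m) : LinearMap.BilinForm ℝ (Amb m) :=
  LinearMap.mk₂ ℝ (fun X Y => formG y X Y -
      ∑ l, inner ℝ (vertV l y) X * inner ℝ (vertV l y) Y / (‖vertV l y‖ ^ 2 * ‖y‖ ^ 2))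
    (fun X X' Y => by simp [inner_add_right]; ring)
    (fun c X Y => by simp [inner_smul_right]; ring)
    (fun X Y Y' => by simp [inner_add_right]; ring)
    (fun c X Y => by simp [inner_smul_right]; ring)

theorem formT_apply (y X Y : Amb m) : formT y X Y = formG y X Y -
    ∑ l, inner ℝ (vertV l y) X * inner ℝ (vertV l y) Y / (‖vertV l y‖ ^ 2 * ‖y‖ ^ 2) := rfl

theorem formG_comm (y X Y : Amb m) : formG y X Y = formG y Y X := by
  simp only [formG_apply, real_inner_comm]; ring

theorem formT_comm (y X Y : Amb m) : formT y X Y = formT y Y X := by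
  simp only [formT_apply, formG_comm y X Y, mul_comm]

theorem formG_radial {y : Amb m} (hy : y ∈ coneG m) (X : Amb m) : formG y X y = 0 := by
  have h0 : ‖y‖ ≠ 0 := norm_ne_zero_iff.2 (ne_zero_of_mem_coneG hy)
  rw [formG_apply, real_inner_comm y (vertU y), inner_self_vertU, real_inner_self_eq_norm_sq,
    real_inner_comm y X]
  field_simp
  ring

theorem formG_vertU {y : Amb m} (hy : y ∈ coneG m) (X : Amb m) : formG y X (vertU y) = 0 := by
  have h0 : ‖y‖ ≠ 0 := norm_ne_zero_iff.2 (ne_zero_of_mem_coneG hy)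
  have h1 : ‖vertU y‖ ≠ 0 := norm_ne_zero_iff.2 (vertU_ne_zero hy)
  rw [formG_apply, inner_self_vertU, real_inner_self_eq_norm_sq, real_inner_comm (vertU y) X]
  field_simp
  ring

theorem formG_vertV (l : Fin 2) (y X : Amb m) :
    formG y X (vertV l y) = inner ℝ X (vertV l y) / ‖y‖ ^ 2 := by
  rw [formG_apply, inner_self_vertV, inner_vertU_vertV]
  simp

theorem formG_vertical {y : Amb m} (hy : y ∈ coneG m) (X : Amb m) (c : ℂ) :
    formG y X (blockMul c (fun _ => (c.re : ℂ)) y) = 0 := by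
  rw [blockMul_eq_add', map_add, map_smul, map_smul, formG_radial hy, formG_vertU hy]; simp

theorem formT_vertical {y : Amb m} (hy : y ∈ coneT m) (X : Amb m) (c : ℂ) (d : Fin 2 → ℂ)
    (hd : ∀ l, (d l).re = c.re) : formT y X (blockMul c d y) = 0 := by
  have hV : ∀ l, formT y X (vertV l y) = 0 := fun l => by
    have h0 : ‖y‖ ≠ 0 := norm_ne_zero_iff.2 (ne_zero_of_mem_coneG hy.1)
    have h1 : ‖vertV l y‖ ≠ 0 := norm_ne_zero_iff.2 (vertV_ne_zero (hy.2 l))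
    rw [formT_apply, formG_vertV, Finset.sum_eq_single l (fun l' _ h => by
      rw [inner_vertV_vertV h]; simp) (by simp), real_inner_self_eq_norm_sq,
      real_inner_comm (vertV l y) X]
    field_simp
    ring
  have h1 : formT y X y = 0 := by
    rw [formT_apply, formG_radial hy.1]
    simp [real_inner_comm y (vertV _ y), inner_self_vertV]
  have h2 : formT y X (vertU y) = 0 := by
    rw [formT_apply, formG_vertU hy.1]
    simp [real_inner_comm (vertU y) (vertV _ y), inner_vertU_vertV]
  rw [blockMul_eq_add c d hd, map_add, map_add, map_smul, map_smul, h1, h2, map_sum]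
  simp [hV]

theorem vertU_blockMul (c : ℂ) (d : Fin 2 → ℂ) (y : Amb m) :
    vertU (blockMul c d y) = blockMul c d (vertU y) := blockMul_comm _ _ _ _ _

theorem vertV_blockMul (l : Fin 2) (c : ℂ) (d : Fin 2 → ℂ) (y : Amb m) :
    vertV l (blockMul c d y) = blockMul c d (vertV l y) := blockMul_comm _ _ _ _ _

theorem norm_blockMul {c : ℂ} {d : Fin 2 → ℂ} {r : ℝ} (hc : ‖c‖ = r) (hd : ∀ l, ‖d l‖ = r)
    (x : Amb m) : ‖blockMul c d x‖ = r * ‖x‖ := by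
  have h := inner_blockMul hc hd x x
  rw [real_inner_self_eq_norm_sq, real_inner_self_eq_norm_sq, ← mul_pow] at h
  exact (pow_left_inj₀ (norm_nonneg _) (mul_nonneg (hc ▸ norm_nonneg _) (norm_nonneg _))
    two_ne_zero).1 h

theorem mul_mul_div_mul_mul {a : ℝ} (ha : a ≠ 0) (x y z w : ℝ) :
    a * x * (a * y) / (a * z * (a * w)) = x * y / (z * w) := by
  rw [mul_mul_mul_comm, mul_mul_mul_comm a z, mul_div_mul_left _ _ (mul_ne_zero ha ha)]

theorem formG_blockMul {c : ℂ} {d : Fin 2 → ℂ} {r : ℝ} (hr : 0 < r) (hc : ‖c‖ = r)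
    (hd : ∀ l, ‖d l‖ = r) (y X Y : Amb m) :
    formG (blockMul c d y) (blockMul c d X) (blockMul c d Y) = formG y X Y := by
  simp only [formG_apply, vertU_blockMul, inner_blockMul hc hd, norm_blockMul hc hd]
  have := hr.ne'
  congr 1
  · congr 1
    · rw [mul_pow, mul_div_mul_left _ _ (pow_ne_zero 2 this)]
    · rw [mul_pow, mul_mul_mul_comm, ← pow_add, mul_div_mul_left _ _ (pow_ne_zero 4 this)]
  · rw [mul_pow, mul_pow, mul_mul_div_mul_mul (pow_ne_zero 2 this)]

theorem formT_blockMul {c : ℂ} {d : Fin 2 → ℂ} {r : ℝ} (hr : 0 < r) (hc : ‖c‖ = r)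
    (hd : ∀ l, ‖d l‖ = r) (y X Y : Amb m) :
    formT (blockMul c d y) (blockMul c d X) (blockMul c d Y) = formT y X Y := by
  simp only [formT_apply, formG_blockMul hr hc hd, vertV_blockMul, inner_blockMul hc hd,
    norm_blockMul hc hd]
  congr 1
  refine Finset.sum_congr rfl fun l _ => ?_
  rw [mul_pow, mul_pow, mul_mul_div_mul_mul (pow_ne_zero 2 hr.ne')]

/-- Passing through the section changes a vector by a symmetry and a vertical vector. The form is
invariant under the former and vanishes on the latter. -/
theorem formG_section {i : Fin m} {y : Amb m} (hy : y (.inl i) ≠ 0) (X Y : Amb m) :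
    formG (affine i (coordQ i y)) (fderiv ℝ (affine i) (coordQ i y) (fderiv ℝ (coordQ i) y X))
      (fderiv ℝ (affine i) (coordQ i y) (fderiv ℝ (coordQ i) y Y)) = formG y X Y := by
  obtain ⟨c, r, hr, hc, h1, h2⟩ := exists_symmetry_affine hy
  obtain ⟨κ, hκ⟩ := h2 X
  obtain ⟨κ', hκ'⟩ := h2 Y
  have hm := affine_mem_coneG i (coordQ i y)
  rw [hκ, hκ', map_add, formG_vertical hm, formG_comm, map_add, formG_vertical hm, formG_comm, h1]
  simp only [add_zero]
  exact formG_blockMul hr hc (fun _ => by simp [abs_of_pos hr]) y X Y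

theorem formT_section {i : Fin m} {y : Amb m} (hy : y (.inl i) ≠ 0) (hv : ∀ l, y (.inr l) ≠ 0)
    (X Y : Amb m) : formT (affineB i (coordB i y))
      (fderiv ℝ (affineB i) (coordB i y) (fderiv ℝ (coordB i) y X))
      (fderiv ℝ (affineB i) (coordB i y) (fderiv ℝ (coordB i) y Y)) = formT y X Y := by
  obtain ⟨c, d, r, hr, hc, hd, h1, h2⟩ := exists_symmetry_affineB hy hv
  obtain ⟨κ, μ, hμ, hκ⟩ := h2 X
  obtain ⟨κ', μ', hμ', hκ'⟩ := h2 Y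
  have hm := affineB_mem_coneT i (coordB i y)
  rw [hκ, hκ', map_add, formT_vertical hm _ _ _ hμ', formT_comm, map_add,
    formT_vertical hm _ _ _ hμ, formT_comm, h1]
  simp only [add_zero]
  exact formT_blockMul hr hc hd y X Y

end

section

/-! ## Identification of `h₀` and `h₀^T` -/

variable {m : ℕ} [NeZero m]

/-- The bilinear forms on `G \ M_princ` induced by `formG`. -/
def tensorG (m : ℕ) [NeZero m] : MetricTensor (ModQ m) (Quo m) := fun q =>
  let L : ModQ m →ₗ[ℝ] Amb m := (fderiv ℝ (affine (idxQ q)) (mapQ (idxQ q) q)).toLinearMap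
  let B : LinearMap.BilinForm ℝ (ModQ m) :=
    (formG (affine (idxQ q) (mapQ (idxQ q) q))).compl₁₂ L L
  B

/-- The bilinear forms on `T \ (G \ M̂)` induced by `formT`. -/
def tensorT (m : ℕ) [NeZero m] : MetricTensor (ModB m) (Base m) := fun b =>
  let L : ModB m →ₗ[ℝ] Amb m := (fderiv ℝ (affineB (idxB b)) (mapB (idxB b) b)).toLinearMap
  let B : LinearMap.BilinForm ℝ (ModB m) :=
    (formT (affineB (idxB b) (mapB (idxB b) b))).compl₁₂ L L
  B

theorem tensorG_apply {y : Amb m} (hy : y ∈ coneG m) (X Y : Amb m) :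
    tensorG m (qG y) (dQ y X : ModQ m) (dQ y Y : ModQ m) = formG y X Y := by
  change formG (affine (idxQ (qG y)) (mapQ (idxQ (qG y)) (qG y)))
    (fderiv ℝ (affine (idxQ (qG y))) (mapQ (idxQ (qG y)) (qG y)) (dQ y X))
    (fderiv ℝ (affine (idxQ (qG y))) (mapQ (idxQ (qG y)) (qG y)) (dQ y Y)) = _
  rw [mapQ_qG hy]
  exact formG_section (inl_idxQ_ne_zero hy) X Y

theorem tensorT_apply {y : Amb m} (hy : y ∈ coneT m) (X Y : Amb m) :
    tensorT m (qT y) (dB y X : ModB m) (dB y Y : ModB m) = formT y X Y := by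
  change formT (affineB (idxB (qT y)) (mapB (idxB (qT y)) (qT y)))
    (fderiv ℝ (affineB (idxB (qT y))) (mapB (idxB (qT y)) (qT y)) (dB y X))
    (fderiv ℝ (affineB (idxB (qT y))) (mapB (idxB (qT y)) (qT y)) (dB y Y)) = _
  rw [mapB_qT hy]
  exact formT_section (inl_idxB_ne_zero hy) hy.2 X Y

theorem dQ_surjective {y : Amb m} (hy : y ∈ coneG m) : Function.Surjective (dQ y) :=
  fderiv_coordQ_surjective (inl_idxQ_ne_zero hy)

theorem dB_surjective {y : Amb m} (hy : y ∈ coneT m) : Function.Surjective (dB y) :=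
  fderiv_coordB_surjective (inl_idxB_ne_zero hy) hy.2

theorem dQ_eq_zero_iff {y : Amb m} (hy : y ∈ coneG m) (X : Amb m) :
    dQ y X = 0 ↔ ∃ c : ℂ, X = blockMul c (fun _ => c.re) y :=
  fderiv_coordQ_eq_zero_iff (inl_idxQ_ne_zero hy) X

theorem dB_eq_zero_iff {y : Amb m} (hy : y ∈ coneT m) (X : Amb m) :
    dB y X = 0 ↔ ∃ (c : ℂ) (d : Fin 2 → ℂ), (∀ l, (d l).re = c.re) ∧ X = blockMul c d y :=
  fderiv_coordB_eq_zero_iff (inl_idxB_ne_zero hy) hy.2 X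

theorem dQ_radial {y : Amb m} (hy : y ∈ coneG m) : dQ y y = 0 :=
  (dQ_eq_zero_iff hy y).2 ⟨1, amb_ext' (fun k => by simp) (fun l => by simp)⟩

theorem dQ_vertU {y : Amb m} (hy : y ∈ coneG m) : dQ y (vertU y) = 0 :=
  (dQ_eq_zero_iff hy _).2 ⟨Complex.I, amb_ext' (fun k => by simp [vertU])
    (fun l => by simp [vertU])⟩

theorem dB_vertV {y : Amb m} (hy : y ∈ coneT m) (l : Fin 2) : dB y (vertV l y) = 0 :=
  (dB_eq_zero_iff hy _).2 ⟨0, Pi.single l Complex.I, fun l' => by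
    by_cases h : l' = l
    · subst h; simp
    · simp [h], rfl⟩

/-- The differential of the inclusion of `M_princ`. -/
def dIncl (x : princ m) (K : TangentSpace 𝓘(ℝ, ModS m) x) : Amb m :=
  mfderiv 𝓘(ℝ, ModS m) 𝓘(ℝ, Amb m) incl x K

theorem dIncl_eq (x : princ m) (K : ModS m) : dIncl x K =
    (mfderiv 𝓘(ℝ, ModS m) 𝓘(ℝ, Amb m) ((↑) : Sph m → Amb m) (x : Sph m) K : Amb m) := by
  have h1 := ((contMDiff_coe_sphere (E := Amb m) (n := 2 * m + 3)
    (m := ∞)).mdifferentiableAt (by simp) (x := (x : Sph m))).hasMFDerivAt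
  have h2 := (h1.comp x (hasMFDerivAt_opens_val x)).mfderiv
  exact congrArg (fun L : ModS m →L[ℝ] Amb m => L K) h2

theorem exists_dIncl_eq_iff (x : princ m) (W : Amb m) :
    (∃ K : TangentSpace 𝓘(ℝ, ModS m) x, dIncl x K = W) ↔ inner ℝ (incl x) W = 0 := by
  rw [← Submodule.mem_orthogonal_singleton_iff_inner_right]
  have h := range_mvfderiv_subtypeVal (E := Amb m) (n := 2 * m + 3) (x : Sph m)
  change _ ↔ W ∈ (Submodule.span ℝ {((x : Sph m) : Amb m)})ᗮ
  rw [← h]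
  constructor
  · rintro ⟨K, rfl⟩
    exact ⟨K, (dIncl_eq x K).symm⟩
  · rintro ⟨K, hK⟩
    exact ⟨K, (dIncl_eq x K).trans hK⟩

theorem metricG0_apply (x : princ m) (K K' : TangentSpace 𝓘(ℝ, ModS m) x) :
    metricG0 m x K K' = inner ℝ (dIncl x K) (dIncl x K') := rfl

theorem mfderiv_projG' (x : princ m) (K : TangentSpace 𝓘(ℝ, ModS m) x) :
    mfderiv 𝓘(ℝ, ModS m) 𝓘(ℝ, ModQ m) projG x K = (dQ (incl x) (dIncl x K) : ModQ m) :=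
  mfderiv_projG x K

theorem tensorG_projG (x : princ m) (X Y : Amb m) :
    tensorG m (projG x) (dQ (incl x) X : ModQ m) (dQ (incl x) Y : ModQ m) =
      formG (incl x) X Y := by
  have h := tensorG_apply (incl_mem_coneG x) X Y
  have key : ∀ q, q = projG x → tensorG m q (dQ (incl x) X : ModQ m) (dQ (incl x) Y : ModQ m) =
      formG (incl x) X Y → tensorG m (projG x) (dQ (incl x) X : ModQ m)
        (dQ (incl x) Y : ModQ m) = formG (incl x) X Y := by
    rintro q rfl h; exact h
  exact key _ (qG_incl x) h

/-- Every vector downstairs has a horizontal lift, and on horizontal lifts the submersion condition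
prescribes the value. -/
theorem isSubmersionMetric_unique {E E' N N' : Type*} [NormedAddCommGroup E] [NormedSpace ℝ E]
    [NormedAddCommGroup E'] [NormedSpace ℝ E'] [TopologicalSpace N] [ChartedSpace E N]
    [TopologicalSpace N'] [ChartedSpace E' N'] {p : N → N'} {g : MetricTensor E N}
    {h h' : MetricTensor E' N'} (hh : IsSubmersionMetric p g h) (hh' : IsSubmersionMetric p g h')
    (hp : ∀ y : N', ∃ x, p x = y)
    (hs : ∀ (x : N) (ξ : TangentSpace 𝓘(ℝ, E') (p x)), ∃ X : TangentSpace 𝓘(ℝ, E) x,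
      mfderiv 𝓘(ℝ, E) 𝓘(ℝ, E') p x X = ξ ∧
      ∀ K : TangentSpace 𝓘(ℝ, E) x, mfderiv 𝓘(ℝ, E) 𝓘(ℝ, E') p x K = 0 → g x X K = 0) :
    h = h' := by
  funext y
  obtain ⟨x, rfl⟩ := hp y
  refine LinearMap.ext fun ξ => LinearMap.ext fun η => ?_
  obtain ⟨X, rfl, hX⟩ := hs x ξ
  obtain ⟨Y, rfl, hY⟩ := hs x η
  rw [hh x X Y hX hY, hh' x X Y hX hY]

/-- The submersion metric is obtained by choice, so it is identified by exhibiting one admissible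
metric and appealing to uniqueness. -/
theorem submersionMetric_eq {E E' N N' : Type*} [NormedAddCommGroup E] [NormedSpace ℝ E]
    [NormedAddCommGroup E'] [NormedSpace ℝ E'] [TopologicalSpace N] [ChartedSpace E N]
    [TopologicalSpace N'] [ChartedSpace E' N'] {p : N → N'} {g : MetricTensor E N}
    {h' : MetricTensor E' N'} (hh' : IsSubmersionMetric p g h')
    (hp : ∀ y : N', ∃ x, p x = y)
    (hs : ∀ (x : N) (ξ : TangentSpace 𝓘(ℝ, E') (p x)), ∃ X : TangentSpace 𝓘(ℝ, E) x,
      mfderiv 𝓘(ℝ, E) 𝓘(ℝ, E') p x X = ξ ∧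
      ∀ K : TangentSpace 𝓘(ℝ, E) x, mfderiv 𝓘(ℝ, E) 𝓘(ℝ, E') p x K = 0 → g x X K = 0) :
    submersionMetric p g = h' :=
  isSubmersionMetric_unique (Classical.epsilon_spec (p := IsSubmersionMetric p g) ⟨h', hh'⟩)
    hh' hp hs

theorem metricH0_eq : metricH0 m = tensorG m := by
  refine submersionMetric_eq ?_ (isQuotientMap_projG m).surjective ?_
  · intro x X Y hX hY
    have hver : ∀ Z : TangentSpace 𝓘(ℝ, ModS m) x, (∀ K : TangentSpace 𝓘(ℝ, ModS m) x,
        mfderiv 𝓘(ℝ, ModS m) 𝓘(ℝ, ModQ m) projG x K = 0 → metricG0 m x Z K = 0) →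
        inner ℝ (vertU (incl x)) (dIncl x Z) = 0 := by
      intro Z hZ
      obtain ⟨K, hK⟩ := (exists_dIncl_eq_iff x (vertU (incl x))).2 (inner_self_vertU _)
      have h := hZ K (by
        rw [mfderiv_projG', hK, dQ_vertU (incl_mem_coneG x)]; rfl)
      rw [metricG0_apply, hK] at h
      rw [real_inner_comm]; exact h
    rw [mfderiv_projG', mfderiv_projG', tensorG_projG, metricG0_apply, formG_apply, hver X hX,
      (exists_dIncl_eq_iff x _).1 ⟨X, rfl⟩, norm_incl]
    simp
  · intro x ξ
    have hx := incl_mem_coneG x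
    obtain ⟨X₀, hX₀⟩ := dQ_surjective hx (ξ : ModQ m)
    set y := incl x with hy
    have hyy : inner ℝ y y = (1 : ℝ) := by rw [real_inner_self_eq_norm_sq, norm_incl]; simp
    have hI : (inner ℝ (vertU y) (vertU y) : ℝ) ≠ 0 := by
      rw [real_inner_self_eq_norm_sq]
      exact pow_ne_zero 2 (norm_ne_zero_iff.2 (vertU_ne_zero hx))
    -- Removing the radial component makes the vector tangent to the sphere, and removing the
    -- component along `(iu, 0)` makes it horizontal. Neither changes its image under `dQ y`.
    set W : Amb m := X₀ - (inner ℝ y X₀ : ℝ) • y -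
      ((inner ℝ (vertU y) X₀ : ℝ) / inner ℝ (vertU y) (vertU y)) • vertU y with hW
    have h1 : inner ℝ y W = 0 := by
      simp only [hW, inner_sub_right, inner_smul_right, hyy, inner_self_vertU]; simp
    have h2 : inner ℝ (vertU y) W = 0 := by
      simp only [hW, inner_sub_right, inner_smul_right, real_inner_comm y (vertU y),
        inner_self_vertU]
      field_simp; simp
    have h3 : dQ y W = ξ := by
      rw [← hX₀]
      simp only [hW, map_sub, map_smul, dQ_radial hx, dQ_vertU hx]; simp
    obtain ⟨X, hX⟩ := (exists_dIncl_eq_iff x W).2 h1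
    refine ⟨X, by rw [mfderiv_projG', hX]; exact h3, fun K hK => ?_⟩
    rw [mfderiv_projG'] at hK
    obtain ⟨c, hc⟩ := (dQ_eq_zero_iff hx _).1 hK
    rw [metricG0_apply, hX, hc, blockMul_eq_add', inner_add_right, inner_smul_right,
      inner_smul_right, real_inner_comm y W, real_inner_comm (vertU y) W, h1, h2]
    simp

theorem metricH0_apply {y : Amb m} (hy : y ∈ coneG m) (X Y : Amb m) :
    metricH0 m (qG y) (dQ y X : ModQ m) (dQ y Y : ModQ m) = formG y X Y := by
  rw [metricH0_eq]; exact tensorG_apply hy X Y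

theorem metricH0Hat_apply {y : Amb m} (hy : y ∈ coneT m) (X Y : Amb m) :
    metricH0Hat m (qHat y) (dQ y X : ModQ m) (dQ y Y : ModQ m) = formG y X Y := by
  have h1 : ∀ ξ η : ModQ m, metricH0Hat m (qHat y) ξ η = metricH0 m (qHat y : Quo m) ξ η := by
    intro ξ η
    have h := (hasMFDerivAt_opens_val (E := ModQ m) (qHat y)).mfderiv
    change metricH0 m (qHat y : Quo m)
      (mfderiv 𝓘(ℝ, ModQ m) 𝓘(ℝ, ModQ m) (Subtype.val : hat m → Quo m) (qHat y) ξ)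
      (mfderiv 𝓘(ℝ, ModQ m) 𝓘(ℝ, ModQ m) (Subtype.val : hat m → Quo m) (qHat y) η) = _
    rw [h]; rfl
  rw [h1]
  have key : ∀ q, q = qG y →
      metricH0 m q (dQ y X : ModQ m) (dQ y Y : ModQ m) = formG y X Y := by
    rintro q rfl; exact metricH0_apply hy.1 X Y
  exact key _ (coe_qHat hy)

theorem metricH0T_eq : metricH0T m = tensorT m := by
  refine submersionMetric_eq ?_ (isQuotientMap_projT m).surjective ?_
  · intro q ξ η hξ hη
    obtain ⟨x, hx, rfl⟩ := qHat_surjective q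
    obtain ⟨X, rfl⟩ := dQ_surjective hx.1 ξ
    obtain ⟨Y, rfl⟩ := dQ_surjective hx.1 η
    have hver : ∀ l, inner ℝ (vertV l (incl x)) X = 0 := by
      intro l
      have h := hξ (dQ (incl x) (vertV l (incl x)) : ModQ m) (by
        rw [mfderiv_projT hx, dB_vertV hx]; rfl)
      rw [metricH0Hat_apply hx, formG_vertV, norm_incl, real_inner_comm] at h
      simpa using h
    rw [mfderiv_projT hx, mfderiv_projT hx, metricH0Hat_apply hx]
    refine (tensorT_apply hx X Y).trans ?_
    rw [formT_apply]
    simp [hver]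
  · intro q ξ
    obtain ⟨x, hx, rfl⟩ := qHat_surjective q
    obtain ⟨X₀, hX₀⟩ := dB_surjective hx (ξ : ModB m)
    generalize incl x = y at *
    have hV : ∀ l, (inner ℝ (vertV l y) (vertV l y) : ℝ) ≠ 0 := by
      intro l
      rw [real_inner_self_eq_norm_sq]
      exact pow_ne_zero 2 (norm_ne_zero_iff.2 (vertV_ne_zero (hx.2 l)))
    set W : Amb m := X₀ - ∑ l, ((inner ℝ (vertV l y) X₀ : ℝ) /
      inner ℝ (vertV l y) (vertV l y)) • vertV l y with hW
    have h1 : ∀ l, inner ℝ W (vertV l y) = 0 := by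
      intro l
      rw [real_inner_comm]
      simp only [hW, inner_sub_right, inner_sum, inner_smul_right]
      rw [Finset.sum_eq_single l (fun l' _ h => by rw [inner_vertV_vertV h.symm]; simp) (by simp),
        div_mul_cancel₀ _ (hV l), sub_self]
    have h2 : dB y W = ξ := by
      rw [← hX₀]
      simp only [hW, map_sub, map_sum, map_smul, dB_vertV hx]; simp
    refine ⟨(dQ y W : ModQ m), (mfderiv_projT hx W).trans h2, fun K hK => ?_⟩
    obtain ⟨K, rfl⟩ := dQ_surjective hx.1 K
    rw [mfderiv_projT hx] at hK
    obtain ⟨c, d, hcd, rfl⟩ := (dB_eq_zero_iff hx _).1 hK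
    rw [metricH0Hat_apply hx, blockMul_eq_add c d hcd, map_add, map_add, map_smul, map_smul,
      formG_radial hx.1, formG_vertU hx.1, map_sum]
    simp [formG_vertV, h1]

theorem metricH0T_apply {y : Amb m} (hy : y ∈ coneT m) (X Y : Amb m) :
    metricH0T m (qT y) (dB y X : ModB m) (dB y Y : ModB m) = formT y X Y := by
  rw [metricH0T_eq]; exact tensorT_apply hy X Y

end

section

/-! ## One-forms -/

section OneForm

variable {V H F : Type*} [NormedAddCommGroup V] [NormedSpace ℝ V]
  [NormedAddCommGroup H] [NormedSpace ℝ H] [NormedAddCommGroup F] [NormedSpace ℝ F]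

/-- A continuous linear map as an alternating map in one variable. -/
def oneForm : (V →L[ℝ] F) ≃ₗᵢ[ℝ] (V [⋀^Fin 1]→L[ℝ] F) :=
  ContinuousAlternatingMap.ofSubsingletonLIE (𝕜 := ℝ) (E := V) (F := F) (0 : Fin 1)

theorem oneForm_compContinuousLinearMap (a : V →L[ℝ] F) (L : H →L[ℝ] V) :
    (oneForm a).compContinuousLinearMap L = oneForm (a.comp L) := rfl

theorem oneForm_ext {η η' : V [⋀^Fin 1]→L[ℝ] F} (h : ∀ X, η (fun _ => X) = η' (fun _ => X)) :
    η = η' := by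
  ext v
  have : v = fun _ => v 0 := funext fun i => congrArg v (Subsingleton.elim i 0)
  rw [this, h]

theorem twoForm_ext {η η' : V [⋀^Fin 2]→L[ℝ] F} (h : ∀ X Y, η ![X, Y] = η' ![X, Y]) :
    η = η' := by
  ext v
  have : v = ![v 0, v 1] := by
    funext i; fin_cases i <;> rfl
  rw [this, h]

theorem extDeriv_oneForm {a : V → V →L[ℝ] F} {y : V} (ha : DifferentiableAt ℝ a y) (X Y : V) :
    extDeriv (fun z => oneForm (a z)) y ![X, Y] = fderiv ℝ a y X Y - fderiv ℝ a y Y X := by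
  have h : HasFDerivAt (fun z => oneForm (a z))
      ((oneForm (V := V) (F := F)).toContinuousLinearEquiv.toContinuousLinearMap.comp
        (fderiv ℝ a y)) y :=
    (oneForm (V := V) (F := F)).toContinuousLinearEquiv.hasFDerivAt.comp y ha.hasFDerivAt
  rw [extDeriv_apply h.differentiableAt, Fin.sum_univ_two]
  have key : ∀ W : V, HasFDerivAt (fun z => a z W) ((ContinuousLinearMap.apply ℝ F W).comp
      (fderiv ℝ a y)) y := fun W =>
    (ContinuousLinearMap.apply ℝ F W).hasFDerivAt.comp y ha.hasFDerivAt
  have h0 : (fun z => oneForm (a z) ((0 : Fin 2).removeNth ![X, Y])) = fun z => a z Y := rfl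
  have h1 : (fun z => oneForm (a z) ((1 : Fin 2).removeNth ![X, Y])) = fun z => a z X := rfl
  rw [h0, h1, (key Y).fderiv, (key X).fderiv]
  simp [sub_eq_add_neg]

theorem differentiableAt_oneForm {a : H → V →L[ℝ] F} {y : H} (ha : DifferentiableAt ℝ a y) :
    DifferentiableAt ℝ (fun z => oneForm (a z)) y :=
  (oneForm (V := V) (F := F)).toContinuousLinearEquiv.differentiableAt.comp y ha

/-- The pullback of a one-form. -/
def pullForm (a : V → V →L[ℝ] F) (s : H → V) (h : H) : H →L[ℝ] F := (a (s h)).comp (fderiv ℝ s h)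

/-- Near `y` the form `a` is the pullback by `f` of the form `s^* a`, and exterior differentiation
commutes with pullbacks. -/
theorem extDeriv_eq_of_section {a : V → V →L[ℝ] F} {s : H → V} {f : V → H} {y : V}
    (hf : ContDiffAt ℝ ∞ f y) (hs : ContDiff ℝ ∞ s) (ha : DifferentiableAt ℝ a (s (f y)))
    (h : ∀ᶠ z in nhds y, (pullForm a s (f z)).comp (fderiv ℝ f z) = a z) (X Y : V) :
    extDeriv (fun z => oneForm (a z)) y ![X, Y] =
      extDeriv (fun z => oneForm (pullForm a s z)) (f y) ![fderiv ℝ f y X, fderiv ℝ f y Y] := by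
  have h1 : (fun z => oneForm (a z)) =ᶠ[nhds y]
      fun z => ((oneForm (pullForm a s (f z))).compContinuousLinearMap (fderiv ℝ f z)) := by
    filter_upwards [h] with z hz
    rw [oneForm_compContinuousLinearMap, hz]
  have h2 : DifferentiableAt ℝ (fun z => oneForm (pullForm a s z)) (f y) := by
    refine differentiableAt_oneForm ?_
    have h3 : DifferentiableAt ℝ (fun z => a (s z)) (f y) :=
      ha.comp (f y) (hs.differentiable (by simp) _)
    have h4 : DifferentiableAt ℝ (fderiv ℝ s) (f y) :=
      (hs.fderiv_right (m := ∞) (by simp)).differentiable (by simp) _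
    exact h3.clm_comp h4
  rw [h1.extDeriv_eq, extDeriv_pullback h2 hf (by simpa using WithTop.coe_le_coe.2 (le_top : (2 : ℕ∞) ≤ ⊤))]
  have : ![fderiv ℝ f y X, fderiv ℝ f y Y] = fderiv ℝ f y ∘ ![X, Y] := by
    funext i; fin_cases i <;> rfl
  rw [this]
  rfl

end OneForm

variable {m : ℕ}

/-! ## The ambient forms -/

/-- The ambient form `(U, V) ↦ Im (V_l / v_l)` that induces `ω₀`. -/
def omegaAmb (y : Amb m) : Amb m →L[ℝ] LieT :=
  ∑ l, (ContinuousLinearMap.single ℝ (fun _ : Fin 2 => ℝ) l).comp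
    (Complex.imCLM.comp ((y (.inr l))⁻¹ •
      ((EuclideanSpace.proj (𝕜 := ℂ) (Sum.inr l : Fin m ⊕ Fin 2)).restrictScalars ℝ)))

theorem omegaAmb_apply (y X : Amb m) (l : Fin 2) :
    omegaAmb y X l = (X (.inr l) / y (.inr l)).im := by
  simp only [omegaAmb, sum_apply, ContinuousLinearMap.comp_apply,
    Finset.sum_apply, ContinuousLinearMap.single_apply]
  rw [Finset.sum_eq_single l (fun l' _ h => by simp [h.symm]) (by simp)]
  simp [div_eq_inv_mul]

/-- The action of a matrix on the component `u`, followed by the projection onto it. -/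
def matU (A : Matrix (Fin m) (Fin m) ℂ) : Amb m →L[ℝ] Amb m :=
  LinearMap.toContinuousLinearMap
    { toFun := fun x => ofU (A *ᵥ partU x)
      map_add' := fun x y => by
        have : partU (x + y) = partU x + partU y := rfl
        rw [this, Matrix.mulVec_add]
        exact amb_ext' (fun k => rfl) fun l => by simp [ofU]
      map_smul' := fun r x => by
        have : partU (r • x) = r • partU x := rfl
        rw [this, Matrix.mulVec_smul]
        exact amb_ext' (fun k => rfl) fun l => by simp [ofU] }

theorem matU_inl (A : Matrix (Fin m) (Fin m) ℂ) (x : Amb m) (k : Fin m) :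
    matU A x (.inl k) = (A *ᵥ partU x) k := rfl

@[simp] theorem matU_inr (A : Matrix (Fin m) (Fin m) ℂ) (x : Amb m) (l : Fin 2) :
    matU A x (.inr l) = 0 := rfl

theorem matU_blockMul (A : Matrix (Fin m) (Fin m) ℂ) (c : ℂ) (d : Fin 2 → ℂ) (x : Amb m) :
    matU A (blockMul c d x) = blockMul c d (matU A x) := by
  refine amb_ext' (fun k => ?_) fun l => by simp
  have : partU (blockMul c d x) = c • partU x := rfl
  rw [matU_inl, this, Matrix.mulVec_smul]
  rfl

theorem inner_matU {A : Matrix (Fin m) (Fin m) ℂ} (hA : Aᴴ = -A) (x y : Amb m) :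
    inner ℝ (matU A x) y = -inner ℝ x (matU A y) := by
  have key : ∀ w z : Amb m, (∀ l, w (.inr l) = 0 ∨ z (.inr l) = 0) →
      inner ℝ w z = (star (partU w) ⬝ᵥ partU z).re := by
    intro w z h
    have h0 : ∑ l, inner ℝ (w (.inr l)) (z (.inr l)) = 0 :=
      Finset.sum_eq_zero fun l _ => by rcases h l with h | h <;> simp only [h, inner_zero_left,
        inner_zero_right]
    rw [inner_amb, h0, add_zero, dotProduct, Complex.re_sum]
    refine Finset.sum_congr rfl fun k _ => ?_
    rw [Complex.inner, mul_comm]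
    rfl
  rw [key _ _ fun l => Or.inl (by simp), key _ _ fun l => Or.inr (by simp)]
  have h1 : partU (matU A x) = A *ᵥ partU x := rfl
  have h2 : partU (matU A y) = A *ᵥ partU y := rfl
  rw [h1, h2, Matrix.star_mulVec, hA, Matrix.vecMul_neg, neg_dotProduct, Complex.neg_re,
    ← Matrix.dotProduct_mulVec]

/-- The matrix `j_{Z_k}`. -/
abbrev matJ (j : LieT →ₗ[ℝ] su m) (k : Fin 2) : Matrix (Fin m) (Fin m) ℂ := (j (basisZ k)).1

theorem conjTranspose_matJ (j : LieT →ₗ[ℝ] su m) (k : Fin 2) : (matJ j k)ᴴ = -matJ j k :=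
  (j (basisZ k)).2.1

theorem ofU_I_smul (y : Amb m) : ofU (Complex.I • partU y) = vertU y :=
  amb_ext' (fun k => rfl) fun l => by simp [vertU, ofU]

theorem norm_ofU_partU (y : Amb m) : ‖ofU (partU y)‖ = ‖vertU y‖ := by
  simp [EuclideanSpace.norm_eq, ofU, vertU, partU]

theorem kappaComp_apply (j : LieT →ₗ[ℝ] su m) (k : Fin 2) (y X : Amb m) : kappaComp j k y X =
    ‖vertU y‖ ^ 2 * inner ℝ (matU (matJ j k) y) X -
      inner ℝ (matU (matJ j k) y) (vertU y) * inner ℝ (vertU y) X := by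
  have h : ofU ((j (basisZ k) : Matrix (Fin m) (Fin m) ℂ) *ᵥ partU y) = matU (matJ j k) y := rfl
  simp only [kappaComp, ofU_I_smul, norm_ofU_partU, h]
  simp

/-- The scaling-invariant ambient form that induces `λ`. -/
def muAmb (j : LieT →ₗ[ℝ] su m) (y : Amb m) : Amb m →L[ℝ] LieT :=
  -- Scaling the point and the vector together by `r` multiplies `κ` by `r⁴`.
  (‖y‖ ^ 4)⁻¹ • ∑ k, (ContinuousLinearMap.single ℝ (fun _ : Fin 2 => ℝ) k).comp (kappaComp j k y)

theorem muAmb_apply (j : LieT →ₗ[ℝ] su m) (y X : Amb m) (k : Fin 2) :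
    muAmb j y X k = (‖y‖ ^ 4)⁻¹ * kappaComp j k y X := by
  simp only [muAmb, smul_apply, sum_apply,
    ContinuousLinearMap.comp_apply, Pi.smul_apply, Finset.sum_apply,
    ContinuousLinearMap.single_apply]
  rw [Finset.sum_eq_single k (fun l' _ h => by simp [h.symm]) (by simp)]
  simp

theorem inner_matU_self {A : Matrix (Fin m) (Fin m) ℂ} (hA : Aᴴ = -A) (x : Amb m) :
    inner ℝ (matU A x) x = 0 := by
  have h := inner_matU hA x x
  rw [real_inner_comm] at h ⊢
  linarith

/-- Skew-symmetry gives `⟨j u, u⟩ = 0`, and the second term of `κ` is exactly the correction that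
cancels `‖u‖² ⟨j u, iu⟩` on the vector `(iu, 0)`. The `v`-directions do not enter `κ`. -/
theorem kappaComp_vertical (j : LieT →ₗ[ℝ] su m) (k : Fin 2) (y : Amb m) (c : ℂ) (d : Fin 2 → ℂ)
    (hd : ∀ l, (d l).re = c.re) : kappaComp j k y (blockMul c d y) = 0 := by
  have h1 : ∀ l, inner ℝ (matU (matJ j k) y) (vertV l y) = 0 := fun l => by
    simp [inner_amb, vertV]
  rw [blockMul_eq_add c d hd, kappaComp_apply]
  simp only [inner_add_right, inner_smul_right, inner_sum, h1, inner_vertU_vertV,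
    inner_matU_self (conjTranspose_matJ j k), real_inner_comm y (vertU y), inner_self_vertU,
    real_inner_self_eq_norm_sq]
  simp
  ring

theorem kappaComp_blockMul (j : LieT →ₗ[ℝ] su m) (k : Fin 2) {c : ℂ} {d : Fin 2 → ℂ} {r : ℝ}
    (hc : ‖c‖ = r) (hd : ∀ l, ‖d l‖ = r) (y X : Amb m) :
    kappaComp j k (blockMul c d y) (blockMul c d X) = r ^ 4 * kappaComp j k y X := by
  simp only [kappaComp_apply, matU_blockMul, vertU_blockMul, inner_blockMul hc hd,
    norm_blockMul hc hd]
  ring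

theorem muAmb_vertical (j : LieT →ₗ[ℝ] su m) (y : Amb m) (c : ℂ) (d : Fin 2 → ℂ)
    (hd : ∀ l, (d l).re = c.re) : muAmb j y (blockMul c d y) = 0 := by
  funext k
  rw [muAmb_apply, kappaComp_vertical j k y c d hd, mul_zero, Pi.zero_apply]

theorem muAmb_blockMul (j : LieT →ₗ[ℝ] su m) {c : ℂ} {d : Fin 2 → ℂ} {r : ℝ} (hr : 0 < r)
    (hc : ‖c‖ = r) (hd : ∀ l, ‖d l‖ = r) (y X : Amb m) :
    muAmb j (blockMul c d y) (blockMul c d X) = muAmb j y X := by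
  funext k
  rw [muAmb_apply, muAmb_apply, kappaComp_blockMul j k hc hd, norm_blockMul hc hd, mul_pow,
    mul_inv, mul_mul_mul_comm, inv_mul_cancel₀ (pow_ne_zero 4 hr.ne'), one_mul]

theorem omegaAmb_vertical (y : Amb m) (c : ℂ) :
    omegaAmb y (blockMul c (fun _ => (c.re : ℂ)) y) = 0 := by
  funext l
  rw [omegaAmb_apply, blockMul_inr, mul_div_assoc]
  by_cases h : y (.inr l) = 0 <;> simp [h]

theorem omegaAmb_blockMul (c : ℂ) {d : Fin 2 → ℂ} (hd : ∀ l, d l ≠ 0) (y X : Amb m) :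
    omegaAmb (blockMul c d y) (blockMul c d X) = omegaAmb y X := by
  funext l
  rw [omegaAmb_apply, omegaAmb_apply, blockMul_inr, blockMul_inr, mul_div_mul_left _ _ (hd l)]

theorem differentiableAt_omegaAmb {y : Amb m} (hy : ∀ l, y (.inr l) ≠ 0) :
    DifferentiableAt ℝ (omegaAmb (m := m)) y := by
  unfold omegaAmb
  refine DifferentiableAt.fun_sum fun l _ => ?_
  have h1 : DifferentiableAt ℝ (fun z : Amb m => (z (.inr l))⁻¹) y := by
    have h2 : DifferentiableAt ℝ (fun z : Amb m => z (.inr l)) y := by fun_prop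
    exact h2.inv (hy l)
  exact (differentiableAt_const _).clm_comp ((differentiableAt_const _).clm_comp
    (h1.smul_const _))

theorem differentiableAt_kappaComp (j : LieT →ₗ[ℝ] su m) (k : Fin 2) (y : Amb m) :
    DifferentiableAt ℝ (kappaComp j k) y := by
  have h : kappaComp j k = fun z => (inner ℝ (vertU z) (vertU z) : ℝ) •
      innerSL ℝ (matU (matJ j k) z) -
        (inner ℝ (matU (matJ j k) z) (vertU z) : ℝ) • innerSL ℝ (vertU z) := by
    funext z
    ext X
    rw [kappaComp_apply]
    simp
  rw [h]
  have h1 : DifferentiableAt ℝ (vertU (m := m)) y := (blockMul Complex.I 0).differentiableAt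
  have h2 : DifferentiableAt ℝ (matU (matJ j k)) y := (matU _).differentiableAt
  exact ((h1.inner ℝ h1).smul ((innerSL ℝ).differentiableAt.comp y h2)).sub
    ((h2.inner ℝ h1).smul ((innerSL ℝ).differentiableAt.comp y h1))

theorem differentiableAt_muAmb (j : LieT →ₗ[ℝ] su m) {y : Amb m} (hy : y ≠ 0) :
    DifferentiableAt ℝ (muAmb j) y := by
  unfold muAmb
  have h : DifferentiableAt ℝ (fun z : Amb m => ∑ k,
      (ContinuousLinearMap.single ℝ (fun _ : Fin 2 => ℝ) k).comp (kappaComp j k z)) y :=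
    DifferentiableAt.fun_sum fun k _ =>
      (differentiableAt_const _).clm_comp (differentiableAt_kappaComp j k y)
  have h2 : DifferentiableAt ℝ (fun z : Amb m => (‖z‖ ^ 4)⁻¹) y :=
    ((differentiableAt_id.norm ℝ hy).pow 4).inv (pow_ne_zero 4 (norm_ne_zero_iff.2 hy))
  exact h2.smul h

theorem fderiv_apply_eq {V F : Type*} [NormedAddCommGroup V] [NormedSpace ℝ V]
    [NormedAddCommGroup F] [NormedSpace ℝ F] {a : V → V →L[ℝ] F} {y : V}
    (ha : DifferentiableAt ℝ a y) (X Y : V) {w : F}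
    (h : HasDerivAt (fun t : ℝ => a (y + t • X) Y) w 0) : fderiv ℝ a y X Y = w := by
  have h1 := ((ContinuousLinearMap.apply ℝ F Y).hasFDerivAt.comp_hasDerivAt (0 : ℝ)
    (hasDerivAt_comp_line ha X))
  exact h1.unique h

/-- Locally the `l`-th component is the differential of the argument of `v_l`, so `ω₀` is flat and
the whole curvature comes from `λ`. -/
theorem extDeriv_omegaAmb {y : Amb m} (hy : ∀ l, y (.inr l) ≠ 0) (X Y : Amb m) :
    extDeriv (fun z => oneForm (omegaAmb z)) y ![X, Y] = 0 := by
  have h := differentiableAt_omegaAmb hy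
  have key : ∀ X Y : Amb m, fderiv ℝ omegaAmb y X Y =
      fun l => (-(X (.inr l) * Y (.inr l) / y (.inr l) ^ 2)).im := by
    intro X Y
    refine fderiv_apply_eq h X Y (hasDerivAt_pi.2 fun l => ?_)
    have h1 := ((hasDerivAt_coord y X (.inr l)).inv (by simpa using hy l)).const_mul (Y (.inr l))
    have h2 := Complex.imCLM.hasFDerivAt.comp_hasDerivAt (0 : ℝ) h1
    convert! h2 using 1
    · funext t
      rw [omegaAmb_apply, div_eq_mul_inv]
      rfl
    · simp only [Complex.imCLM_apply]
      congr 1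
      simp
      ring
  rw [extDeriv_oneForm h, key, key]
  funext l
  simp [mul_comm]

end

section

/-! ## The forms on the quotients -/

variable {m : ℕ}

/-- An invariant form that kills vertical vectors is basic, so pulling it back along a section and
then along the projection recovers it. -/
theorem pullForm_affine {F : Type*} [NormedAddCommGroup F] [NormedSpace ℝ F]
    {a : Amb m → Amb m →L[ℝ] F}
    (hinv : ∀ (c : ℂ) (r : ℝ), 0 < r → ‖c‖ = r → ∀ y X,
      a (blockMul c (fun _ => r) y) (blockMul c (fun _ => r) X) = a y X)
    (hker : ∀ y (κ : ℂ), a y (blockMul κ (fun _ => (κ.re : ℂ)) y) = 0)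
    {i : Fin m} {y : Amb m} (hy : y (.inl i) ≠ 0) :
    (pullForm a (affine i) (coordQ i y)).comp (fderiv ℝ (coordQ i) y) = a y := by
  ext1 X
  obtain ⟨c, r, hr, hc, h1, h2⟩ := exists_symmetry_affine hy
  obtain ⟨κ, hκ⟩ := h2 X
  change a (affine i (coordQ i y)) (fderiv ℝ (affine i) (coordQ i y) (fderiv ℝ (coordQ i) y X)) = _
  rw [hκ, map_add, hker, add_zero, h1, hinv c r hr hc]

theorem pullForm_affineB {F : Type*} [NormedAddCommGroup F] [NormedSpace ℝ F]
    {a : Amb m → Amb m →L[ℝ] F}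
    (hinv : ∀ (c : ℂ) (d : Fin 2 → ℂ) (r : ℝ), 0 < r → ‖c‖ = r → (∀ l, ‖d l‖ = r) → ∀ y X,
      a (blockMul c d y) (blockMul c d X) = a y X)
    (hker : ∀ y (c : ℂ) (d : Fin 2 → ℂ), (∀ l, (d l).re = c.re) → a y (blockMul c d y) = 0)
    {i : Fin m} {y : Amb m} (hy : y (.inl i) ≠ 0) (hv : ∀ l, y (.inr l) ≠ 0) :
    (pullForm a (affineB i) (coordB i y)).comp (fderiv ℝ (coordB i) y) = a y := by
  ext1 X
  obtain ⟨c, d, r, hr, hc, hd, h1, h2⟩ := exists_symmetry_affineB hy hv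
  obtain ⟨κ, μ, hμ, hκ⟩ := h2 X
  change a (affineB i (coordB i y))
    (fderiv ℝ (affineB i) (coordB i y) (fderiv ℝ (coordB i) y X)) = _
  rw [hκ, map_add, hker _ _ _ hμ, add_zero, h1, hinv c d r hr hc hd]

theorem pullForm_muAmb (j : LieT →ₗ[ℝ] su m) {i : Fin m} {y : Amb m} (hy : y (.inl i) ≠ 0) :
    (pullForm (muAmb j) (affine i) (coordQ i y)).comp (fderiv ℝ (coordQ i) y) = muAmb j y :=
  pullForm_affine (fun c r hr hc y X => muAmb_blockMul j hr hc
    (fun _ => by simp [abs_of_pos hr]) y X) (fun y κ => muAmb_vertical j y κ _ (by simp)) hy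

theorem pullForm_omegaAmb {i : Fin m} {y : Amb m} (hy : y (.inl i) ≠ 0) :
    (pullForm omegaAmb (affine i) (coordQ i y)).comp (fderiv ℝ (coordQ i) y) = omegaAmb y :=
  pullForm_affine (fun c r hr _ y X => omegaAmb_blockMul c
    (fun _ => by exact_mod_cast hr.ne') y X) (fun y κ => omegaAmb_vertical y κ) hy

variable [NeZero m]

/-- The one-form on `G \ M_princ` that is induced by an ambient form. -/
def descForm (a : Amb m → Amb m →L[ℝ] LieT) (q : Quo m) : ModQ m [⋀^Fin 1]→L[ℝ] LieT :=
  oneForm (pullForm a (affine (idxQ q)) (mapQ (idxQ q) q))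

theorem descForm_omegaAmb {y : Amb m} (hy : y ∈ coneG m) (X : Amb m) :
    descForm omegaAmb (qG y) (fun _ => dQ y X) = omegaAmb y X := by
  have h := pullForm_omegaAmb (inl_idxQ_ne_zero hy)
  rw [descForm, mapQ_qG hy]
  exact congrArg (fun L : Amb m →L[ℝ] LieT => L X) h

theorem descForm_muAmb (j : LieT →ₗ[ℝ] su m) {y : Amb m} (hy : y ∈ coneG m) (X : Amb m) :
    descForm (muAmb j) (qG y) (fun _ => dQ y X) = muAmb j y X := by
  have h := pullForm_muAmb j (inl_idxQ_ne_zero hy)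
  rw [descForm, mapQ_qG hy]
  exact congrArg (fun L : Amb m →L[ℝ] LieT => L X) h

/-- The induced form is also obtained by choice. Surjectivity of the map and of its differentials
forces any two candidates to agree. -/
theorem inducedForm_eq {E E' N N' F : Type*} [NormedAddCommGroup E] [NormedSpace ℝ E]
    [NormedAddCommGroup E'] [NormedSpace ℝ E'] [TopologicalSpace N] [ChartedSpace E N]
    [TopologicalSpace N'] [ChartedSpace E' N'] [NormedAddCommGroup F] [NormedSpace ℝ F] {k : ℕ}
    {p : N → N'} {η : DiffForm E N k F} {η' : DiffForm E' N' k F} (h : η'.pullback p = η)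
    (hp : ∀ y : N', ∃ x, p x = y)
    (hs : ∀ x : N, Function.Surjective (mfderiv 𝓘(ℝ, E) 𝓘(ℝ, E') p x)) :
    inducedForm p η = η' := by
  have h1 : (inducedForm p η : DiffForm E' N' k F).pullback p = η :=
    Classical.epsilon_spec (p := fun η' : DiffForm E' N' k F => η'.pullback p = η) ⟨η', h⟩
  funext y
  obtain ⟨x, rfl⟩ := hp y
  ext v
  choose w hw using fun i => hs x (v i)
  have h2 : (inducedForm p η : DiffForm E' N' k F).pullback p x w = η'.pullback p x w := by
    rw [h1, h]
  have h3 : v = fun i => mfderiv 𝓘(ℝ, E) 𝓘(ℝ, E') p x (w i) := funext fun i => (hw i).symm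
  rw [h3]
  exact h2

theorem exists_dIncl_dQ_eq (x : princ m) (ξ : ModQ m) :
    ∃ K : TangentSpace 𝓘(ℝ, ModS m) x, dQ (incl x) (dIncl x K) = ξ := by
  have hx := incl_mem_coneG x
  obtain ⟨X₀, hX₀⟩ := dQ_surjective hx ξ
  obtain ⟨K, hK⟩ := (exists_dIncl_eq_iff x (X₀ - (inner ℝ (incl x) X₀ : ℝ) • incl x)).2 (by
    rw [inner_sub_right, inner_smul_right, real_inner_self_eq_norm_sq, norm_incl]; simp)
  exact ⟨K, by rw [hK, map_sub, map_smul, dQ_radial hx, smul_zero, sub_zero, hX₀]⟩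

theorem mfderiv_projG_surjective (x : princ m) :
    Function.Surjective (mfderiv 𝓘(ℝ, ModS m) 𝓘(ℝ, ModQ m) projG x) := by
  intro ξ
  obtain ⟨K, hK⟩ := exists_dIncl_dQ_eq x ξ
  exact ⟨K, (mfderiv_projG' x K).trans hK⟩

theorem mfderiv_projT_surjective (q : hat m) :
    Function.Surjective (mfderiv 𝓘(ℝ, ModQ m) 𝓘(ℝ, ModB m) projT q) := by
  intro ξ
  obtain ⟨x, hx, rfl⟩ := qHat_surjective q
  obtain ⟨X, hX⟩ := dB_surjective hx ξ
  exact ⟨(dQ (incl x) X : ModQ m), (mfderiv_projT hx X).trans hX⟩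

theorem lam_eq (j : LieT →ₗ[ℝ] su m) : lam j = descForm (muAmb j) := by
  refine inducedForm_eq (η' := (descForm (muAmb j) : DiffForm (ModQ m) (Quo m) 1 LieT)) ?_
    (isQuotientMap_projG m).surjective mfderiv_projG_surjective
  funext x
  refine oneForm_ext (V := ModS m) fun K => ?_
  have h1 : descForm (muAmb j) (projG x) (fun _ => dQ (incl x) (dIncl x K)) =
      muAmb j (incl x) (dIncl x K) := by
    rw [← qG_incl]; exact descForm_muAmb j (incl_mem_coneG x) _
  have h2 : descForm (muAmb j) (projG x) (fun _ =>
      (mfderiv 𝓘(ℝ, ModS m) 𝓘(ℝ, ModQ m) projG x K : ModQ m)) = muAmb j (incl x) (dIncl x K) :=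
    (congrArg (fun ξ : ModQ m => descForm (muAmb j) (projG x) (fun _ => ξ))
      (mfderiv_projG' x K)).trans h1
  refine h2.trans ?_
  have h3 : (mfderiv 𝓘(ℝ, ModS m) 𝓘(ℝ, ModS m) (Subtype.val : princ m → Sph m) x K : ModS m) = K :=
    congrArg (fun L : ModS m →L[ℝ] ModS m => L K) (hasMFDerivAt_opens_val (E := ModS m) x).mfderiv
  -- On the unit sphere the normalising factor of `muAmb` equals one.
  have h4 : muAmb j (incl x) (dIncl x K) =
      kappaAmb j (incl x) (fun _ => dIncl x K) := by
    funext k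
    rw [muAmb_apply, norm_incl]
    simp only [one_pow, inv_one, one_mul]
    rfl
  rw [h4]
  change _ = kappaAmb j (incl x) (fun _ => (mfderiv 𝓘(ℝ, ModS m) 𝓘(ℝ, Amb m)
    ((↑) : Sph m → Amb m) (x : Sph m)
    (mfderiv 𝓘(ℝ, ModS m) 𝓘(ℝ, ModS m) (Subtype.val : princ m → Sph m) x K : ModS m) : Amb m))
  rw [h3, ← dIncl_eq]

/-! ### The connection form `ω₀` -/

theorem hasDerivAt_circleExp_mul (a : ℝ) (z : ℂ) :
    HasDerivAt (fun t : ℝ => (Circle.exp (t * a) : ℂ) * z) (a * Complex.I * z) 0 := by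
  have h1 : HasDerivAt (fun t : ℝ => ((t * a : ℝ) : ℂ) * Complex.I) (a * Complex.I) 0 := by
    have := ((hasDerivAt_id (0 : ℝ)).mul_const a).ofReal_comp.mul_const Complex.I
    simpa using this
  have h2 := (h1.cexp.mul_const z)
  simpa [Circle.coe_exp] using h2

theorem hasDerivAt_actT (Z : LieT) (y : Amb m) :
    HasDerivAt (fun t : ℝ => actT (expT (t • Z)) y) (∑ l, Z l • vertV l y) 0 := by
  have h : HasDerivAt (fun t : ℝ => (Sum.elim (fun k => y (.inl k))
      ![(Circle.exp (t * Z 0) : ℂ) * y (.inr 0), (Circle.exp (t * Z 1) : ℂ) * y (.inr 1)] :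
        Fin m ⊕ Fin 2 → ℂ))
      (Sum.elim 0 ![Z 0 * Complex.I * y (.inr 0), Z 1 * Complex.I * y (.inr 1)]) 0 := by
    refine hasDerivAt_pi.2 fun i => ?_
    rcases i with k | l
    · exact hasDerivAt_const _ _
    · fin_cases l
      · exact hasDerivAt_circleExp_mul _ _
      · exact hasDerivAt_circleExp_mul _ _
  have h2 := (PiLp.continuousLinearEquiv 2 ℝ
    (fun _ : Fin m ⊕ Fin 2 => ℂ)).symm.hasFDerivAt.comp_hasDerivAt (0 : ℝ) h
  convert! h2 using 1
  refine amb_ext (fun k => ?_) ?_ ?_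
  · simp [vertV]
  · simp [vertV, mul_assoc]
  · simp [vertV, mul_assoc]

theorem actT_mem_coneT (t : Torus) {y : Amb m} (hy : y ∈ coneT m) : actT t y ∈ coneT m := by
  rw [actT_eq_blockMul]
  refine blockMul_mem_coneT one_ne_zero (fun l => ?_) hy
  fin_cases l <;> simp

theorem actT_mem_coneG (t : Torus) {y : Amb m} (hy : y ∈ coneG m) : actT t y ∈ coneG m := by
  rw [actT_eq_blockMul]
  exact blockMul_mem_coneG one_ne_zero _ hy

theorem smul_qG (t : Torus) {y : Amb m} (hy : y ∈ coneG m) : t • qG y = qG (actT t y) := by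
  rw [qG_of_mem hy, qG_of_mem (actT_mem_coneG t hy), smul_projG]
  congr 1
  apply incl_injective
  rw [incl_smulT, incl_coneProj, incl_coneProj, actT_smul, norm_actT]

theorem smul_qHat (t : Torus) {y : Amb m} (hy : y ∈ coneT m) : t • qHat y = qHat (actT t y) := by
  refine Subtype.ext ?_
  rw [coe_qHat (actT_mem_coneT t hy), ← smul_qG t hy.1, ← coe_qHat hy]
  rfl

theorem expT_zero_smul (Z : LieT) : expT ((0 : ℝ) • Z) = 1 := by
  refine Prod.ext ?_ ?_ <;> simp [expT]

theorem actT_one (y : Amb m) : actT 1 y = y := amb_ext (fun _ => rfl) (one_mul _) (one_mul _)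

theorem fundFieldHat_qHat (Z : LieT) {y : Amb m} (hy : y ∈ coneT m) :
    fundFieldHat Z (qHat y) = (dQ y (∑ l, Z l • vertV l y) : ModQ m) := by
  have h0 : actT (expT ((0 : ℝ) • Z)) y = y := by rw [expT_zero_smul, actT_one]
  have h1 : HasMFDerivAt 𝓘(ℝ, ℝ) 𝓘(ℝ, Amb m) (fun t : ℝ => actT (expT (t • Z)) y) 0
      (ContinuousLinearMap.toSpanSingleton ℝ (∑ l, Z l • vertV l y)) :=
    (hasDerivAt_actT Z y).hasFDerivAt.hasMFDerivAt
  have h2 : HasMFDerivAt 𝓘(ℝ, Amb m) 𝓘(ℝ, ModQ m) qHat (actT (expT ((0 : ℝ) • Z)) y) (dQ y) := by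
    rw [h0]; exact hasMFDerivAt_qHat hy
  have h3 := (h2.comp (0 : ℝ) h1).mfderiv
  have h4 : (qHat ∘ fun t : ℝ => actT (expT (t • Z)) y) = fun t : ℝ => expT (t • Z) • qHat y :=
    funext fun t => (smul_qHat _ hy).symm
  rw [h4] at h3
  have h5 := congrArg (fun L : ℝ →L[ℝ] ModQ m => L 1) h3
  refine Eq.trans h5 ?_
  change dQ y ((1 : ℝ) • (∑ l, Z l • vertV l y)) = _
  rw [one_smul]

theorem fundField_qG (Z : LieT) {y : Amb m} (hy : y ∈ coneG m) :
    fundField Z (qG y) = (dQ y (∑ l, Z l • vertV l y) : ModQ m) := by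
  have h0 : actT (expT ((0 : ℝ) • Z)) y = y := by rw [expT_zero_smul, actT_one]
  have h1 : HasMFDerivAt 𝓘(ℝ, ℝ) 𝓘(ℝ, Amb m) (fun t : ℝ => actT (expT (t • Z)) y) 0
      (ContinuousLinearMap.toSpanSingleton ℝ (∑ l, Z l • vertV l y)) :=
    (hasDerivAt_actT Z y).hasFDerivAt.hasMFDerivAt
  have h2 : HasMFDerivAt 𝓘(ℝ, Amb m) 𝓘(ℝ, ModQ m) qG (actT (expT ((0 : ℝ) • Z)) y) (dQ y) := by
    rw [h0]; exact hasMFDerivAt_qG hy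
  have h3 := (h2.comp (0 : ℝ) h1).mfderiv
  have h4 : (qG ∘ fun t : ℝ => actT (expT (t • Z)) y) = fun t : ℝ => expT (t • Z) • qG y :=
    funext fun t => (smul_qG _ hy).symm
  rw [h4] at h3
  have h5 := congrArg (fun L : ℝ →L[ℝ] ModQ m => L 1) h3
  refine Eq.trans h5 ?_
  change dQ y ((1 : ℝ) • (∑ l, Z l • vertV l y)) = _
  rw [one_smul]

theorem omegaAmb_vertV (Z : LieT) {y : Amb m} (hy : ∀ l, y (.inr l) ≠ 0) :
    omegaAmb y (∑ l, Z l • vertV l y) = Z := by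
  funext l
  rw [omegaAmb_apply]
  have h0 := hy 0
  have h1 := hy 1
  fin_cases l <;> simp [vertV, h0, h1, mul_div_assoc]

/-- Orthogonality to `(0, i v_l)` is the vanishing of `Im (X_l / v_l)` when `v_l ≠ 0`. This is why
`omegaAmb` has the kernel required of `ω₀`. -/
theorem inner_vertV_right (l : Fin 2) (y X : Amb m) :
    inner ℝ X (vertV l y) = ‖y (.inr l)‖ ^ 2 * omegaAmb y X l := by
  have h : inner ℝ X (vertV l y) = inner ℝ (X (.inr l)) (Complex.I * y (.inr l)) := by
    rw [inner_amb, Finset.sum_eq_zero fun k _ => by simp [vertV], zero_add,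
      Finset.sum_eq_single l (fun l' _ h => by simp [vertV, h]) (by simp)]
    simp [vertV]
  rw [h, omegaAmb_apply]
  by_cases h0 : y (.inr l) = 0
  · simp [h0]
  · have h1 : Complex.normSq (y (.inr l)) ≠ 0 := by simpa using h0
    rw [← Complex.normSq_eq_norm_sq, Complex.inner, Complex.div_im]
    field_simp
    simp
    ring

theorem isConnectionForm_descForm :
    IsConnectionForm (m := m) fun q : hat m => descForm omegaAmb (q : Quo m) := by
  intro q
  obtain ⟨x, hx, rfl⟩ := qHat_surjective q
  have key : ∀ X, descForm omegaAmb (qHat (incl x) : Quo m) (fun _ => dQ (incl x) X) =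
      omegaAmb (incl x) X := by
    intro X
    rw [coe_qHat hx]; exact descForm_omegaAmb hx.1 X
  constructor
  · intro Z
    rw [fundFieldHat_qHat Z hx]
    exact (key _).trans (omegaAmb_vertV Z hx.2)
  · intro ξ
    obtain ⟨X, rfl⟩ := dQ_surjective hx.1 ξ
    have h1 : ∀ Z : LieT, metricH0Hat m (qHat (incl x)) (dQ (incl x) X : ModQ m)
        (fundFieldHat Z (qHat (incl x))) = ∑ l, Z l * (‖incl x (.inr l)‖ ^ 2 *
          omegaAmb (incl x) X l) := by
      intro Z
      rw [fundFieldHat_qHat Z hx, metricH0Hat_apply hx, map_sum]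
      simp only [map_smul, formG_vertV, norm_incl, inner_vertV_right]
      simp
    have h2 : (descForm omegaAmb (qHat (incl x) : Quo m) (fun _ => dQ (incl x) X) = 0) ↔
        omegaAmb (incl x) X = 0 := by rw [key]
    refine h2.trans ⟨fun h Z => ?_, fun h => funext fun l => ?_⟩
    · rw [h1, h]; simp
    · have h3 := h (Pi.single l 1)
      rw [h1, Finset.sum_eq_single l (fun l' _ h => by simp [h]) (by simp)] at h3
      simpa [hx.2 l] using h3

/-- Subtract from `X` the fundamental vector on which `θ` takes the same value as on `X`. The
difference lies in the kernel of `θ`, that is in the horizontal space, and hence in the kernel of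
`θ'`. Both forms agree on the fundamental vector. -/
theorem isConnectionForm_unique {θ θ' : DiffForm (ModQ m) (hat m) 1 LieT}
    (h : IsConnectionForm θ) (h' : IsConnectionForm θ') : θ = θ' := by
  funext q
  refine oneForm_ext (V := ModQ m) fun X => ?_
  obtain ⟨a, ha⟩ := (oneForm (V := ModQ m) (F := LieT)).surjective (θ q)
  obtain ⟨a', ha'⟩ := (oneForm (V := ModQ m) (F := LieT)).surjective (θ' q)
  obtain ⟨h1, h2⟩ := h q
  obtain ⟨h1', h2'⟩ := h' q
  have e : ∀ Y : ModQ m, θ q (fun _ => Y) = a Y := fun Y => by rw [← ha]; rfl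
  have e' : ∀ Y : ModQ m, θ' q (fun _ => Y) = a' Y := fun Y => by rw [← ha']; rfl
  set Z : LieT := a X with hZ
  set V : ModQ m := fundFieldHat Z q with hV
  have h3 : a V = Z := (e V).symm.trans (h1 Z)
  have h3' : a' V = Z := (e' V).symm.trans (h1' Z)
  have h4 : a (X - V) = 0 := by rw [map_sub, h3, hZ, sub_self]
  have h5 : a' (X - V) = 0 := (e' _).symm.trans ((h2' _).2 ((h2 _).1 ((e _).trans h4)))
  rw [map_sub, h3'] at h5
  exact (e X).trans ((sub_eq_zero.1 h5).symm.trans (e' X).symm)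

theorem omegaZero_eq : omegaZero m = fun q : hat m => descForm omegaAmb (q : Quo m) :=
  isConnectionForm_unique
    (Classical.epsilon_spec (p := IsConnectionForm) ⟨_, isConnectionForm_descForm⟩)
    isConnectionForm_descForm

/-- The ambient form that induces `ω_λ`. -/
def omegaLamAmb (j : LieT →ₗ[ℝ] su m) (y : Amb m) : Amb m →L[ℝ] LieT := omegaAmb y + muAmb j y

theorem omegaLam_apply (j : LieT →ₗ[ℝ] su m) {y : Amb m} (hy : y ∈ coneT m) (X : Amb m) :
    omegaLam j (qHat y) (fun _ => (dQ y X : ModQ m)) = omegaLamAmb j y X := by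
  have h1 : omegaZero m (qHat y) (fun _ => (dQ y X : ModQ m)) = omegaAmb y X := by
    rw [omegaZero_eq]
    change descForm omegaAmb (qHat y : Quo m) (fun _ => dQ y X) = _
    rw [coe_qHat hy]; exact descForm_omegaAmb hy.1 X
  have h2 : (mfderiv 𝓘(ℝ, ModQ m) 𝓘(ℝ, ModQ m) (Subtype.val : hat m → Quo m) (qHat y)
      (dQ y X : ModQ m) : ModQ m) = dQ y X :=
    congrArg (fun L : ModQ m →L[ℝ] ModQ m => L (dQ y X))
      (hasMFDerivAt_opens_val (E := ModQ m) (qHat y)).mfderiv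
  have h3 : (lam j).pullback (Subtype.val : hat m → Quo m) (qHat y)
      (fun _ => (dQ y X : ModQ m)) = muAmb j y X := by
    rw [lam_eq]
    change descForm (muAmb j) (qHat y : Quo m) (fun _ => (mfderiv 𝓘(ℝ, ModQ m) 𝓘(ℝ, ModQ m)
      (Subtype.val : hat m → Quo m) (qHat y) (dQ y X : ModQ m) : ModQ m)) = _
    rw [h2, coe_qHat hy]; exact descForm_muAmb j hy.1 X
  change omegaZero m (qHat y) (fun _ => (dQ y X : ModQ m)) +
    (lam j).pullback (Subtype.val : hat m → Quo m) (qHat y) (fun _ => (dQ y X : ModQ m)) = _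
  rw [h1, h3]; rfl

end

section

/-! ## The curvature form -/

variable {m : ℕ} [NeZero m]

/-- The tangent space is coordinatised by this very chart, so the last factor in `DiffForm.d` acts
as the identity. -/
theorem hasMFDerivAt_chartAt_self {E M : Type*} [NormedAddCommGroup E] [NormedSpace ℝ E]
    [TopologicalSpace M] [ChartedSpace E M] (q : M) :
    HasMFDerivAt 𝓘(ℝ, E) 𝓘(ℝ, E) (chartAt E q) q (ContinuousLinearMap.id ℝ E) := by
  refine ⟨(chartAt E q).continuousAt (mem_chart_source _ q), ?_⟩
  simp only [mfld_simps]
  refine HasFDerivAt.hasFDerivWithinAt (𝕜 := ℝ) (E := E) (F := E)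
    ((hasFDerivAt_id (chartAt E q q)).congr_of_eventuallyEq ?_)
  have h : (chartAt E q).target ∈ nhds (chartAt E q q) :=
    (chartAt E q).open_target.mem_nhds ((chartAt E q).map_source (mem_chart_source _ q))
  filter_upwards [h] with z hz
  exact (chartAt E q).right_inv hz

theorem affine_mem_coneT (i : Fin m) {h : ModQ m} (hh : ∀ l, h.2 l ≠ 0) :
    affine i h ∈ coneT m := ⟨affine_mem_coneG i h, fun l => by simpa using hh l⟩

theorem chartAt_hat_apply (q p : hat m) :
    chartAt (ModQ m) q p = mapQ (idxQ (q : Quo m)) (p : Quo m) := rfl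

theorem isOpen_snd_ne_zero : IsOpen {h : ModQ m | ∀ l, h.2 l ≠ 0} := by
  have : {h : ModQ m | ∀ l, h.2 l ≠ 0} = ⋂ l, {h : ModQ m | h.2 l ≠ 0} := by
    ext; simp [-Fin.forall_fin_two]
  rw [this]
  exact isOpen_iInter_of_finite fun l => isOpen_ne_fun (by fun_prop) continuous_const

theorem chartAt_hat_symm (q : hat m) {h : ModQ m} (hh : ∀ l, h.2 l ≠ 0) :
    h ∈ (chartAt (ModQ m) q).target ∧
      (chartAt (ModQ m) q).symm h = qHat (affine (idxQ (q : Quo m)) h) := by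
  set i := idxQ (q : Quo m) with hi
  have hm := affine_mem_coneT i hh
  have h1 : chartAt (ModQ m) q (qHat (affine i h)) = h := by
    rw [chartAt_hat_apply, coe_qHat hm, mapQ_qG hm.1, ← hi, coordQ_affine]
  have h2 : qHat (affine i h) ∈ (chartAt (ModQ m) q).source := by
    have h3 : (chartAt (ModQ m) q).source = Subtype.val ⁻¹' domQ i := by
      change ((chartAt (ModQ m) (q : Quo m)).subtypeRestr ⟨q⟩).source = _
      rw [OpenPartialHomeomorph.subtypeRestr_source]
      rfl
    rw [h3, Set.mem_preimage, coe_qHat hm, qG_mem_domQ hm.1]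
    simp
  have h4 := (chartAt (ModQ m) q).map_source h2
  have h5 := (chartAt (ModQ m) q).left_inv h2
  rw [h1] at h4 h5
  exact ⟨h4, h5⟩

theorem differentiableAt_omegaLamAmb (j : LieT →ₗ[ℝ] su m) {y : Amb m} (hy : y ∈ coneT m) :
    DifferentiableAt ℝ (omegaLamAmb j) y :=
  (differentiableAt_omegaAmb hy.2).add (differentiableAt_muAmb j (ne_zero_of_mem_coneG hy.1))

theorem pullForm_omegaLamAmb (j : LieT →ₗ[ℝ] su m) {i : Fin m} {y : Amb m}
    (hy : y (.inl i) ≠ 0) : (pullForm (omegaLamAmb j) (affine i) (coordQ i y)).comp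
      (fderiv ℝ (coordQ i) y) = omegaLamAmb j y := by
  have h1 := pullForm_muAmb j hy
  have h2 := pullForm_omegaAmb hy
  rw [omegaLamAmb, ← h1, ← h2]
  rfl

theorem pullback_chart_omegaLam (j : LieT →ₗ[ℝ] su m) (q : hat m) {h : ModQ m}
    (hh : ∀ l, h.2 l ≠ 0) :
    DiffForm.pullback (E := ModQ m) (chartAt (ModQ m) q).symm (omegaLam j) h =
      oneForm (pullForm (omegaLamAmb j) (affine (idxQ (q : Quo m))) h) := by
  set i := idxQ (q : Quo m) with hi
  set e := chartAt (ModQ m) q with he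
  have hm := affine_mem_coneT i hh
  have h1 : HasMFDerivAt 𝓘(ℝ, ModQ m) 𝓘(ℝ, ModQ m) (qHat ∘ affine i) h
      ((dQ (affine i h)).comp (fderiv ℝ (affine i) h)) :=
    (hasMFDerivAt_qHat hm).comp h
      ((contDiff_affine i).differentiable (by simp) h).hasFDerivAt.hasMFDerivAt
  have h2 : e.symm =ᶠ[nhds h] (qHat ∘ affine i) := by
    filter_upwards [isOpen_snd_ne_zero.mem_nhds hh] with z hz
    exact (chartAt_hat_symm q hz).2
  have h3 := (h1.congr_of_eventuallyEq h2).mfderiv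
  refine oneForm_ext (V := ModQ m) fun ξ => ?_
  have h4 : (mfderiv 𝓘(ℝ, ModQ m) 𝓘(ℝ, ModQ m) e.symm h ξ : ModQ m) =
      dQ (affine i h) (fderiv ℝ (affine i) h ξ) :=
    congrArg (fun L : ModQ m →L[ℝ] ModQ m => L ξ) h3
  have h5 : ∀ p : hat m, p = qHat (affine i h) → omegaLam j p
      (fun _ => (dQ (affine i h) (fderiv ℝ (affine i) h ξ) : ModQ m)) =
        omegaLamAmb j (affine i h) (fderiv ℝ (affine i) h ξ) := by
    rintro p rfl
    exact omegaLam_apply j hm _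
  change omegaLam j (e.symm h)
    (fun _ => (mfderiv 𝓘(ℝ, ModQ m) 𝓘(ℝ, ModQ m) e.symm h ξ : ModQ m)) = _
  rw [h4]
  exact h5 _ (chartAt_hat_symm q hh).2

/-- `DiffForm.d` is computed in the preferred chart, where `ω_λ` is the pullback of `omegaLamAmb`
along the affine section. That ambient form is basic for the projection to `G \ M̂`, so
`extDeriv_eq_of_section` carries the computation back to the cone. -/
theorem d_omegaLam_apply (j : LieT →ₗ[ℝ] su m) {y : Amb m} (hy : y ∈ coneT m) (X Y : Amb m) :
    (omegaLam j).d (qHat y) ![(dQ y X : ModQ m), (dQ y Y : ModQ m)] =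
      extDeriv (fun z => oneForm (omegaLamAmb j z)) y ![X, Y] := by
  have hi0 : y (.inl (idxQ (qHat y : Quo m))) ≠ 0 := by
    rw [coe_qHat hy]; exact inl_idxQ_ne_zero hy.1
  have hc : chartAt (ModQ m) (qHat y) (qHat y) = coordQ (idxQ (qHat y : Quo m)) y := by
    rw [chartAt_hat_apply, coe_qHat hy, mapQ_qG hy.1]
  have hd : dQ y = fderiv ℝ (coordQ (idxQ (qHat y : Quo m))) y := by rw [coe_qHat hy]; rfl
  have hne : ∀ l, (coordQ (idxQ (qHat y : Quo m)) y).2 l ≠ 0 := coordQ_inr_ne_zero hi0 hy.2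
  have h1 : (fun h => DiffForm.pullback (E := ModQ m) (chartAt (ModQ m) (qHat y)).symm
      (omegaLam j) h) =ᶠ[nhds (coordQ (idxQ (qHat y : Quo m)) y)]
      fun h => oneForm (pullForm (omegaLamAmb j) (affine (idxQ (qHat y : Quo m))) h) := by
    filter_upwards [isOpen_snd_ne_zero.mem_nhds hne] with h hh
    exact pullback_chart_omegaLam j _ hh
  have h2 := (hasMFDerivAt_chartAt_self (E := ModQ m) (qHat y)).mfderiv
  have h3 : ∀ ξ : ModQ m, (mfderiv 𝓘(ℝ, ModQ m) 𝓘(ℝ, ModQ m) (chartAt (ModQ m) (qHat y))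
      (qHat y) ξ : ModQ m) = ξ := fun ξ => congrArg (fun L : ModQ m →L[ℝ] ModQ m => L ξ) h2
  have h4 := extDeriv_eq_of_section (a := omegaLamAmb j) (contDiffAt_coordQ hi0)
    (contDiff_affine (idxQ (qHat y : Quo m)))
    (differentiableAt_omegaLamAmb j (affine_mem_coneT _ hne)) (by
      have : ContinuousAt (fun z : Amb m => z (.inl (idxQ (qHat y : Quo m)))) y := by fun_prop
      filter_upwards [this.eventually_ne hi0] with z hz
      exact pullForm_omegaLamAmb j hz) X Y
  rw [h4, ← hd, ← h1.extDeriv_eq, ← hc]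
  have h5 : (fun i => (mfderiv 𝓘(ℝ, ModQ m) 𝓘(ℝ, ModQ m) (chartAt (ModQ m) (qHat y))
      (qHat y) ((![dQ y X, dQ y Y] : Fin 2 → ModQ m) i) : ModQ m)) = ![dQ y X, dQ y Y] :=
    funext fun i => h3 _
  exact congrArg (fun v : Fin 2 → ModQ m => extDeriv (fun h => DiffForm.pullback (E := ModQ m)
    (chartAt (ModQ m) (qHat y)).symm (omegaLam j) h) (chartAt (ModQ m) (qHat y) (qHat y)) v) h5

theorem extDeriv_omegaLamAmb (j : LieT →ₗ[ℝ] su m) {y : Amb m} (hy : y ∈ coneT m) (X Y : Amb m) :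
    extDeriv (fun z => oneForm (omegaLamAmb j z)) y ![X, Y] =
      extDeriv (fun z => oneForm (muAmb j z)) y ![X, Y] := by
  have h := extDeriv_fun_add (differentiableAt_oneForm (differentiableAt_omegaAmb hy.2))
    (differentiableAt_oneForm (differentiableAt_muAmb j (ne_zero_of_mem_coneG hy.1)))
  have h1 : (fun z => oneForm (omegaLamAmb j z)) =
      fun z => oneForm (omegaAmb z) + oneForm (muAmb j z) := funext fun z => map_add _ _ _
  rw [h1, h]
  change extDeriv (fun z => oneForm (omegaAmb z)) y ![X, Y] + _ = _
  rw [extDeriv_omegaAmb hy.2, zero_add]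
  rfl

/-- The two-form on `T \ (G \ M̂)` induced by the exterior derivative of `muAmb j`. -/
def descCurv (j : LieT →ₗ[ℝ] su m) (b : Base m) : ModB m [⋀^Fin 2]→L[ℝ] LieT :=
  extDeriv (fun h => oneForm (pullForm (muAmb j) (affineB (idxB b)) h)) (mapB (idxB b) b)

theorem descCurv_apply (j : LieT →ₗ[ℝ] su m) {y : Amb m} (hy : y ∈ coneT m) (X Y : Amb m) :
    descCurv j (qT y) ![dB y X, dB y Y] = extDeriv (fun z => oneForm (muAmb j z)) y ![X, Y] := by
  have hi := inl_idxB_ne_zero hy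
  rw [descCurv, mapB_qT hy]
  refine (extDeriv_eq_of_section (a := muAmb j) (contDiffAt_coordB hi hy.2) (contDiff_affineB _)
    (differentiableAt_muAmb j (ne_zero_of_mem_coneG (affineB_mem_coneT _ _).1)) ?_ X Y).symm
  have : ContinuousAt (fun z : Amb m => z (.inl (idxB (qT y)))) y := by fun_prop
  filter_upwards [this.eventually_ne hi, (isOpen_coneT m).mem_nhds hy] with z hz hz'
  exact pullForm_affineB (fun c d r hr hc hd y X => muAmb_blockMul j hr hc hd y X)
    (fun y c d hd => muAmb_vertical j y c d hd) hz hz'.2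

theorem curvature_eq (j : LieT →ₗ[ℝ] su m) : curvature j = descCurv j := by
  refine inducedForm_eq (η' := (descCurv j : DiffForm (ModB m) (Base m) 2 LieT)) ?_
    (isQuotientMap_projT m).surjective mfderiv_projT_surjective
  funext q
  obtain ⟨x, hx, rfl⟩ := qHat_surjective q
  refine twoForm_ext (V := ModQ m) fun ξ η => ?_
  obtain ⟨X, rfl⟩ := dQ_surjective hx.1 ξ
  obtain ⟨Y, rfl⟩ := dQ_surjective hx.1 η
  refine Eq.trans ?_ ((descCurv_apply j hx X Y).trans
    ((extDeriv_omegaLamAmb j hx X Y).symm.trans (d_omegaLam_apply j hx X Y).symm))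
  have h : (fun i => (mfderiv 𝓘(ℝ, ModQ m) 𝓘(ℝ, ModB m) projT (qHat (incl x))
      ((![dQ (incl x) X, dQ (incl x) Y] : Fin 2 → ModQ m) i) : ModB m)) =
      ![dB (incl x) X, dB (incl x) Y] := by
    funext i
    fin_cases i
    · exact mfderiv_projT hx X
    · exact mfderiv_projT hx Y
  exact congrArg (fun v : Fin 2 → ModB m => descCurv j (qT (incl x)) v) h

/-- This replaces the curvature form, defined by choice on a double quotient, by an antisymmetrised
derivative in a vector space. -/
theorem curvature_apply (j : LieT →ₗ[ℝ] su m) {y : Amb m} (hy : y ∈ coneT m) (X Y : Amb m) :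
    curvature j (qT y) ![(dB y X : ModB m), (dB y Y : ModB m)] =
      fderiv ℝ (muAmb j) y X Y - fderiv ℝ (muAmb j) y Y X := by
  rw [curvature_eq, ← extDeriv_oneForm (differentiableAt_muAmb j (ne_zero_of_mem_coneG hy.1))]
  exact descCurv_apply j hy X Y

end

section

/-! ## The action of the automorphisms on the torus and on the orbit types -/

/-- Continuous characters of `𝔱` are exponentials of linear forms. -/
theorem exists_eq_circleExp {V : Type*} [NormedAddCommGroup V] [NormedSpace ℝ V] (χ : V → Circle)
    (hc : Continuous χ) (hadd : ∀ x y, χ (x + y) = χ x * χ y) :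
    ∃ L : V →L[ℝ] ℝ, ∀ x, χ x = Circle.exp (L x) := by
  have h0 : χ 0 = 1 := by
    have h := hadd 0 0
    rw [add_zero] at h
    exact (mul_eq_left.1 h.symm)
  obtain ⟨g, ⟨hg0, hg⟩, -⟩ := Circle.isCoveringMap_exp.existsUnique_continuousMap_lifts
    (⟨χ, hc⟩ : C(V, Circle)) 0 0 (by simp [h0])
  have hgχ : ∀ x, Circle.exp (g x) = χ x := fun x => congrFun hg x
  have hZ : ∀ x y : V, g (x + y) - g x - g y = 0 := by
    intro x y
    -- The additive defect of the lift is continuous on a connected space and takes values in `2πℤ`.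
    -- It vanishes at the origin, so a nonzero value would force the value `π` or `-π`.
    let f : V × V → ℝ := fun p => g (p.1 + p.2) - g p.1 - g p.2
    have hf : Continuous f := by fun_prop
    have hfZ : ∀ p, ∃ n : ℤ, f p = n * (2 * Real.pi) := by
      intro p
      rw [← Circle.exp_eq_one, Circle.exp_sub, Circle.exp_sub, hgχ, hgχ, hgχ, hadd]
      simp
    have hpre : IsPreconnected (Set.range f) := isPreconnected_range hf
    by_contra hne
    have hmem : ∀ p, f p ∈ Set.range f := fun p => ⟨p, rfl⟩
    have hf0 : f (0, 0) = 0 := by simp [f, hg0]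
    have hconn := hpre.ordConnected
    obtain ⟨n, hn⟩ := hfZ (x, y)
    have hpi := Real.pi_pos
    have hn0 : n ≠ 0 := by
      rintro rfl
      exact hne (by simpa [f] using hn)
    rcases lt_or_gt_of_ne hn0 with h | h
    · have h1 : (n : ℝ) ≤ -1 := by exact_mod_cast Int.le_sub_one_of_lt h
      have h2 : -Real.pi ∈ Set.range f := hconn.out (hmem (x, y)) (hmem (0, 0))
        ⟨by rw [hn]; nlinarith, by rw [hf0]; linarith⟩
      obtain ⟨p, hp⟩ := h2
      obtain ⟨k, hk⟩ := hfZ p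
      rw [hp] at hk
      have h3 : (2 * k : ℝ) = -1 := by
        have : Real.pi * (2 * k + 1) = 0 := by linear_combination -hk
        rcases mul_eq_zero.1 this with h | h
        · exact absurd h hpi.ne'
        · linarith
      have h4 : (2 * k : ℤ) = -1 := by exact_mod_cast h3
      omega
    · have h1 : (1 : ℝ) ≤ n := by exact_mod_cast h
      have h2 : Real.pi ∈ Set.range f := hconn.out (hmem (0, 0)) (hmem (x, y))
        ⟨by rw [hf0]; linarith, by rw [hn]; nlinarith⟩
      obtain ⟨p, hp⟩ := h2
      obtain ⟨k, hk⟩ := hfZ p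
      rw [hp] at hk
      have h3 : (2 * k : ℝ) = 1 := by
        have : Real.pi * (2 * k - 1) = 0 := by linear_combination -hk
        rcases mul_eq_zero.1 this with h | h
        · exact absurd h hpi.ne'
        · linarith
      have h4 : (2 * k : ℤ) = 1 := by exact_mod_cast h3
      omega
  let G : V →+ ℝ := { toFun := g, map_zero' := hg0, map_add' := fun x y => by linarith [hZ x y] }
  exact ⟨G.toRealLinearMap g.continuous, fun x => (hgχ x).symm⟩

variable {m : ℕ} [NeZero m]

theorem eq_one_of_smul_eq {q : Quo m} (hq : q ∈ hat m) {t : Torus} (h : t • q = q) : t = 1 := by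
  have h1 : t ∈ MulAction.stabilizer Torus q := h
  have h2 : MulAction.stabilizer Torus q = ⊥ := hq
  rwa [h2, Subgroup.mem_bot] at h1

theorem smul_injective {q : Quo m} (hq : q ∈ hat m) {s t : Torus} (h : s • q = t • q) : s = t := by
  have h1 : (t⁻¹ * s) • q = q := by rw [mul_smul, h, inv_smul_smul]
  exact (inv_mul_eq_one.1 (eq_one_of_smul_eq hq h1)).symm

theorem exists_mem_hat (m : ℕ) [NeZero m] : ∃ q : Quo m, q ∈ hat m := ⟨_, (secT 0 0).2⟩

theorem expT_surjective (t : Torus) : ∃ Z, expT Z = t := by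
  obtain ⟨a, ha⟩ := Circle.exp_surjective t.1
  obtain ⟨b, hb⟩ := Circle.exp_surjective t.2
  exact ⟨![a, b], Prod.ext ha hb⟩

theorem continuous_expT : Continuous expT := by
  unfold expT
  fun_prop

theorem expT_add (Z W : LieT) : expT (Z + W) = expT Z * expT W := by
  refine Prod.ext ?_ ?_ <;> simp [expT, Circle.exp_add]

theorem continuous_smul_quo (q : Quo m) : Continuous fun t : Torus => t • q := by
  obtain ⟨x, rfl⟩ := qG_surjective q
  have h : (fun t : Torus => t • qG (incl x)) = fun t => qG (actT t (incl x)) :=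
    funext fun t => smul_qG t (incl_mem_coneG x)
  rw [h, continuous_iff_continuousAt]
  intro t
  refine ContinuousAt.comp (g := qG) (continuousAt_qG (actT_mem_coneG t (incl_mem_coneG x))) ?_
  refine Continuous.continuousAt ((PiLp.continuous_toLp 2 _).comp (continuous_pi fun i => ?_))
  rcases i with k | l
  · exact continuous_const
  · fin_cases l
    · exact (continuous_subtype_val.comp continuous_fst).mul continuous_const
    · exact (continuous_subtype_val.comp continuous_snd).mul continuous_const

theorem mapQ_smul_snd {y : Amb m} (hy : y ∈ coneG m) (i : Fin m) (t : Torus) :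
    (mapQ i (t • qG y)).2 0 = t.1 * (mapQ i (qG y)).2 0 ∧
      (mapQ i (t • qG y)).2 1 = t.2 * (mapQ i (qG y)).2 1 := by
  rw [smul_qG t hy, mapQ_qG hy, mapQ_qG (actT_mem_coneG t hy)]
  constructor <;> simp [coordQ, mul_div_assoc]

/-- In a chart the torus multiplies the two nonzero coordinates `v_l / |u_i|`, so the torus element
is a quotient of coordinates of the moved point and of `q`. -/
theorem continuous_of_continuous_smul {q : Quo m} (hq : q ∈ hat m) {X : Type*}
    [TopologicalSpace X] {c : X → Torus} (h : Continuous fun x => c x • q) : Continuous c := by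
  obtain ⟨x, hx, hxq⟩ := qHat_surjective ⟨q, hq⟩
  have hxq' : qG (incl x) = q := by rw [← coe_qHat hx, hxq]
  subst hxq'
  obtain ⟨i, hi⟩ := hx.1
  have hdom : ∀ t : Torus, t • qG (incl x) ∈ domQ i := fun t => by
    rw [smul_qG t hx.1, qG_mem_domQ (actT_mem_coneG t hx.1)]
    simpa using hi
  have h1 : Continuous fun z => mapQ i (c z • qG (incl x)) :=
    (continuousOn_chartQ i).comp_continuous h fun z => hdom _
  have hne : ∀ l, (mapQ i (qG (incl x))).2 l ≠ 0 := by
    rw [mapQ_qG hx.1]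
    exact coordQ_inr_ne_zero hi hx.2
  refine Continuous.prodMk (f := fun z => (c z).1) (g := fun z => (c z).2) ?_ ?_
  · refine continuous_induced_rng.2 ?_
    have h2 : Continuous fun z => (mapQ i (c z • qG (incl x))).2 0 / (mapQ i (qG (incl x))).2 0 :=
      ((continuous_apply 0).comp (continuous_snd.comp h1)).div_const _
    refine h2.congr fun z => ?_
    rw [(mapQ_smul_snd hx.1 i _).1, mul_div_cancel_right₀ _ (hne 0)]
    rfl
  · refine continuous_induced_rng.2 ?_
    have h2 : Continuous fun z => (mapQ i (c z • qG (incl x))).2 1 / (mapQ i (qG (incl x))).2 1 :=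
      ((continuous_apply 1).comp (continuous_snd.comp h1)).div_const _
    refine h2.congr fun z => ?_
    rw [(mapQ_smul_snd hx.1 i _).2, mul_div_cancel_right₀ _ (hne 1)]
    rfl

/-- The linear map `Ψ` corresponds to conjugation by `F` under the exponential map. -/
def IsConjDifferential (F : DiffeoQuo m) (Ψ : LieT →L[ℝ] LieT) : Prop :=
  ∀ (Z : LieT) (q : Quo m), F (expT Z • F.symm q) = expT (Ψ Z) • q

/-- Freeness of the action at one point of `G \ M̂` makes `z ↦ F ∘ z ∘ F⁻¹` a well-defined
continuous endomorphism of `T`. Composed with `expT`, its two components are characters of `𝔱`,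
hence exponentials of linear forms. -/
theorem exists_isConjDifferential {F : DiffeoQuo m} (hF : IsTPreserving F) :
    ∃ Ψ, IsConjDifferential F Ψ := by
  choose C hC using hF
  obtain ⟨q₀, hq₀⟩ := exists_mem_hat m
  have hmul : ∀ s t, C (s * t) = C s * C t := by
    intro s t
    refine smul_injective hq₀ ?_
    rw [← hC, mul_smul, mul_smul, ← hC t, ← hC s, F.symm_apply_apply]
  have hcont : Continuous C := by
    refine continuous_of_continuous_smul hq₀ ?_
    have : (fun t => C t • q₀) = fun t => F (t • F.symm q₀) := funext fun t => (hC t q₀).symm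
    rw [this]
    exact F.continuous.comp (continuous_smul_quo _)
  have hE : ∀ Z W, C (expT (Z + W)) = C (expT Z) * C (expT W) := fun Z W => by
    rw [expT_add, hmul]
  obtain ⟨L₀, h₀⟩ := exists_eq_circleExp (fun Z => (C (expT Z)).1)
    (continuous_fst.comp (hcont.comp continuous_expT)) fun Z W => by rw [hE]; rfl
  obtain ⟨L₁, h₁⟩ := exists_eq_circleExp (fun Z => (C (expT Z)).2)
    (continuous_snd.comp (hcont.comp continuous_expT)) fun Z W => by rw [hE]; rfl
  refine ⟨ContinuousLinearMap.pi ![L₀, L₁], fun Z q => ?_⟩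
  rw [hC]
  congr 1
  exact Prod.ext (h₀ Z) (h₁ Z)

/-! ### Lengths of the fundamental fields, and the signed permutation defined by an automorphism -/

/-- The squared `h₀`-norms of the fundamental fields `Z₁^*`, `Z₂^*`. -/
def levelQ (q : Quo m) (l : Fin 2) : ℝ :=
  metricH0 m q (fundField (basisZ l) q) (fundField (basisZ l) q)

/-- The vectors `(0, i v_l)` are mutually orthogonal, orthogonal to the radial and `G`-directions,
and have length `|v_l|`, so the metric on torus orbits is diagonal in `Z₁, Z₂`. -/
theorem metricH0_fundField (Z W : LieT) {y : Amb m} (hy : y ∈ coneG m) :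
    metricH0 m (qG y) (fundField Z (qG y)) (fundField W (qG y)) =
      ∑ l, Z l * W l * (‖y (.inr l)‖ ^ 2 / ‖y‖ ^ 2) := by
  rw [fundField_qG Z hy, fundField_qG W hy, metricH0_apply hy, map_sum]
  refine Finset.sum_congr rfl fun l _ => ?_
  rw [map_smul, formG_vertV, inner_vertV_right]
  by_cases h : y (.inr l) = 0
  · simp [h]
  · have : omegaAmb y (∑ l, Z l • vertV l y) l = Z l := by
      rw [omegaAmb_apply]
      have : (∑ l, Z l • vertV l y) (.inr l) = Z l * Complex.I * y (.inr l) := by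
        fin_cases l <;> simp [vertV, mul_assoc]
      rw [this, mul_div_cancel_right₀ _ h]
      simp
    rw [this, smul_eq_mul]
    ring

theorem levelQ_qG {y : Amb m} (hy : y ∈ coneG m) (l : Fin 2) :
    levelQ (qG y) l = ‖y (.inr l)‖ ^ 2 / ‖y‖ ^ 2 := by
  rw [levelQ, metricH0_fundField _ _ hy,
    Finset.sum_eq_single l (fun l' _ h => by simp [basisZ, h]) (by simp)]
  simp [basisZ]

theorem metricH0_fundField_eq (Z W : LieT) (q : Quo m) :
    metricH0 m q (fundField Z q) (fundField W q) = ∑ l, Z l * W l * levelQ q l := by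
  obtain ⟨x, rfl⟩ := qG_surjective q
  rw [metricH0_fundField _ _ (incl_mem_coneG x)]
  simp only [levelQ_qG (incl_mem_coneG x)]

theorem levelQ_pos {q : Quo m} (hq : q ∈ hat m) (l : Fin 2) : 0 < levelQ q l := by
  obtain ⟨x, hx, hxq⟩ := qHat_surjective ⟨q, hq⟩
  have hxq' : qG (incl x) = q := by rw [← coe_qHat hx, hxq]
  rw [← hxq', levelQ_qG hx.1, norm_incl]
  have := norm_pos_iff.2 (hx.2 l)
  positivity

theorem norm_sq_amb (y : Amb m) :
    ‖y‖ ^ 2 = ‖vertU y‖ ^ 2 + ‖y (.inr 0)‖ ^ 2 + ‖y (.inr 1)‖ ^ 2 := by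
  rw [EuclideanSpace.norm_sq_eq, EuclideanSpace.norm_sq_eq, Fintype.sum_sum_type,
    Fintype.sum_sum_type]
  simp [vertU, add_assoc]

theorem levelQ_sum_lt (q : Quo m) : levelQ q 0 + levelQ q 1 < 1 := by
  obtain ⟨x, rfl⟩ := qG_surjective q
  have hx := incl_mem_coneG x
  rw [levelQ_qG hx, levelQ_qG hx, norm_incl]
  have h := norm_sq_amb (incl x)
  have h1 := norm_pos_iff.2 (vertU_ne_zero hx)
  rw [norm_incl] at h
  have h2 : 0 < ‖vertU (incl x)‖ ^ 2 := by positivity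
  linarith

/-- The model point with prescribed component `u` and positive real components of `v`. -/
def levelPoint (u : Fin m → ℂ) (a : Fin 2 → ℝ) : Amb m :=
  WithLp.toLp 2 (Sum.elim u (fun l => (a l : ℂ)))

@[simp] theorem levelPoint_inl (u : Fin m → ℂ) (a : Fin 2 → ℝ) (k : Fin m) :
    levelPoint u a (.inl k) = u k := rfl

@[simp] theorem levelPoint_inr (u : Fin m → ℂ) (a : Fin 2 → ℝ) (l : Fin 2) :
    levelPoint u a (.inr l) = a l := rfl

theorem levelPoint_mem_coneT {u : Fin m → ℂ} (hu : u ≠ 0) {a : Fin 2 → ℝ} (ha : ∀ l, 0 < a l) :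
    levelPoint u a ∈ coneT m := by
  refine ⟨?_, fun l => by simpa using (ha l).ne'⟩
  by_contra h
  refine hu (funext fun k => ?_)
  by_contra hk
  exact h ⟨k, hk⟩

theorem exists_level {s t : ℝ} (hs : 0 < s) (ht : 0 < t) (hst : s + t < 1) :
    ∃ q : Quo m, q ∈ hat m ∧ levelQ q 0 = s ∧ levelQ q 1 = t := by
  have hu : (Pi.single 0 ((Real.sqrt (1 - s - t) : ℝ) : ℂ) : Fin m → ℂ) ≠ 0 := by
    have : 0 < Real.sqrt (1 - s - t) := Real.sqrt_pos.2 (by linarith)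
    simpa using this.ne'
  have hy := levelPoint_mem_coneT hu (a := ![Real.sqrt s, Real.sqrt t]) (by
    intro l
    fin_cases l
    · exact Real.sqrt_pos.2 hs
    · exact Real.sqrt_pos.2 ht)
  set y := levelPoint (Pi.single 0 ((Real.sqrt (1 - s - t) : ℝ) : ℂ) : Fin m → ℂ)
    ![Real.sqrt s, Real.sqrt t] with hyd
  have hn : ‖y‖ ^ 2 = 1 := by
    rw [EuclideanSpace.norm_sq_eq, Fintype.sum_sum_type,
      Finset.sum_eq_single 0 (fun k _ hk => by simp [hyd, hk]) (by simp)]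
    simp [hyd, Real.sq_sqrt hs.le, Real.sq_sqrt ht.le,
      Real.sq_sqrt (by linarith : (0 : ℝ) ≤ 1 - s - t)]
  refine ⟨qG y, ?_, ?_, ?_⟩
  · rw [← coe_qHat hy]; exact (qHat y).2
  · rw [levelQ_qG hy.1, hn]; simp [hyd, Real.sq_sqrt hs.le]
  · rw [levelQ_qG hy.1, hn]; simp [hyd, Real.sq_sqrt ht.le]

theorem hasMFDerivAt_orbit (Z : LieT) (q : Quo m) :
    HasMFDerivAt 𝓘(ℝ, ℝ) 𝓘(ℝ, ModQ m) (fun t : ℝ => expT (t • Z) • q) 0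
      (ContinuousLinearMap.toSpanSingleton ℝ (fundField Z q : ModQ m)) := by
  obtain ⟨x, rfl⟩ := qG_surjective q
  have hy := incl_mem_coneG x
  have h0 : actT (expT ((0 : ℝ) • Z)) (incl x) = incl x := by rw [expT_zero_smul, actT_one]
  have h1 : HasMFDerivAt 𝓘(ℝ, ℝ) 𝓘(ℝ, Amb m) (fun t : ℝ => actT (expT (t • Z)) (incl x)) 0
      (ContinuousLinearMap.toSpanSingleton ℝ (∑ l, Z l • vertV l (incl x))) :=
    (hasDerivAt_actT Z (incl x)).hasFDerivAt.hasMFDerivAt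
  have h2 : HasMFDerivAt 𝓘(ℝ, Amb m) 𝓘(ℝ, ModQ m) qG (actT (expT ((0 : ℝ) • Z)) (incl x))
      (dQ (incl x)) := by
    rw [h0]; exact hasMFDerivAt_qG hy
  have h3 := h2.comp (0 : ℝ) h1
  have h4 : (qG ∘ fun t : ℝ => actT (expT (t • Z)) (incl x)) =
      fun t : ℝ => expT (t • Z) • qG (incl x) := funext fun t => (smul_qG _ hy).symm
  rw [h4] at h3
  have h5 : (dQ (incl x)).comp
      (ContinuousLinearMap.toSpanSingleton ℝ (∑ l, Z l • vertV l (incl x))) =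
      ContinuousLinearMap.toSpanSingleton ℝ (fundField Z (qG (incl x)) : ModQ m) := by
    rw [fundField_qG Z hy]
    ext1
    simp only [ContinuousLinearMap.comp_apply, ContinuousLinearMap.toSpanSingleton_apply, one_smul]
    exact (one_smul ℝ _).symm
  exact h5 ▸ h3

theorem mfderiv_fundField {F : DiffeoQuo m} {Ψ : LieT →L[ℝ] LieT} (h : IsConjDifferential F Ψ)
    (Z : LieT) (q : Quo m) :
    mfderiv 𝓘(ℝ, ModQ m) 𝓘(ℝ, ModQ m) F q (fundField Z q) = fundField (Ψ Z) (F q) := by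
  have h0 : expT ((0 : ℝ) • Z) • q = q := by rw [expT_zero_smul, one_smul]
  have hF : HasMFDerivAt 𝓘(ℝ, ModQ m) 𝓘(ℝ, ModQ m) F (expT ((0 : ℝ) • Z) • q)
      (mfderiv 𝓘(ℝ, ModQ m) 𝓘(ℝ, ModQ m) F q : ModQ m →L[ℝ] ModQ m) := by
    rw [h0]; exact ((F.contMDiff q).mdifferentiableAt (by simp)).hasMFDerivAt
  have h1 := (hF.comp (0 : ℝ) (hasMFDerivAt_orbit Z q)).mfderiv
  have h2 : (F ∘ fun t : ℝ => expT (t • Z) • q) = fun t : ℝ => expT (t • Ψ Z) • F q := by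
    funext t
    have := h (t • Z) (F q)
    rw [F.symm_apply_apply, Ψ.map_smul] at this
    exact this
  rw [h2, (hasMFDerivAt_orbit (Ψ Z) (F q)).mfderiv] at h1
  have h3 := congrArg (fun L : ℝ →L[ℝ] ModQ m => L 1) h1
  have h4 : ((1 : ℝ) • (fundField (Ψ Z) (F q) : ModQ m) : ModQ m) =
    (mfderiv 𝓘(ℝ, ModQ m) 𝓘(ℝ, ModQ m) F q : ModQ m →L[ℝ] ModQ m)
      ((1 : ℝ) • (fundField Z q : ModQ m)) := h3
  rw [one_smul, one_smul] at h4
  exact h4.symm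

/-- `F` conjugates stabilizers to stabilizers. With the surjectivity of `F` it follows that all
orbit types of `G \ M̂` occur at images of points of `G \ M̂`. -/
theorem mem_hat_of_map {F : DiffeoQuo m} {Ψ : LieT →L[ℝ] LieT} (h : IsConjDifferential F Ψ)
    {q : Quo m} (hq : F q ∈ hat m) : q ∈ hat m := by
  change MulAction.stabilizer Torus q = ⊥
  rw [eq_bot_iff]
  intro t ht
  rw [MulAction.mem_stabilizer_iff] at ht
  obtain ⟨Z, rfl⟩ := expT_surjective t
  have h1 := h Z (F q)
  rw [F.symm_apply_apply, ht] at h1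
  have h2 := eq_one_of_smul_eq hq h1.symm
  obtain ⟨q₀, hq₀⟩ := exists_mem_hat m
  have h3 := h Z (F q₀)
  rw [F.symm_apply_apply, h2, one_smul] at h3
  rw [Subgroup.mem_bot]
  exact eq_one_of_smul_eq hq₀ (F.injective h3)

theorem levelQ_map {F : DiffeoQuo m} (hF : F ∈ AutT m) {Ψ : LieT →L[ℝ] LieT}
    (h : IsConjDifferential F Ψ) {q : Quo m} (hq : q ∈ hat m) (Z : LieT) :
    ∑ l, Ψ Z l * Ψ Z l * levelQ (F q) l = ∑ l, Z l * Z l * levelQ q l := by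
  have h1 := hF.2.1 q hq Z
  rw [mfderiv_fundField h, metricH0_fundField_eq, metricH0_fundField_eq] at h1
  exact h1

/-- An automorphism permutes the two circle factors of the torus up to sign, and it permutes
the orbit types accordingly. -/
theorem exists_perm {F : DiffeoQuo m} (hF : F ∈ AutT m) {Ψ : LieT →L[ℝ] LieT}
    (h : IsConjDifferential F Ψ) : ∃ (σ : Equiv.Perm (Fin 2)) (ε : Fin 2 → ℝ),
      (∀ k, ε k = 1 ∨ ε k = -1) ∧ (∀ k, Ψ (basisZ k) = ε k • basisZ (σ k)) ∧
      ∀ q ∈ hat m, ∀ k, levelQ (F q) (σ k) = levelQ q k := by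
  set P : Fin 2 → Fin 2 → ℝ := fun l k => Ψ (basisZ k) l with hP
  have hquad : ∀ q ∈ hat m, ∀ k, P 0 k ^ 2 * levelQ (F q) 0 + P 1 k ^ 2 * levelQ (F q) 1 =
      levelQ q k := by
    intro q hq k
    have h1 := levelQ_map hF h hq (basisZ k)
    rw [Fin.sum_univ_two, Finset.sum_eq_single k (fun l' _ h => by simp [basisZ, h])
      (by simp)] at h1
    simp only [basisZ, Pi.single_eq_same] at h1
    simp only [hP, basisZ]
    linarith
  -- Polarisation: the quadratic form on the right has no mixed term in `Z₁, Z₂`.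
  have hcross : ∀ q ∈ hat m, P 0 0 * P 0 1 * levelQ (F q) 0 + P 1 0 * P 1 1 * levelQ (F q) 1 =
      0 := by
    intro q hq
    have h1 := levelQ_map hF h hq (basisZ 0 + basisZ 1)
    have h2 := hquad q hq 0
    have h3 := hquad q hq 1
    rw [Fin.sum_univ_two, Fin.sum_univ_two, map_add] at h1
    have e0 : (basisZ 0 + basisZ 1) 0 = 1 := by simp [basisZ]
    have e1 : (basisZ 0 + basisZ 1) 1 = 1 := by simp [basisZ]
    have e2 : ∀ l, (Ψ (basisZ 0) + Ψ (basisZ 1)) l = P l 0 + P l 1 := fun l => rfl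
    rw [e0, e1, e2, e2] at h1
    linarith
  have hsurj : ∀ s t : ℝ, 0 < s → 0 < t → s + t < 1 → ∃ q ∈ hat m, levelQ (F q) 0 = s ∧
      levelQ (F q) 1 = t := by
    intro s t hs ht hst
    obtain ⟨q, hq, h0, h1⟩ := exists_level (m := m) hs ht hst
    refine ⟨F.symm q, mem_hat_of_map h (by rwa [F.apply_symm_apply]), ?_, ?_⟩
    · rwa [F.apply_symm_apply]
    · rwa [F.apply_symm_apply]
  -- The level vectors `(1/2, 1/4)` and `(1/4, 1/2)` are linearly independent, so the mixed relation
  -- at these two points kills both products `P l 0 * P l 1`.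
  obtain ⟨q₁, hq₁, a1, b1⟩ := hsurj (1 / 2) (1 / 4) (by norm_num) (by norm_num) (by norm_num)
  obtain ⟨q₂, hq₂, a2, b2⟩ := hsurj (1 / 4) (1 / 2) (by norm_num) (by norm_num) (by norm_num)
  have c1 := hcross q₁ hq₁
  have c2 := hcross q₂ hq₂
  rw [a1, b1] at c1
  rw [a2, b2] at c2
  have z0 : P 0 0 * P 0 1 = 0 := by linarith
  have z1 : P 1 0 * P 1 1 = 0 := by linarith
  -- `Ψ` covers an endomorphism of `T`, so it maps the kernel `2πℤ²` of the exponential map to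
  -- itself.
  have hint : ∀ l k, ∃ n : ℤ, P l k = n := by
    intro l k
    obtain ⟨q₀, hq₀⟩ := exists_mem_hat m
    have h1 := h ((2 * Real.pi) • basisZ k) q₀
    have h2 : expT ((2 * Real.pi) • basisZ k) = 1 := by
      refine Prod.ext ?_ ?_ <;> fin_cases k <;> simp [expT, basisZ]
    rw [h2, one_smul, F.apply_symm_apply] at h1
    have h3 := eq_one_of_smul_eq hq₀ h1.symm
    rw [map_smul] at h3
    have h4 : Circle.exp (2 * Real.pi * P l k) = 1 := by
      fin_cases l
      · exact congrArg Prod.fst h3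
      · exact congrArg Prod.snd h3
    obtain ⟨n, hn⟩ := Circle.exp_eq_one.1 h4
    refine ⟨n, ?_⟩
    have := Real.pi_pos
    have h5 : 2 * Real.pi * (P l k - n) = 0 := by linear_combination hn
    rcases mul_eq_zero.1 h5 with h | h
    · linarith
    · linarith
  -- In `hquad` the weights on the left are at least `1/4` and the right side is below `1`. With
  -- integrality the entries are `0` or `±1`.
  have hle : ∀ l k, P l k ^ 2 < 4 := by
    intro l k
    have u1 := hquad q₁ hq₁ k
    have u2 := hquad q₂ hq₂ k
    rw [a1, b1] at u1
    rw [a2, b2] at u2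
    have v1 : levelQ q₁ k < 1 := by
      have := levelQ_sum_lt q₁
      have p0 := levelQ_pos hq₁ 0
      have p1 := levelQ_pos hq₁ 1
      fin_cases k
      · simp; linarith
      · simp; linarith
    have v2 : levelQ q₂ k < 1 := by
      have := levelQ_sum_lt q₂
      have p0 := levelQ_pos hq₂ 0
      have p1 := levelQ_pos hq₂ 1
      fin_cases k
      · simp; linarith
      · simp; linarith
    fin_cases l
    · simp only [Fin.zero_eta]
      nlinarith [sq_nonneg (P 0 k), sq_nonneg (P 1 k)]
    · simp only [Fin.mk_one]
      nlinarith [sq_nonneg (P 0 k), sq_nonneg (P 1 k)]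
  have hpm : ∀ l k, P l k = 0 ∨ P l k = 1 ∨ P l k = -1 := by
    intro l k
    obtain ⟨n, hn⟩ := hint l k
    have h1 := hle l k
    rw [hn] at h1
    have h2 : n ^ 2 < 4 := by exact_mod_cast h1
    have h3 : -2 < n ∧ n < 2 := by constructor <;> nlinarith
    obtain ⟨h4, h5⟩ := h3
    interval_cases n <;> simp [hn]
  have hcol : ∀ k, ¬ (P 0 k = 0 ∧ P 1 k = 0) := by
    rintro k ⟨e0, e1⟩
    have h1 := hquad q₁ hq₁ k
    rw [e0, e1] at h1
    have := levelQ_pos hq₁ k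
    linarith
  have hΨ : ∀ k, Ψ (basisZ k) = P 0 k • basisZ 0 + P 1 k • basisZ 1 := by
    intro k
    funext l
    fin_cases l <;> simp [hP, basisZ]
  by_cases h00 : P 0 0 = 0
  · have h10 : P 1 0 ≠ 0 := fun h' => hcol 0 ⟨h00, h'⟩
    have h11 : P 1 1 = 0 := (mul_eq_zero.1 z1).resolve_left h10
    have h01 : P 0 1 ≠ 0 := fun h' => hcol 1 ⟨h', h11⟩
    have s10 := (hpm 1 0).resolve_left h10
    have s01 := (hpm 0 1).resolve_left h01
    refine ⟨Equiv.swap 0 1, ![P 1 0, P 0 1], fun k => ?_, fun k => ?_, fun q hq k => ?_⟩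
    · fin_cases k
      · exact s10
      · exact s01
    · fin_cases k
      · simpa [h00] using hΨ 0
      · simpa [h11] using hΨ 1
    · have u := hquad q hq k
      fin_cases k
      · rcases s10 with s | s <;> simpa [h00, s] using u
      · rcases s01 with s | s <;> simpa [h11, s] using u
  · have h01 : P 0 1 = 0 := (mul_eq_zero.1 z0).resolve_left h00
    have h11 : P 1 1 ≠ 0 := fun h' => hcol 1 ⟨h01, h'⟩
    have h10 : P 1 0 = 0 := (mul_eq_zero.1 z1).resolve_right h11
    have s00 := (hpm 0 0).resolve_left h00
    have s11 := (hpm 1 1).resolve_left h11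
    refine ⟨1, ![P 0 0, P 1 1], fun k => ?_, fun k => ?_, fun q hq k => ?_⟩
    · fin_cases k
      · exact s00
      · exact s11
    · fin_cases k
      · simpa [h10] using hΨ 0
      · simpa [h01] using hΨ 1
    · have u := hquad q hq k
      fin_cases k
      · rcases s00 with s | s <;> simpa [h10, s] using u
      · rcases s11 with s | s <;> simpa [h01, s] using u

end

section

/-! ## Transition probabilities along curves -/

/-- The Hermitian space `ℂ^m`. -/
abbrev Herm (m : ℕ) : Type := EuclideanSpace ℂ (Fin m)

/-- The transition probability between the lines spanned by two vectors. -/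
def transProb {m : ℕ} (u w : Herm m) : ℝ := ‖inner ℂ u w‖ ^ 2 / (‖u‖ ^ 2 * ‖w‖ ^ 2)

theorem transProb_comm {m : ℕ} (u w : Herm m) : transProb u w = transProb w u := by
  rw [transProb, transProb, norm_inner_symm, mul_comm]

theorem transProb_smul_left {m : ℕ} {c : ℂ} (hc : c ≠ 0) (u w : Herm m) :
    transProb (c • u) w = transProb u w := by
  have : ‖c‖ ^ 2 ≠ 0 := pow_ne_zero 2 (norm_ne_zero_iff.2 hc)
  rw [transProb, transProb, inner_smul_left, norm_mul, norm_smul, RCLike.norm_conj, mul_pow,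
    mul_pow, mul_assoc, mul_div_mul_left _ _ this]

theorem transProb_smul_right {m : ℕ} {c : ℂ} (hc : c ≠ 0) (u w : Herm m) :
    transProb u (c • w) = transProb u w := by
  rw [transProb_comm, transProb_smul_left hc, transProb_comm]

theorem transProb_self {m : ℕ} {u : Herm m} (hu : u ≠ 0) : transProb u u = 1 := by
  have : ‖u‖ ≠ 0 := norm_ne_zero_iff.2 hu
  rw [transProb, inner_self_eq_norm_sq_to_K]
  simp
  field_simp

theorem transProb_nonneg {m : ℕ} (u w : Herm m) : 0 ≤ transProb u w := by
  unfold transProb; positivity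

theorem transProb_le_one {m : ℕ} (u w : Herm m) : transProb u w ≤ 1 := by
  refine div_le_one_of_le₀ ?_ (by positivity)
  rw [← mul_pow]
  exact pow_le_pow_left₀ (norm_nonneg _) (norm_inner_le_norm u w) 2

/-- This is Cauchy–Schwarz for the components of `p` and `U` orthogonal to `u`, rescaled by `‖u‖²`
to avoid denominators. -/
theorem gram_inequality {m : ℕ} {p u : Herm m} (hp : ‖p‖ = 1) (hu : u ≠ 0) (U : Herm m) :
    ‖(‖u‖ ^ 2 : ℂ) * inner ℂ p U - inner ℂ p u * inner ℂ u U‖ ^ 2 ≤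
      (‖u‖ ^ 2 - ‖inner ℂ p u‖ ^ 2) * (‖u‖ ^ 2 * ‖U‖ ^ 2 - ‖inner ℂ u U‖ ^ 2) := by
  have hn : 0 < ‖u‖ ^ 2 := by have := norm_pos_iff.2 hu; positivity
  have key : ∀ x y : Herm m, ‖((‖u‖ : ℂ) ^ 2) • x - (inner ℂ u x) • u‖ ^ 2 =
      ‖u‖ ^ 2 * (‖u‖ ^ 2 * ‖x‖ ^ 2 - ‖inner ℂ u x‖ ^ 2) := by
    intro x _
    have h1 := norm_sub_sq (𝕜 := ℂ) (((‖u‖ : ℂ) ^ 2) • x) ((inner ℂ u x) • u)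
    rw [h1, inner_smul_left, inner_smul_right, norm_smul, norm_smul, ← inner_conj_symm x u,
      RCLike.mul_conj]
    simp only [norm_pow, map_pow, Complex.conj_ofReal, Complex.norm_real, norm_norm, RCLike.re_to_complex]
    have : ((‖u‖ : ℂ) ^ 2 * ((‖inner ℂ u x‖ : ℝ) : ℂ) ^ 2).re = ‖u‖ ^ 2 * ‖inner ℂ u x‖ ^ 2 := by
      rw [← Complex.ofReal_pow, ← Complex.ofReal_pow, ← Complex.ofReal_mul, Complex.ofReal_re]
    erw [this]
    ring
  have h2 : inner ℂ (((‖u‖ : ℂ) ^ 2) • p - (inner ℂ u p) • u)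
      (((‖u‖ : ℂ) ^ 2) • U - (inner ℂ u U) • u) =
      (‖u‖ ^ 2 : ℂ) * ((‖u‖ ^ 2 : ℂ) * inner ℂ p U - inner ℂ p u * inner ℂ u U) := by
    simp only [inner_sub_left, inner_sub_right, inner_smul_left, inner_smul_right,
      inner_self_eq_norm_sq_to_K, map_pow, Complex.conj_ofReal, inner_conj_symm]
    have : (RCLike.ofReal ‖u‖ : ℂ) = (‖u‖ : ℂ) := rfl
    rw [this]
    ring
  have h3 := norm_inner_le_norm (𝕜 := ℂ) (((‖u‖ : ℂ) ^ 2) • p - (inner ℂ u p) • u)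
      (((‖u‖ : ℂ) ^ 2) • U - (inner ℂ u U) • u)
  have h4 := pow_le_pow_left₀ (norm_nonneg _) h3 2
  rw [h2, norm_mul, mul_pow, mul_pow, key p p, key U U, hp, norm_inner_symm u p] at h4
  simp only [norm_pow, Complex.norm_real, norm_norm] at h4
  have h5 : 0 < (‖u‖ ^ 2) ^ 2 := by positivity
  refine le_of_mul_le_mul_left (h4.trans (le_of_eq ?_)) h5
  ring

/-- The hypothesis bounds the Fubini–Study speed of the curve of lines by `v`. The component of `U`
along `u` does not move the line, and `gram_inequality` bounds the effect of the rest; the result is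
the speed bound for `cos²` of the distance to the line of `p`. -/
theorem hasDerivAt_transProb {m : ℕ} {p : Herm m} (hp : ‖p‖ = 1) {u : ℝ → Herm m} {U : Herm m}
    {t : ℝ} (hu : HasDerivAt u U t) (h0 : u t ≠ 0) {v : ℝ} (hv : 0 ≤ v)
    (hU : ‖U‖ ^ 2 - ‖inner ℂ (u t) U‖ ^ 2 / ‖u t‖ ^ 2 ≤ v ^ 2 * ‖u t‖ ^ 2) :
    ∃ f', HasDerivAt (fun s => transProb p (u s)) f' t ∧
      |f'| ≤ 2 * v * Real.sqrt (transProb p (u t) * (1 - transProb p (u t))) := by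
  have hn : 0 < ‖u t‖ := norm_pos_iff.2 h0
  have h1 : HasDerivAt (fun s => inner ℂ p (u s)) (inner ℂ p U) t :=
    ((innerSL ℂ p).restrictScalars ℝ).hasFDerivAt.comp_hasDerivAt t hu
  have h2 : HasDerivAt (fun s => ‖inner ℂ p (u s)‖ ^ 2)
      (2 * inner ℝ (inner ℂ p (u t) : ℂ) (inner ℂ p U : ℂ)) t := h1.norm_sq
  have h3 : HasDerivAt (fun s => ‖u s‖ ^ 2) (2 * (inner ℂ (u t) U).re) t := by
    have h : ∀ s, ‖u s‖ ^ 2 = ∑ k, ‖u s k‖ ^ 2 := fun s => EuclideanSpace.norm_sq_eq _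
    have hk : ∀ k, HasDerivAt (fun s => u s k) (U k) t := fun k =>
      ((EuclideanSpace.proj k : Herm m →L[ℂ] ℂ).restrictScalars ℝ).hasFDerivAt.comp_hasDerivAt t hu
    have h' := HasDerivAt.fun_sum (u := Finset.univ) fun k _ => (hk k).norm_sq
    simp only [h]
    refine h'.congr_deriv ?_
    rw [PiLp.inner_apply, Complex.re_sum, Finset.mul_sum]
    refine Finset.sum_congr rfl fun k _ => ?_
    rw [Complex.inner]
    simp
  have h4 := h2.div h3 (by positivity)
  refine ⟨_, h4.congr_of_eventuallyEq (Filter.Eventually.of_forall fun s => ?_), ?_⟩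
  · simp [transProb, hp]
  set a : ℂ := inner ℂ p (u t) with ha
  set b : ℂ := inner ℂ p U with hb
  set c : ℂ := inner ℂ (u t) U with hc
  set n : ℝ := ‖u t‖ with hnd
  have h5 := gram_inequality hp h0 U
  rw [← ha, ← hb, ← hc, ← hnd] at h5
  have hg : transProb p (u t) = ‖a‖ ^ 2 / n ^ 2 := by simp [transProb, hp, ha, hnd]
  have hpos : 0 ≤ n ^ 2 - ‖a‖ ^ 2 := by
    have := transProb_le_one p (u t)
    rw [hg, div_le_one (by positivity)] at this
    linarith
  have h6 : 2 * inner ℝ a b * n ^ 2 - ‖a‖ ^ 2 * (2 * c.re) =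
      2 * inner ℝ a ((n ^ 2 : ℂ) * b - a * c) := by
    rw [Complex.inner, Complex.inner, ← Complex.normSq_eq_norm_sq, Complex.normSq_apply,
      ← Complex.ofReal_pow]
    simp only [Complex.mul_re, Complex.mul_im, Complex.sub_re, Complex.sub_im, Complex.conj_re,
      Complex.conj_im, Complex.ofReal_re, Complex.ofReal_im]
    ring
  have h7 : ‖(n ^ 2 : ℂ) * b - a * c‖ ≤ Real.sqrt (n ^ 2 - ‖a‖ ^ 2) * (v * n ^ 2) := by
    refine abs_le_of_sq_le_sq' ?_ (by positivity) |>.2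
    rw [mul_pow, Real.sq_sqrt hpos]
    refine h5.trans (mul_le_mul_of_nonneg_left ?_ hpos)
    have := mul_le_mul_of_nonneg_left hU (sq_nonneg n)
    rw [mul_sub, mul_div_cancel₀ _ (by positivity)] at this
    linarith
  rw [h6, hg]
  have h8 : ‖a‖ ^ 2 / n ^ 2 * (1 - ‖a‖ ^ 2 / n ^ 2) = (‖a‖ / n ^ 2) ^ 2 * (n ^ 2 - ‖a‖ ^ 2) := by
    field_simp
  rw [h8, Real.sqrt_mul (by positivity), Real.sqrt_sq (by positivity), abs_div, abs_mul,
    abs_of_pos (by positivity : (0 : ℝ) < (n ^ 2) ^ 2), div_le_iff₀ (by positivity)]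
  have h9 := (abs_real_inner_le_norm a ((n ^ 2 : ℂ) * b - a * c)).trans
    (mul_le_mul_of_nonneg_left h7 (norm_nonneg a))
  rw [abs_two]
  refine (mul_le_mul_of_nonneg_left h9 (by norm_num)).trans (le_of_eq ?_)
  field_simp

/-- A function that grows at most as fast as `sin²` is bounded by `sin²`. -/
theorem le_sin_sq {h h' : ℝ → ℝ} {T : ℝ} (hT0 : 0 ≤ T) (hT : T < Real.pi / 2) (h0 : h 0 = 0)
    (hd : ∀ t ∈ Set.Icc 0 T, HasDerivAt h (h' t) t)
    (hb : ∀ t ∈ Set.Icc 0 T, |h' t| ≤ 2 * Real.sqrt (h t * (1 - h t))) :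
    h T ≤ Real.sin T ^ 2 := by
  have hcont : ContinuousOn h (Set.Icc 0 T) := fun t ht => (hd t ht).continuousAt.continuousWithinAt
  -- The equation `h' = 2 √(h (1 - h))` has several solutions starting at `0`, so direct comparison
  -- fails. The shift by `ε` makes the bound start above zero and the factor `1 + ε` makes it grow
  -- strictly faster wherever the two functions meet.
  have key : ∀ ε : ℝ, 0 < ε → (1 + ε) * T + ε < Real.pi / 2 →
      h T ≤ Real.sin ((1 + ε) * T + ε) ^ 2 := by
    intro ε hε hlt
    have hang : ∀ t, HasDerivAt (fun t => (1 + ε) * t + ε) (1 + ε) t := fun t => by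
      simpa using ((hasDerivAt_id t).const_mul (1 + ε)).add_const ε
    have hB : ∀ t, HasDerivAt (fun t => Real.sin ((1 + ε) * t + ε) ^ 2)
        (2 * Real.sin ((1 + ε) * t + ε) * (Real.cos ((1 + ε) * t + ε) * (1 + ε))) t := fun t => by
      refine (((hang t).sin).pow 2).congr_deriv ?_
      simp
    refine image_le_of_deriv_right_lt_deriv_boundary hcont
      (fun t ht => (hd t ⟨ht.1, ht.2.le⟩).hasDerivWithinAt) (by rw [h0]; positivity) hB
      (fun t ht heq => ?_) ⟨hT0, le_rfl⟩
    have hpos : 0 < (1 + ε) * t + ε := by have := ht.1; positivity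
    have hlt' : (1 + ε) * t + ε < Real.pi / 2 := by
      have := ht.2
      nlinarith
    have hs : 0 < Real.sin ((1 + ε) * t + ε) :=
      Real.sin_pos_of_pos_of_lt_pi hpos (by linarith [Real.pi_pos])
    have hc : 0 < Real.cos ((1 + ε) * t + ε) :=
      Real.cos_pos_of_mem_Ioo ⟨by linarith [Real.pi_pos], hlt'⟩
    have h1 := (le_abs_self _).trans (hb t ⟨ht.1, ht.2.le⟩)
    rw [heq, ← Real.cos_sq', ← mul_pow, Real.sqrt_sq (by positivity)] at h1
    have : 0 < Real.sin ((1 + ε) * t + ε) * Real.cos ((1 + ε) * t + ε) := by positivity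
    nlinarith
  have hlim : Filter.Tendsto (fun ε : ℝ => Real.sin ((1 + ε) * T + ε) ^ 2) (nhdsWithin 0 (Set.Ioi 0))
      (nhds (Real.sin T ^ 2)) := by
    have : ContinuousAt (fun ε : ℝ => Real.sin ((1 + ε) * T + ε) ^ 2) 0 := by fun_prop
    have h2 := this.tendsto
    simp only [add_zero, one_mul] at h2
    exact h2.mono_left nhdsWithin_le_nhds
  have hlim2 : Filter.Tendsto (fun ε : ℝ => (1 + ε) * T + ε) (nhdsWithin 0 (Set.Ioi 0)) (nhds T) := by
    have : ContinuousAt (fun ε : ℝ => (1 + ε) * T + ε) 0 := by fun_prop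
    have h2 := this.tendsto
    simp only [add_zero, one_mul] at h2
    exact h2.mono_left nhdsWithin_le_nhds
  refine ge_of_tendsto hlim ?_
  filter_upwards [hlim2.eventually (gt_mem_nhds hT), self_mem_nhdsWithin] with ε h1 h2
  exact key ε h2 h1

end

section

/-! ## Lines and levels of the points of the base -/

variable {m : ℕ} [NeZero m]

/-- The component `u` of `(u, v)` as an element of the Hermitian space. -/
def partE (m : ℕ) : Amb m →L[ℝ] Herm m :=
  LinearMap.toContinuousLinearMap
    { toFun := fun x => WithLp.toLp 2 fun k => x (.inl k)
      map_add' := fun _ _ => rfl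
      map_smul' := fun _ _ => rfl }

/-- The inclusion `u ↦ (u, 0)`. -/
def ofE (m : ℕ) : Herm m →L[ℝ] Amb m :=
  LinearMap.toContinuousLinearMap
    { toFun := fun u => WithLp.toLp 2 (Sum.elim u 0)
      map_add' := fun _ _ => amb_ext' (fun _ => rfl) fun _ => by simp
      map_smul' := fun _ _ => amb_ext' (fun _ => rfl) fun _ => by simp }

@[simp] theorem partE_apply (y : Amb m) (k : Fin m) : partE m y k = y (.inl k) := rfl

@[simp] theorem ofE_inl (u : Herm m) (k : Fin m) : ofE m u (.inl k) = u k := rfl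

@[simp] theorem ofE_inr (u : Herm m) (l : Fin 2) : ofE m u (.inr l) = 0 := rfl

@[simp] theorem partE_ofE (u : Herm m) : partE m (ofE m u) = u := by ext k; simp

theorem partE_ne_zero {y : Amb m} (hy : y ∈ coneG m) : partE m y ≠ 0 := by
  obtain ⟨k, hk⟩ := hy
  intro h
  exact hk (congrArg (fun u : Herm m => u k) h)

theorem partE_blockMul (c : ℂ) (d : Fin 2 → ℂ) (y : Amb m) :
    partE m (blockMul c d y) = c • partE m y := by ext k; simp

theorem norm_partE (y : Amb m) : ‖partE m y‖ = ‖vertU y‖ := by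
  rw [EuclideanSpace.norm_eq, EuclideanSpace.norm_eq, Fintype.sum_sum_type]
  simp [vertU]

theorem norm_sq_eq_partE (y : Amb m) :
    ‖y‖ ^ 2 = ‖partE m y‖ ^ 2 + ∑ l, ‖y (.inr l)‖ ^ 2 := by
  rw [norm_sq_amb, norm_partE, Fin.sum_univ_two, add_assoc]

theorem inner_eq_partE (x y : Amb m) :
    inner ℝ x y = (inner ℂ (partE m x) (partE m y)).re + ∑ l, inner ℝ (x (.inr l)) (y (.inr l)) := by
  rw [inner_amb, PiLp.inner_apply, Complex.re_sum]
  congr 1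

theorem qT_blockMul {c : ℂ} {d : Fin 2 → ℂ} {r : ℝ} (hr : 0 < r) (hc : ‖c‖ = r)
    (hd : ∀ l, ‖d l‖ = r) {y : Amb m} (hy : y ∈ coneT m) : qT (blockMul c d y) = qT y := by
  have hc0 : c ≠ 0 := norm_pos_iff.1 (hc ▸ hr)
  have hd0 : ∀ l, d l ≠ 0 := fun l => norm_pos_iff.1 (hd l ▸ hr)
  have hy' := blockMul_mem_coneT hc0 hd0 hy
  obtain ⟨i, hi⟩ := hy.1
  refine eq_of_mapB_eq (i := i) ((qT_mem_domB hy' i).2 (by simp [hc0, hi]))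
    ((qT_mem_domB hy i).2 hi) ?_
  rw [mapB_qT hy', mapB_qT hy, coordB_blockMul i hr hc hd]

/-- A representative of a point of the base. -/
def repB (b : Base m) : Amb m := affineB (idxB b) (mapB (idxB b) b)

theorem repB_mem (b : Base m) : repB b ∈ coneT m := affineB_mem_coneT _ _

theorem qT_repB (b : Base m) : qT (repB b) = b := qT_affineB_mapB (mem_domB_idxB b)

theorem repB_qT {y : Amb m} (hy : y ∈ coneT m) : ∃ (c : ℂ) (d : Fin 2 → ℂ) (r : ℝ),
    0 < r ∧ ‖c‖ = r ∧ (∀ l, ‖d l‖ = r) ∧ repB (qT y) = blockMul c d y := by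
  obtain ⟨c, d, r, hr, hc, hd, h, -⟩ := exists_symmetry_affineB (inl_idxB_ne_zero hy) hy.2
  exact ⟨c, d, r, hr, hc, hd, by rw [repB, mapB_qT hy, h]⟩

/-- The quotients `|v_l| / ‖u‖`. -/
def levelB (b : Base m) (l : Fin 2) : ℝ := ‖repB b (.inr l)‖ / ‖partE m (repB b)‖

theorem levelB_qT {y : Amb m} (hy : y ∈ coneT m) (l : Fin 2) :
    levelB (qT y) l = ‖y (.inr l)‖ / ‖partE m y‖ := by
  obtain ⟨c, d, r, hr, hc, hd, h⟩ := repB_qT hy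
  rw [levelB, h, partE_blockMul, norm_smul, blockMul_inr, norm_mul, hc, hd,
    mul_div_mul_left _ _ hr.ne']

/-- The transition probability of the lines given by two points of the base. -/
def transB (b b' : Base m) : ℝ := transProb (partE m (repB b)) (partE m (repB b'))

theorem transB_qT {y z : Amb m} (hy : y ∈ coneT m) (hz : z ∈ coneT m) :
    transB (qT y) (qT z) = transProb (partE m y) (partE m z) := by
  obtain ⟨c, d, r, hr, hc, hd, h⟩ := repB_qT hy
  obtain ⟨c', d', r', hr', hc', hd', h'⟩ := repB_qT hz
  rw [transB, h, h', partE_blockMul, partE_blockMul,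
    transProb_smul_left (norm_pos_iff.1 (hc ▸ hr)), transProb_smul_right (norm_pos_iff.1 (hc' ▸ hr'))]

/-- The point `(u, ‖u‖ s)`. -/
def levelVec (s : Fin 2 → ℝ) (u : Herm m) : Amb m := levelPoint u (fun l => ‖u‖ * s l)

theorem levelVec_mem {s : Fin 2 → ℝ} (hs : ∀ l, 0 < s l) {u : Herm m} (hu : u ≠ 0) :
    levelVec s u ∈ coneT m :=
  levelPoint_mem_coneT (fun h => hu (by ext k; exact congrFun h k))
    fun l => mul_pos (norm_pos_iff.2 hu) (hs l)

@[simp] theorem partE_levelVec (s : Fin 2 → ℝ) (u : Herm m) : partE m (levelVec s u) = u := rfl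

theorem levelVec_inr (s : Fin 2 → ℝ) (u : Herm m) (l : Fin 2) :
    levelVec s u (.inr l) = ((‖u‖ * s l : ℝ) : ℂ) := rfl

/-- The point of the base at the level `s` given by a vector. -/
def qL (s : Fin 2 → ℝ) (u : Herm m) : Base m := qT (levelVec s u)

theorem levelB_qL {s : Fin 2 → ℝ} (hs : ∀ l, 0 < s l) {u : Herm m} (hu : u ≠ 0) (l : Fin 2) :
    levelB (qL s u) l = s l := by
  have := norm_pos_iff.2 hu
  rw [qL, levelB_qT (levelVec_mem hs hu), levelVec_inr, partE_levelVec, Complex.norm_real,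
    Real.norm_of_nonneg (mul_nonneg this.le (hs l).le), mul_div_cancel_left₀ _ this.ne']

theorem qL_smul {s : Fin 2 → ℝ} (hs : ∀ l, 0 < s l) {u : Herm m} (hu : u ≠ 0) {c : ℂ}
    (hc : c ≠ 0) : qL s (c • u) = qL s u := by
  rw [qL, qL, ← qT_blockMul (norm_pos_iff.2 hc) rfl (d := fun _ => (‖c‖ : ℂ)) (by simp)
    (levelVec_mem hs hu)]
  congr 1
  refine amb_ext' (fun k => rfl) fun l => ?_
  rw [blockMul_inr, levelVec_inr, levelVec_inr, norm_smul]
  push_cast; ring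

/-- The torus removes the phases of `v`, the level fixes the moduli `|v_l|` from `‖u‖`, and scaling
normalises `u`. A level is therefore the space of lines of `ℂ^m`. -/
theorem exists_qL_eq {s : Fin 2 → ℝ} {b : Base m} (hb : ∀ l, levelB b l = s l) :
    ∃ u : Herm m, ‖u‖ = 1 ∧ qL s u = b := by
  have hs : ∀ l, 0 < s l := fun l => by
    rw [← hb l]
    exact div_pos (norm_pos_iff.2 ((repB_mem b).2 l)) (norm_pos_iff.2 (partE_ne_zero (repB_mem b).1))
  set y := repB b with hy
  have hu := partE_ne_zero (repB_mem b).1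
  have hn := norm_pos_iff.2 hu
  have h1 : qL s (partE m y) = b := by
    rw [← qT_repB b, qL, ← hy, ← qT_blockMul one_pos (c := 1) (by simp)
      (d := fun l => (‖y (.inr l)‖ : ℂ) / y (.inr l)) (fun l => ?_) (repB_mem b)]
    · congr 1
      refine amb_ext' (fun k => (one_mul _).symm) fun l => ?_
      rw [levelVec_inr, blockMul_inr, div_mul_cancel₀ _ ((repB_mem b).2 l), ← hb l, levelB,
        mul_div_cancel₀ _ hn.ne']
    · have := (repB_mem b).2 l
      rw [← hy] at this
      simp [this]
  have hc : ((‖partE m y‖⁻¹ : ℝ) : ℂ) ≠ 0 := by exact_mod_cast (inv_pos.2 hn).ne'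
  refine ⟨((‖partE m y‖⁻¹ : ℝ) : ℂ) • partE m y, ?_, ?_⟩
  · rw [norm_smul, Complex.norm_real, norm_inv, norm_norm, inv_mul_cancel₀ hn.ne']
  · rw [qL_smul hs hu hc, h1]

theorem transB_qL {s : Fin 2 → ℝ} (hs : ∀ l, 0 < s l) {u w : Herm m} (hu : u ≠ 0) (hw : w ≠ 0) :
    transB (qL s u) (qL s w) = transProb u w :=
  transB_qT (levelVec_mem hs hu) (levelVec_mem hs hw)

/-- The metric `h₀^T` along a level. -/
theorem formT_level {s : Fin 2 → ℝ} (hs : ∀ l, 0 < s l) {y W : Amb m} (hy : y ∈ coneT m)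
    (hl : ∀ l, ‖y (.inr l)‖ = ‖partE m y‖ * s l)
    (hW : ∀ l, inner ℝ (y (.inr l)) (W (.inr l)) =
      s l ^ 2 * (inner ℂ (partE m y) (partE m W)).re) :
    formT y W W = (‖partE m W‖ ^ 2 - ‖inner ℂ (partE m y) (partE m W)‖ ^ 2 / ‖partE m y‖ ^ 2) /
      ((1 + ∑ l, s l ^ 2) * ‖partE m y‖ ^ 2) := by
  have hn := norm_pos_iff.2 (partE_ne_zero hy.1)
  set n := ‖partE m y‖ with hnd
  set N := 1 + ∑ l, s l ^ 2 with hN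
  have hNpos : 0 < N := by
    have : 0 ≤ ∑ l, s l ^ 2 := Finset.sum_nonneg fun l _ => sq_nonneg _
    linarith
  set c : ℂ := inner ℂ (partE m y) (partE m W) with hc
  have e1 : ‖y‖ ^ 2 = N * n ^ 2 := by
    rw [norm_sq_eq_partE]
    simp only [hl, mul_pow, ← Finset.mul_sum]
    rw [hN, ← hnd]; ring
  have e2 : inner ℝ y W = N * c.re := by
    rw [inner_eq_partE, ← hc]
    simp only [hW, ← Finset.sum_mul]
    rw [hN]; ring
  have e3 : inner ℝ (vertU y) W = c.im := by
    have : partE m (vertU y) = Complex.I • partE m y := partE_blockMul _ _ _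
    rw [inner_eq_partE, this, inner_smul_left, ← hc]
    simp [vertU]
  have e4 : ∀ l, ‖vertV l y‖ ^ 2 = ‖y (.inr l)‖ ^ 2 := by
    intro l
    rw [norm_sq_eq_partE]
    have : partE m (vertV l y) = 0 := by ext k; simp [vertV]
    rw [this, Finset.sum_eq_single l (fun k _ hk => by simp [vertV, hk]) (by simp)]
    simp [vertV]
  have e5 : ∀ l, inner ℝ (vertV l y) W = inner ℝ (Complex.I * y (.inr l)) (W (.inr l)) := by
    intro l
    rw [inner_eq_partE]
    have : partE m (vertV l y) = 0 := by ext k; simp [vertV]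
    rw [this, Finset.sum_eq_single l (fun k _ hk => by simp [vertV, hk]) (by simp)]
    simp [vertV]
  -- The component of `W_l` along `v_l` is fixed by tangency to the level, and the one along `i v_l`
  -- is the part subtracted in `formT`.
  have e6 : ∀ l, ‖W (.inr l)‖ ^ 2 * ‖y (.inr l)‖ ^ 2 =
      (s l ^ 2 * c.re) ^ 2 + inner ℝ (Complex.I * y (.inr l)) (W (.inr l)) ^ 2 := by
    intro l
    rw [← hW l, Complex.inner, Complex.inner, ← Complex.normSq_eq_norm_sq,
      ← Complex.normSq_eq_norm_sq, Complex.normSq_apply, Complex.normSq_apply]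
    simp
    ring
  have e7 : ∀ l, inner ℝ (vertV l y) W * inner ℝ (vertV l y) W / (‖vertV l y‖ ^ 2 * ‖y‖ ^ 2) =
      (‖W (.inr l)‖ ^ 2 - s l ^ 2 * c.re ^ 2 / n ^ 2) / (N * n ^ 2) := by
    intro l
    have hl0 := hs l
    rw [e4, e5, hl, e1]
    have := e6 l
    rw [hl] at this
    field_simp
    linear_combination (-1) * this
  have e8 : ‖c‖ ^ 2 = c.re ^ 2 + c.im ^ 2 := by
    rw [← Complex.normSq_eq_norm_sq, Complex.normSq_apply]; ring
  have e9 : ‖y‖ ^ 4 = (N * n ^ 2) ^ 2 := by rw [← e1]; ring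
  rw [formT_apply, formG_apply]
  simp only [e7]
  rw [real_inner_self_eq_norm_sq, norm_sq_eq_partE W, ← norm_partE, ← hnd, e1, e9, e2, e3, e8,
    ← Finset.sum_div, Finset.sum_sub_distrib, ← Finset.sum_div, ← Finset.sum_mul]
  have hN' : ∑ l, s l ^ 2 = N - 1 := by rw [hN]; ring
  rw [hN']
  field_simp
  ring

end

section

/-! ## Isometries of the base that preserve a level -/

variable {m : ℕ} [NeZero m]

/-- Lift of the image of a curve under a diffeomorphism of the base. -/
theorem exists_lift (Φ : DiffeoBase m) {z : ℝ → Amb m} {Z : Amb m} {t₀ : ℝ}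
    (hz : HasDerivAt z Z t₀) (h0 : z t₀ ∈ coneT m) :
    ∃ (y : ℝ → Amb m) (W : Amb m), HasDerivAt y W t₀ ∧
      (∀ᶠ t in nhds t₀, y t ∈ coneT m ∧ qT (y t) = Φ (qT (z t))) ∧
      (dB (y t₀) W : ModB m) =
        mfderiv 𝓘(ℝ, ModB m) 𝓘(ℝ, ModB m) Φ (qT (z t₀)) (dB (z t₀) Z : ModB m) := by
  set c : ℝ → Base m := fun t => Φ (qT (z t)) with hc
  set D : ModB m →L[ℝ] ModB m := mfderiv 𝓘(ℝ, ModB m) 𝓘(ℝ, ModB m) Φ (qT (z t₀)) with hD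
  have hΦ : HasMFDerivAt 𝓘(ℝ, ModB m) 𝓘(ℝ, ModB m) Φ (qT (z t₀)) D :=
    ((Φ.contMDiff _).mdifferentiableAt (by simp)).hasMFDerivAt
  have hq := hasMFDerivAt_qT h0
  have hz' : HasMFDerivAt 𝓘(ℝ, ℝ) 𝓘(ℝ, Amb m) z t₀ (ContinuousLinearMap.toSpanSingleton ℝ Z) :=
    hz.hasFDerivAt.hasMFDerivAt
  have hcd : HasMFDerivAt 𝓘(ℝ, ℝ) 𝓘(ℝ, ModB m) c t₀
      (D.comp ((dB (z t₀)).comp (ContinuousLinearMap.toSpanSingleton ℝ Z))) :=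
    HasMFDerivAt.comp (g := Φ) t₀ hΦ (HasMFDerivAt.comp (g := qT) t₀ hq hz')
  obtain ⟨hcc, hfd⟩ := hasMFDerivAt_iff_of_vectorSpace.1 hcd
  set i := idxB (c t₀) with hi
  have hfd' : HasDerivAt (fun t => mapB i (c t)) (D (dB (z t₀) Z)) t₀ := by
    refine (HasFDerivAt.hasDerivAt hfd).congr_deriv ?_
    change D (dB (z t₀) ((1 : ℝ) • Z)) = _
    rw [one_smul]
  have hy := ((contDiff_affineB i).differentiable (by simp) (mapB i (c t₀))).hasFDerivAt.comp_hasDerivAt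
    t₀ hfd'
  have hev : ∀ᶠ t in nhds t₀, qT (affineB i (mapB i (c t))) = c t := by
    filter_upwards [hcc.eventually_mem ((isOpen_domB i).mem_nhds (mem_domB_idxB (c t₀)))] with t ht
    exact qT_affineB_mapB ht
  refine ⟨fun t => affineB i (mapB i (c t)), _, hy, ?_, ?_⟩
  · filter_upwards [hev] with t ht
    exact ⟨affineB_mem_coneT _ _, ht⟩
  · have h1 := HasMFDerivAt.comp t₀ (hasMFDerivAt_qT (affineB_mem_coneT i (mapB i (c t₀))))
      (hy.hasFDerivAt.hasMFDerivAt)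
    have h2 := hcd.congr_of_eventuallyEq (f₁ := fun t => qT (affineB i (mapB i (c t)))) hev
    have h3 := hasMFDerivAt_unique h1 h2
    have h4 : dB (affineB i (mapB i (c t₀))) ((1 : ℝ) • fderiv ℝ (affineB i) (mapB i (c t₀))
        (D (dB (z t₀) Z))) = D (dB (z t₀) ((1 : ℝ) • Z)) :=
      congrArg (fun L : ℝ →L[ℝ] ModB m => L 1) h3
    rw [one_smul, one_smul] at h4
    exact h4

theorem isometry_formT {Φ : DiffeoBase m} (hΦ : IsIsometryBase Φ) {y z : Amb m} (hy : y ∈ coneT m)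
    (hz : z ∈ coneT m) (hyz : qT y = Φ (qT z)) {W Z : Amb m} (h : (dB y W : ModB m) =
      mfderiv 𝓘(ℝ, ModB m) 𝓘(ℝ, ModB m) Φ (qT z) (dB z Z : ModB m)) :
    formT y W W = formT z Z Z := by
  rw [← metricH0T_apply hy, ← metricH0T_apply hz]
  have key : ∀ (b : Base m) (ξ : ModB m), b = Φ (qT z) →
      ξ = mfderiv 𝓘(ℝ, ModB m) 𝓘(ℝ, ModB m) Φ (qT z) (dB z Z : ModB m) →
      metricH0T m b ξ ξ = metricH0T m (qT z) (dB z Z : ModB m) (dB z Z : ModB m) := by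
    rintro _ _ rfl rfl
    have h1 := congrFun hΦ (qT z)
    exact congrArg (fun B : LinearMap.BilinForm ℝ (ModB m) => B (dB z Z) (dB z Z)) h1
  exact key _ _ hyz h

/-- `Φ` maps the level `s` to itself. -/
def PreservesLevel (s : Fin 2 → ℝ) (Φ : DiffeoBase m) : Prop :=
  ∀ b : Base m, (∀ l, levelB b l = s l) → ∀ l, levelB (Φ b) l = s l

/-- Differentiate the equation `‖v_l‖² = s_l² ‖u‖²` of the level along the curve. The result is the
tangency hypothesis of `formT_level`. -/
theorem level_deriv {s : Fin 2 → ℝ} {y : ℝ → Amb m} {W : Amb m} {t : ℝ} (hy : HasDerivAt y W t)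
    (h : ∀ᶠ τ in nhds t, ∀ l, ‖y τ (.inr l)‖ = ‖partE m (y τ)‖ * s l) (l : Fin 2) :
    inner ℝ (y t (.inr l)) (W (.inr l)) =
      s l ^ 2 * (inner ℂ (partE m (y t)) (partE m W)).re := by
  have hk : ∀ k, HasDerivAt (fun τ => y τ k) (W k) t := fun k =>
    ((EuclideanSpace.proj k : Amb m →L[ℂ] ℂ).restrictScalars ℝ).hasFDerivAt.comp_hasDerivAt t hy
  have h1 := (hk (.inr l)).norm_sq
  have h2 := (HasDerivAt.fun_sum (u := Finset.univ)
    fun k _ => (hk (.inl k)).norm_sq).const_mul (s l ^ 2)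
  have h3 := h2.congr_of_eventuallyEq (f₁ := fun τ => ‖y τ (.inr l)‖ ^ 2) (by
    filter_upwards [h] with τ hτ
    rw [hτ l, mul_pow, EuclideanSpace.norm_sq_eq]
    simp [mul_comm])
  have h4 := h1.unique h3
  rw [← Finset.mul_sum] at h4
  have h5 : (inner ℂ (partE m (y t)) (partE m W)).re =
      ∑ k, inner ℝ (y t (.inl k)) (W (.inl k)) := by
    rw [PiLp.inner_apply, Complex.re_sum]
    exact Finset.sum_congr rfl fun k _ => rfl
  rw [h5]
  linarith

/-- On unit vectors the `v`-component is the constant `s`, so only `u` moves. -/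
theorem hasDerivAt_levelVec {s : Fin 2 → ℝ} {u : ℝ → Herm m} {U : Herm m} {t : ℝ}
    (hu : HasDerivAt u U t) (h1 : ∀ τ, ‖u τ‖ = 1) :
    HasDerivAt (fun τ => levelVec s (u τ)) (ofE m U) t := by
  have h2 : (fun τ => levelVec s (u τ)) =
      fun τ => ofE m (u τ) + levelVec s (u t) - ofE m (u t) := by
    funext τ
    refine amb_ext' (fun k => ?_) fun l => ?_
    · simp [levelVec]
    · simp [levelVec, h1]
  rw [h2]
  exact (((ofE m).hasFDerivAt.comp_hasDerivAt t hu).add_const _).sub_const _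

/-- The speed of the image of a curve of lines. -/
theorem exists_lift_level {s : Fin 2 → ℝ} (hs : ∀ l, 0 < s l) {Φ : DiffeoBase m}
    (hΦ : IsIsometryBase Φ) (hL : PreservesLevel s Φ) {u : ℝ → Herm m} {U : Herm m} {t : ℝ}
    (hu : HasDerivAt u U t) (h1 : ∀ τ, ‖u τ‖ = 1) (hU : inner ℂ (u t) U = 0) :
    ∃ (y : ℝ → Amb m) (W : Amb m), HasDerivAt y W t ∧
      (∀ᶠ τ in nhds t, y τ ∈ coneT m ∧ qT (y τ) = Φ (qL s (u τ))) ∧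
      ‖partE m W‖ ^ 2 - ‖inner ℂ (partE m (y t)) (partE m W)‖ ^ 2 / ‖partE m (y t)‖ ^ 2 =
        ‖U‖ ^ 2 * ‖partE m (y t)‖ ^ 2 := by
  have h0 : ∀ τ, u τ ≠ 0 := fun τ h => by simpa [h] using h1 τ
  have hz := hasDerivAt_levelVec (s := s) hu h1
  have hzc : ∀ τ, levelVec s (u τ) ∈ coneT m := fun τ => levelVec_mem hs (h0 τ)
  obtain ⟨y, W, hy, hev, hd⟩ := exists_lift Φ hz (hzc t)
  refine ⟨y, W, hy, hev, ?_⟩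
  have hlev : ∀ᶠ τ in nhds t, ∀ l, ‖y τ (.inr l)‖ = ‖partE m (y τ)‖ * s l := by
    filter_upwards [hev] with τ hτ l
    have h2 := hL (qL s (u τ)) (levelB_qL hs (h0 τ)) l
    have h3 : qT (y τ) = Φ (qL s (u τ)) := hτ.2
    rw [← h3, levelB_qT hτ.1, div_eq_iff (norm_ne_zero_iff.2 (partE_ne_zero hτ.1.1))] at h2
    rw [h2, mul_comm]
  have hy0 := hev.self_of_nhds
  have e1 := isometry_formT hΦ hy0.1 (hzc t) hy0.2 hd
  rw [formT_level hs hy0.1 hlev.self_of_nhds (level_deriv hy hlev), formT_level hs (hzc t)] at e1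
  · have hn := norm_pos_iff.2 (partE_ne_zero hy0.1.1)
    have hN : 0 < 1 + ∑ l, s l ^ 2 := by
      have : 0 ≤ ∑ l, s l ^ 2 := Finset.sum_nonneg fun l _ => sq_nonneg _
      linarith
    rw [partE_ofE, partE_levelVec, hU, h1] at e1
    simp only [norm_zero] at e1
    rw [div_eq_div_iff (by positivity) (by positivity)] at e1
    -- Both curves run in the same level, so the metric carries the same constant factor on both
    -- sides and what remains compares Fubini–Study speeds.
    have e2 : (1 + ∑ l, s l ^ 2) *
        (‖partE m W‖ ^ 2 - ‖inner ℂ (partE m (y t)) (partE m W)‖ ^ 2 / ‖partE m (y t)‖ ^ 2 -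
          ‖U‖ ^ 2 * ‖partE m (y t)‖ ^ 2) = 0 := by
      linear_combination e1
    have := (mul_eq_zero.1 e2).resolve_left hN.ne'
    linarith
  · intro l
    rw [levelVec_inr, partE_levelVec, Complex.norm_real, h1, Real.norm_of_nonneg]
    linarith [hs l]
  · intro l
    rw [partE_ofE, partE_levelVec, hU]
    simp

theorem transB_self (b : Base m) : transB b b = 1 := transProb_self (partE_ne_zero (repB_mem b).1)

/-- The great circle from `u` towards `n` gives a geodesic of unit speed, and its image under `Φ`
also has unit speed. If `f` is the transition probability of the image with its starting line, then
`1 - f` starts at zero and obeys the differential inequality of `le_sin_sq`. -/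
theorem le_transB_map {s : Fin 2 → ℝ} (hs : ∀ l, 0 < s l) {Φ : DiffeoBase m}
    (hΦ : IsIsometryBase Φ) (hL : PreservesLevel s Φ) {u n : Herm m} (hu : ‖u‖ = 1) (hn : ‖n‖ = 1)
    (hun : inner ℂ u n = 0) {T : ℝ} (hT0 : 0 ≤ T) (hT : T < Real.pi / 2) :
    Real.cos T ^ 2 ≤ transB (Φ (qL s u)) (Φ (qL s (Real.cos T • u + Real.sin T • n))) := by
  set c : ℝ → Herm m := fun t => Real.cos t • u + Real.sin t • n with hc
  set c' : ℝ → Herm m := fun t => (-Real.sin t) • u + Real.cos t • n with hc'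
  have hd : ∀ t, HasDerivAt c (c' t) t := fun t =>
    ((Real.hasDerivAt_cos t).smul_const u).add ((Real.hasDerivAt_sin t).smul_const n)
  have hnu : inner ℂ n u = 0 := by rw [← inner_conj_symm, hun, map_zero]
  have hin : ∀ a b a' b' : ℝ, inner ℂ (a • u + b • n) (a' • u + b' • n) = ((a * a' + b * b' : ℝ) : ℂ) := by
    intro a b a' b'
    simp only [← Complex.coe_smul, inner_add_left, inner_add_right, inner_smul_left,
      inner_smul_right, hun, hnu, inner_self_eq_norm_sq_to_K, hu, hn]
    simp
    ring
  have h1 : ∀ t, ‖c t‖ = 1 := by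
    intro t
    have h := inner_self_eq_norm_sq (𝕜 := ℂ) (c t)
    rw [hc, hin] at h
    have h2 : ‖c t‖ ^ 2 = 1 := by
      rw [← h]
      change Real.cos t * Real.cos t + Real.sin t * Real.sin t = 1
      have := Real.sin_sq_add_cos_sq t
      linarith
    exact (sq_eq_sq₀ (norm_nonneg _) zero_le_one).1 (by rw [h2]; norm_num)
  have h1' : ∀ t, ‖c' t‖ = 1 := by
    intro t
    have h := inner_self_eq_norm_sq (𝕜 := ℂ) (c' t)
    rw [hc', hin] at h
    have h2 : ‖c' t‖ ^ 2 = 1 := by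
      rw [← h]
      change -Real.sin t * -Real.sin t + Real.cos t * Real.cos t = 1
      have := Real.sin_sq_add_cos_sq t
      linarith
    exact (sq_eq_sq₀ (norm_nonneg _) zero_le_one).1 (by rw [h2]; norm_num)
  have horth : ∀ t, inner ℂ (c t) (c' t) = 0 := by
    intro t
    rw [hc, hc', hin]
    norm_cast
    ring
  set P : Herm m := partE m (repB (Φ (qL s u))) with hP
  have hP0 : P ≠ 0 := partE_ne_zero (repB_mem _).1
  have hPn : ((‖P‖⁻¹ : ℝ) : ℂ) ≠ 0 := by exact_mod_cast (inv_pos.2 (norm_pos_iff.2 hP0)).ne'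
  set p : Herm m := ((‖P‖⁻¹ : ℝ) : ℂ) • P with hp
  have hp1 : ‖p‖ = 1 := by
    rw [hp, norm_smul, Complex.norm_real, norm_inv, norm_norm,
      inv_mul_cancel₀ (norm_ne_zero_iff.2 hP0)]
  have htr : ∀ {z : Amb m}, z ∈ coneT m → transB (Φ (qL s u)) (qT z) = transProb p (partE m z) := by
    intro z hz
    rw [← qT_repB (Φ (qL s u)), transB_qT (repB_mem _) hz, hp, transProb_smul_left hPn]
  have hder : ∀ t, ∃ f', HasDerivAt (fun τ => transB (Φ (qL s u)) (Φ (qL s (c τ)))) f' t ∧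
      |f'| ≤ 2 * Real.sqrt (transB (Φ (qL s u)) (Φ (qL s (c t))) *
        (1 - transB (Φ (qL s u)) (Φ (qL s (c t))))) := by
    intro t
    obtain ⟨y, W, hy, hev, hnorm⟩ := exists_lift_level hs hΦ hL (hd t) h1 (horth t)
    have hy0 := hev.self_of_nhds
    have hpy : HasDerivAt (fun τ => partE m (y τ)) (partE m W) t :=
      (partE m).hasFDerivAt.comp_hasDerivAt t hy
    obtain ⟨f', hf, hb⟩ := hasDerivAt_transProb hp1 hpy (partE_ne_zero hy0.1.1) zero_le_one (by
      rw [hnorm, h1'])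
    refine ⟨f', hf.congr_of_eventuallyEq ?_, ?_⟩
    · filter_upwards [hev] with τ hτ
      rw [← hτ.2, htr hτ.1]
    · rw [← hy0.2, htr hy0.1]
      simpa using hb
  choose f' hf hb using hder
  have hfin := le_sin_sq (h := fun τ => 1 - transB (Φ (qL s u)) (Φ (qL s (c τ))))
    (h' := fun t => -f' t) hT0 hT (by simp [hc, transB_self]) (fun t _ => (hf t).const_sub 1)
    (fun t _ => by
      rw [abs_neg, mul_comm (1 - _)]
      simpa using hb t)
  have := Real.sin_sq_add_cos_sq T
  linarith

/-- Two non-orthogonal lines are joined by a geodesic of length `T = arccos |⟨u, w⟩| < π/2`, and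
`cos² T` is their transition probability. For orthogonal lines the bound is zero. -/
theorem transProb_le_transB_map {s : Fin 2 → ℝ} (hs : ∀ l, 0 < s l) {Φ : DiffeoBase m}
    (hΦ : IsIsometryBase Φ) (hL : PreservesLevel s Φ) {u w : Herm m} (hu : ‖u‖ = 1) (hw : ‖w‖ = 1) :
    transProb u w ≤ transB (Φ (qL s u)) (Φ (qL s w)) := by
  have hw0 : w ≠ 0 := fun h => by simp [h] at hw
  set a : ℂ := inner ℂ u w with ha
  have htp : transProb u w = ‖a‖ ^ 2 := by simp [transProb, hu, hw, ha]
  have hle : ‖a‖ ≤ 1 := by simpa [hu, hw] using norm_inner_le_norm (𝕜 := ℂ) u w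
  by_cases h0 : a = 0
  · rw [htp, h0]
    rw [norm_zero, zero_pow two_ne_zero]
    exact transProb_nonneg (partE m (repB (Φ (qL s u)))) (partE m (repB (Φ (qL s w))))
  have hapos := norm_pos_iff.2 h0
  -- A change of phase makes the inner product real and positive, so the second vector lies on a
  -- real great circle through `u`.
  set c : ℂ := (‖a‖ : ℂ) / a with hc
  have hc0 : c ≠ 0 := div_ne_zero (by simpa using h0) h0
  have hcn : ‖c‖ = 1 := by simp [hc, h0]
  obtain ⟨w', hw'⟩ : ∃ w' : Herm m, w' = c • w := ⟨_, rfl⟩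
  have hin : inner ℂ u w' = (‖a‖ : ℂ) := by
    rw [hw', inner_smul_right, ← ha, hc, div_mul_cancel₀ _ h0]
  have hw'1 : ‖w'‖ = 1 := by rw [hw', norm_smul, hcn, hw, one_mul]
  rw [htp, ← qL_smul hs hw0 hc0, ← hw']
  have hsub : ‖w' - (‖a‖ : ℂ) • u‖ ^ 2 = 1 - ‖a‖ ^ 2 := by
    rw [norm_sub_sq (𝕜 := ℂ), inner_smul_right, ← inner_conj_symm, hin, norm_smul, hu, hw'1]
    simp
    ring
  by_cases h1 : ‖a‖ = 1
  · rw [h1] at hsub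
    have : w' = u := by
      have h2 : ‖w' - ((1 : ℝ) : ℂ) • u‖ = 0 := by
        have : ‖w' - ((1 : ℝ) : ℂ) • u‖ ^ 2 = 0 := by rw [hsub]; norm_num
        exact pow_eq_zero_iff (two_ne_zero) |>.1 this
      rw [norm_eq_zero, Complex.ofReal_one, one_smul] at h2
      exact sub_eq_zero.1 h2
    rw [this, transB_self, h1]; norm_num
  have hlt : ‖a‖ < 1 := lt_of_le_of_ne hle h1
  have hspos : 0 < Real.sqrt (1 - ‖a‖ ^ 2) := Real.sqrt_pos.2 (by nlinarith)
  set n : Herm m := (((Real.sqrt (1 - ‖a‖ ^ 2))⁻¹ : ℝ) : ℂ) • (w' - (‖a‖ : ℂ) • u) with hn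
  have hT := le_transB_map hs hΦ hL (u := u) (n := n) hu ?_ ?_ (Real.arccos_nonneg ‖a‖)
    (Real.arccos_lt_pi_div_two.2 hapos)
  · rw [Real.cos_arccos (by linarith) hle, Real.sin_arccos] at hT
    convert hT using 3
    rw [hn, ← Complex.coe_smul (Real.sqrt _), smul_smul, ← Complex.ofReal_mul,
      mul_inv_cancel₀ hspos.ne', Complex.ofReal_one, one_smul, ← Complex.coe_smul]
    abel_nf
  · have h2 : ‖w' - (‖a‖ : ℂ) • u‖ = Real.sqrt (1 - ‖a‖ ^ 2) := by
      rw [← hsub, Real.sqrt_sq (norm_nonneg _)]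
    rw [hn, norm_smul, h2, Complex.norm_real, norm_inv, Real.norm_of_nonneg hspos.le,
      inv_mul_cancel₀ hspos.ne']
  · rw [hn, inner_smul_right, inner_sub_right, inner_smul_right, hin, inner_self_eq_norm_sq_to_K, hu]
    simp

theorem IsIsometryBase.symm {Φ : DiffeoBase m} (hΦ : IsIsometryBase Φ) :
    IsIsometryBase Φ.symm := by
  funext b
  have h1 : ∀ b', MDifferentiableAt 𝓘(ℝ, ModB m) 𝓘(ℝ, ModB m) Φ b' := fun b' =>
    (Φ.contMDiff _).mdifferentiableAt (by simp)
  have h2 : ∀ b', MDifferentiableAt 𝓘(ℝ, ModB m) 𝓘(ℝ, ModB m) Φ.symm b' := fun b' =>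
    (Φ.symm.contMDiff _).mdifferentiableAt (by simp)
  set D : ModB m →L[ℝ] ModB m := mfderiv 𝓘(ℝ, ModB m) 𝓘(ℝ, ModB m) Φ (Φ.symm b) with hD
  set D' : ModB m →L[ℝ] ModB m := mfderiv 𝓘(ℝ, ModB m) 𝓘(ℝ, ModB m) Φ.symm b with hD'
  have h3 : ∀ ξ, D (D' ξ) = ξ := by
    have h := ((h1 (Φ.symm b)).hasMFDerivAt.comp b (h2 b).hasMFDerivAt).mfderiv
    have hid : (Φ ∘ Φ.symm : Base m → Base m) = id := funext fun x => Φ.apply_symm_apply x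
    rw [hid, mfderiv_id] at h
    intro ξ
    exact (congrArg (fun L : ModB m →L[ℝ] ModB m => L ξ) h).symm
  have h4 := congrFun hΦ (Φ.symm b)
  have key : ∀ (b' : Base m), b' = b → ∀ ξ η : ModB m,
      metricH0T m b' (D (D' ξ) : ModB m) (D (D' η) : ModB m) = metricH0T m b ξ η := by
    rintro _ rfl ξ η
    rw [h3, h3]
  refine LinearMap.ext fun ξ => LinearMap.ext fun η => ?_
  have h5 := congrArg (fun B : LinearMap.BilinForm ℝ (ModB m) => B (D' ξ) (D' η)) h4
  exact h5.symm.trans (key _ (Φ.apply_symm_apply b) ξ η)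

/-- The one-sided estimate applied to `Φ` and to its inverse gives equality. -/
theorem transB_map {s : Fin 2 → ℝ} (hs : ∀ l, 0 < s l) {Φ : DiffeoBase m}
    (hΦ : IsIsometryBase Φ) (hL : PreservesLevel s Φ) (hL' : PreservesLevel s Φ.symm)
    {u w : Herm m} (hu : ‖u‖ = 1) (hw : ‖w‖ = 1) :
    transB (Φ (qL s u)) (Φ (qL s w)) = transProb u w := by
  have hu0 : u ≠ 0 := fun h => by simp [h] at hu
  have hw0 : w ≠ 0 := fun h => by simp [h] at hw
  refine le_antisymm ?_ (transProb_le_transB_map hs hΦ hL hu hw)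
  obtain ⟨u', hu', hu'b⟩ := exists_qL_eq (hL (qL s u) (levelB_qL hs hu0))
  obtain ⟨w', hw', hw'b⟩ := exists_qL_eq (hL (qL s w) (levelB_qL hs hw0))
  have h := transProb_le_transB_map hs hΦ.symm hL' hu' hw'
  have hu0' : u' ≠ 0 := fun h => by simp [h] at hu'
  have hw0' : w' ≠ 0 := fun h => by simp [h] at hw'
  rw [hu'b, hw'b, Φ.symm_apply_apply, Φ.symm_apply_apply, transB_qL hs hu0 hw0,
    ← transB_qL hs hu0' hw0', hu'b, hw'b] at h
  exact h

end

section

/-! ## Wigner's theorem -/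

variable {m : ℕ} [NeZero m]

/-- Two vectors span the same line. -/
def SameLine (u w : Herm m) : Prop := ∃ c : ℂ, c ≠ 0 ∧ w = c • u

theorem SameLine.symm {u w : Herm m} (h : SameLine u w) : SameLine w u := by
  obtain ⟨c, hc, rfl⟩ := h
  exact ⟨c⁻¹, inv_ne_zero hc, by rw [smul_smul, inv_mul_cancel₀ hc, one_smul]⟩

theorem SameLine.trans {u v w : Herm m} (h : SameLine u v) (h' : SameLine v w) : SameLine u w := by
  obtain ⟨c, hc, rfl⟩ := h
  obtain ⟨d, hd, rfl⟩ := h'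
  exact ⟨d * c, mul_ne_zero hd hc, smul_smul _ _ _⟩

theorem SameLine.transProb_left {u v : Herm m} (h : SameLine u v) (w : Herm m) :
    transProb u w = transProb v w := by
  obtain ⟨c, hc, rfl⟩ := h
  rw [transProb_smul_left hc]

theorem SameLine.transProb_right {u v : Herm m} (h : SameLine u v) (w : Herm m) :
    transProb w u = transProb w v := by
  rw [transProb_comm, h.transProb_left, transProb_comm]

theorem SameLine.map {u v : Herm m} (h : SameLine u v) (L : Herm m ≃ₗᵢ[ℂ] Herm m) :
    SameLine (L u) (L v) := by
  obtain ⟨c, hc, rfl⟩ := h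
  exact ⟨c, hc, map_smul _ _ _⟩

theorem sameLine_of_transProb_eq_one {u w : Herm m} (hu : u ≠ 0) (hw : w ≠ 0)
    (h : transProb u w = 1) : SameLine u w := by
  have hn := norm_pos_iff.2 hu
  have hn' := norm_pos_iff.2 hw
  rw [transProb, div_eq_one_iff_eq (by positivity), ← mul_pow] at h
  have h1 := (sq_eq_sq₀ (norm_nonneg _) (by positivity)).1 h
  obtain ⟨r, hr, h2⟩ := (norm_inner_eq_norm_iff (𝕜 := ℂ) hu hw).1 h1
  exact ⟨r, hr, h2⟩

theorem transProb_of_norm_inner {u v u' v' : Herm m} (h : ‖inner ℂ u v‖ = ‖inner ℂ u' v'‖)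
    (hu : ‖u‖ = ‖u'‖) (hv : ‖v‖ = ‖v'‖) : transProb u v = transProb u' v' := by
  rw [transProb, transProb, h, hu, hv]

/-- `f` induces a map of lines that preserves the transition probabilities. -/
structure PreservesTransProb (f : Herm m → Herm m) : Prop where
  ne_zero : ∀ u, u ≠ 0 → f u ≠ 0
  transProb_map : ∀ u w, u ≠ 0 → w ≠ 0 → transProb (f u) (f w) = transProb u w

/-- The standard basis. -/
def stdE (k : Fin m) : Herm m := EuclideanSpace.single k 1

theorem stdE_ne_zero (k : Fin m) : stdE k ≠ 0 := by simp [stdE]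

@[simp] theorem stdE_self (k : Fin m) : stdE k k = 1 := by simp [stdE]

@[simp] theorem stdE_of_ne {k l : Fin m} (h : l ≠ k) : stdE k l = 0 := by simp [stdE, h]

theorem inner_stdE (k : Fin m) (u : Herm m) : inner ℂ (stdE k) u = u k := by
  simp [stdE, EuclideanSpace.inner_single_left]

theorem norm_stdE (k : Fin m) : ‖stdE k‖ = 1 := by simp [stdE]

theorem transProb_stdE (k : Fin m) (u : Herm m) : transProb (stdE k) u = ‖u k‖ ^ 2 / ‖u‖ ^ 2 := by
  simp [transProb, inner_stdE, norm_stdE]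

theorem ne_zero_of_apply_zero {u : Herm m} (h : u 0 = 1) : u ≠ 0 := by
  rintro rfl
  simp at h

/-- The circles through `z` centred at `0` and `-1` meet only in `z` and its conjugate. -/
theorem eq_of_sq_norm {z w : ℂ} (h1 : ‖z‖ ^ 2 = ‖w‖ ^ 2) (h2 : ‖1 + z‖ ^ 2 = ‖1 + w‖ ^ 2) :
    z.re = w.re ∧ z.im ^ 2 = w.im ^ 2 := by
  simp only [← Complex.normSq_eq_norm_sq, Complex.normSq_apply, Complex.add_re, Complex.add_im,
    Complex.one_re, Complex.one_im] at h1 h2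
  have : z.re = w.re := by linarith
  exact ⟨this, by rw [this] at h1; linarith⟩

/-! ### Wigner's theorem for maps fixing the coordinate lines -/

section Normalized

variable {f : Herm m → Herm m}

/-- The multiple of `f u` with first coordinate `1`. -/
def normalizedMap (f : Herm m → Herm m) (u : Herm m) : Herm m := (f u 0)⁻¹ • f u

variable (hf : PreservesTransProb f) (he : ∀ k, SameLine (stdE k) (f (stdE k)))
include hf he

theorem transProb_stdE_map {u : Herm m} (hu : u ≠ 0) (k : Fin m) :
    ‖f u k‖ ^ 2 / ‖f u‖ ^ 2 = ‖u k‖ ^ 2 / ‖u‖ ^ 2 := by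
  rw [← transProb_stdE, ← transProb_stdE, (he k).transProb_left,
    hf.transProb_map _ _ (stdE_ne_zero k) hu]

theorem map_apply_eq_zero {u : Herm m} (hu : u ≠ 0) (k : Fin m) : f u k = 0 ↔ u k = 0 := by
  have h := transProb_stdE_map hf he hu k
  have h1 := norm_ne_zero_iff.2 hu
  have h2 := norm_ne_zero_iff.2 (hf.ne_zero u hu)
  constructor
  · intro h0
    simpa [h0, h1] using h.symm
  · intro h0
    simpa [h0, h2] using h

theorem sameLine_normalizedMap {u : Herm m} (hu : u 0 = 1) : SameLine (f u) (normalizedMap f u) :=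
  ⟨_, inv_ne_zero fun h => by
    have := (map_apply_eq_zero hf he (ne_zero_of_apply_zero hu) 0).1 h
    rw [hu] at this
    exact one_ne_zero this, rfl⟩

theorem normalizedMap_zero {u : Herm m} (hu : u 0 = 1) : normalizedMap f u 0 = 1 := by
  refine inv_mul_cancel₀ fun h => ?_
  have := (map_apply_eq_zero hf he (ne_zero_of_apply_zero hu) 0).1 h
  rw [hu] at this
  exact one_ne_zero this

theorem transProb_normalizedMap {u w : Herm m} (hu : u 0 = 1) (hw : w 0 = 1) :
    transProb (normalizedMap f u) (normalizedMap f w) = transProb u w := by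
  rw [← (sameLine_normalizedMap hf he hu).transProb_left,
    ← (sameLine_normalizedMap hf he hw).transProb_right,
    hf.transProb_map _ _ (ne_zero_of_apply_zero hu) (ne_zero_of_apply_zero hw)]

theorem sq_norm_normalizedMap_apply {u : Herm m} (hu : u 0 = 1) (k : Fin m) :
    ‖normalizedMap f u k‖ ^ 2 / ‖normalizedMap f u‖ ^ 2 = ‖u k‖ ^ 2 / ‖u‖ ^ 2 := by
  rw [← transProb_stdE, ← (sameLine_normalizedMap hf he hu).transProb_right, transProb_stdE,
    transProb_stdE_map hf he (ne_zero_of_apply_zero hu)]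

/-- Transition probabilities with the line of `e₀` agree, and both vectors have first coordinate
`1`. -/
theorem norm_normalizedMap {u : Herm m} (hu : u 0 = 1) : ‖normalizedMap f u‖ ^ 2 = ‖u‖ ^ 2 := by
  have h := sq_norm_normalizedMap_apply hf he hu 0
  rw [normalizedMap_zero hf he hu, hu] at h
  have h1 := norm_pos_iff.2 (ne_zero_of_apply_zero hu)
  have h2 := norm_pos_iff.2 (ne_zero_of_apply_zero (normalizedMap_zero hf he hu))
  rw [div_eq_div_iff (by positivity) (by positivity)] at h
  simpa using h.symm

theorem norm_normalizedMap_apply {u : Herm m} (hu : u 0 = 1) (k : Fin m) :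
    ‖normalizedMap f u k‖ ^ 2 = ‖u k‖ ^ 2 := by
  have h := sq_norm_normalizedMap_apply hf he hu k
  have h1 := norm_pos_iff.2 (ne_zero_of_apply_zero hu)
  rw [norm_normalizedMap hf he hu] at h
  exact (div_left_inj' (by positivity)).1 h

theorem norm_inner_normalizedMap {u w : Herm m} (hu : u 0 = 1) (hw : w 0 = 1) :
    ‖inner ℂ (normalizedMap f u) (normalizedMap f w)‖ ^ 2 = ‖inner ℂ u w‖ ^ 2 := by
  have h := transProb_normalizedMap hf he hu hw
  have h1 := norm_pos_iff.2 (ne_zero_of_apply_zero hu)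
  have h2 := norm_pos_iff.2 (ne_zero_of_apply_zero hw)
  rw [transProb, transProb, norm_normalizedMap hf he hu, norm_normalizedMap hf he hw] at h
  exact (div_left_inj' (by positivity)).1 h

variable (hone : ∀ k, k ≠ 0 → normalizedMap f (stdE 0 + stdE k) = stdE 0 + stdE k)
include hone

/-- Testing against `e_k` gives `|z_k|` and testing against `e₀ + e_k` gives `|1 + z_k|`, which
leaves only the sign of the imaginary part undetermined. -/
theorem normalizedMap_re {u : Herm m} (hu : u 0 = 1) {k : Fin m} (hk : k ≠ 0) :
    (normalizedMap f u k).re = (u k).re ∧ (normalizedMap f u k).im ^ 2 = (u k).im ^ 2 := by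
  refine eq_of_sq_norm (norm_normalizedMap_apply hf he hu k) ?_
  have h := norm_inner_normalizedMap hf he (u := stdE 0 + stdE k) (w := u)
    (by simp [stdE_of_ne hk.symm]) hu
  rw [hone k hk] at h
  simpa [inner_add_left, inner_stdE, normalizedMap_zero hf he hu, hu] using h

/-- The sign is read off from the probe `e₀ + i e_k`. Inner products with this probe determine the
imaginary part of any other `k`-th coordinate, so the sign does not depend on `u`. -/
theorem exists_sign (k : Fin m) : ∃ τ : ℝ, (τ = 1 ∨ τ = -1) ∧
    ∀ u : Herm m, u 0 = 1 → k ≠ 0 → (normalizedMap f u k).im = τ * (u k).im := by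
  by_cases hk : k = 0
  · exact ⟨1, Or.inl rfl, fun _ _ h => absurd hk h⟩
  set x : Herm m := stdE 0 + Complex.I • stdE k with hx
  have hx0 : x 0 = 1 := by simp [hx, stdE_of_ne (Ne.symm hk)]
  have hxk : x k = Complex.I := by simp [hx, stdE_of_ne hk]
  obtain ⟨h1, h2⟩ := normalizedMap_re hf he hone hx0 hk
  rw [hxk] at h1 h2
  simp only [Complex.I_re, Complex.I_im, one_pow] at h1 h2
  have hsign := sq_eq_one_iff.1 h2
  set τ := (normalizedMap f x k).im with hτ
  have hval : normalizedMap f x = stdE 0 + (τ * Complex.I) • stdE k := by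
    ext l
    by_cases hl0 : l = 0
    · subst hl0
      rw [normalizedMap_zero hf he hx0]
      simp [stdE_of_ne (Ne.symm hk)]
    · by_cases hlk : l = k
      · subst hlk
        apply Complex.ext
        · simp [h1, stdE_of_ne hl0]
        · simp [stdE_of_ne hl0, hτ]
      · have h3 := norm_normalizedMap_apply hf he hx0 l
        have h4 : x l = 0 := by simp [hx, stdE_of_ne hl0, stdE_of_ne hlk]
        rw [h4] at h3
        simp at h3
        rw [h3]
        simp [stdE_of_ne hl0, stdE_of_ne hlk]
  refine ⟨τ, hsign, fun u hu _ => ?_⟩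
  have h3 := norm_inner_normalizedMap hf he hx0 hu
  have h4 := norm_normalizedMap_apply hf he hu k
  rw [hval, hx, inner_add_left, inner_add_left, inner_smul_left, inner_smul_left, inner_stdE,
    inner_stdE, inner_stdE, inner_stdE, normalizedMap_zero hf he hu, hu] at h3
  simp only [← Complex.normSq_eq_norm_sq, Complex.normSq_apply] at h3 h4
  simp at h3
  rcases hsign with h | h
  · rw [h] at h3 ⊢
    linarith
  · rw [h] at h3 ⊢
    linarith

/-- The real vector `e₀ + e_k + e_l` is fixed. Its inner product with `e₀ + i e_k + i e_l` is `1 +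
2i`, while opposite signs would turn it into `1`. -/
theorem sign_unique {k l : Fin m} (hk : k ≠ 0) (hl : l ≠ 0) (hkl : k ≠ l) {τ τ' : ℝ}
    (hτ : τ = 1 ∨ τ = -1) (hτ' : τ' = 1 ∨ τ' = -1)
    (h : ∀ u : Herm m, u 0 = 1 → (normalizedMap f u k).im = τ * (u k).im)
    (h' : ∀ u : Herm m, u 0 = 1 → (normalizedMap f u l).im = τ' * (u l).im) : τ = τ' := by
  set w : Herm m := stdE 0 + stdE k + stdE l with hw
  set x : Herm m := stdE 0 + Complex.I • stdE k + Complex.I • stdE l with hx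
  have hw0 : w 0 = 1 := by simp [hw, stdE_of_ne hk.symm, stdE_of_ne hl.symm]
  have hx0 : x 0 = 1 := by simp [hx, stdE_of_ne hk.symm, stdE_of_ne hl.symm]
  have hwk : w k = 1 := by simp [hw, stdE_of_ne hk, stdE_of_ne hkl]
  have hwl : w l = 1 := by simp [hw, stdE_of_ne hl, stdE_of_ne hkl.symm]
  have hxk : x k = Complex.I := by simp [hx, stdE_of_ne hk, stdE_of_ne hkl]
  have hxl : x l = Complex.I := by simp [hx, stdE_of_ne hl, stdE_of_ne hkl.symm]
  have hwn : normalizedMap f w = w := by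
    ext j
    by_cases hj0 : j = 0
    · subst hj0; rw [normalizedMap_zero hf he hw0, hw0]
    obtain ⟨h1, h2⟩ := normalizedMap_re hf he hone hw0 hj0
    refine Complex.ext h1 ?_
    have h3 : (w j).im = 0 := by
      by_cases hjk : j = k
      · rw [hjk, hwk]; rfl
      · by_cases hjl : j = l
        · rw [hjl, hwl]; rfl
        · simp [hw, stdE_of_ne hj0, stdE_of_ne hjk, stdE_of_ne hjl]
    rw [h3] at h2 ⊢
    simpa using h2
  have hyk : normalizedMap f x k = τ * Complex.I := by
    apply Complex.ext
    · rw [(normalizedMap_re hf he hone hx0 hk).1, hxk]; simp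
    · rw [h x hx0, hxk]; simp
  have hyl : normalizedMap f x l = τ' * Complex.I := by
    apply Complex.ext
    · rw [(normalizedMap_re hf he hone hx0 hl).1, hxl]; simp
    · rw [h' x hx0, hxl]; simp
  have h3 := norm_inner_normalizedMap hf he hw0 hx0
  rw [hwn, hw] at h3
  simp only [inner_add_left, inner_stdE, hx0, hxk, hxl, normalizedMap_zero hf he hx0, hyk,
    hyl] at h3
  simp only [← Complex.normSq_eq_norm_sq, Complex.normSq_apply] at h3
  simp at h3
  rcases hτ with rfl | rfl <;> rcases hτ' with rfl | rfl <;>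
    first | rfl | (exfalso; norm_num at h3)

omit hone in
/-- A map of lines is determined by its values on the vectors with first coordinate `1`. -/
theorem sameLine_of_normalizedMap_eq {J : Herm m → Herm m} (hJadd : ∀ u w, J (u + w) = J u + J w)
    (hJi : ∀ u w, ‖inner ℂ (J u) (J w)‖ = ‖inner ℂ u w‖) (hJn : ∀ u, ‖J u‖ = ‖u‖)
    (hJ0 : J (stdE 0) = stdE 0) (h : ∀ u : Herm m, u 0 = 1 → normalizedMap f u = J u)
    {u : Herm m} (hu : u ≠ 0) : SameLine (J u) (f u) := by
  have hJ : ∀ v w, transProb (J v) (J w) = transProb v w := fun v w =>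
    transProb_of_norm_inner (hJi v w) (hJn v) (hJn w)
  have hJne : ∀ v, v ≠ 0 → J v ≠ 0 := fun v hv h0 => hv (norm_eq_zero.1 (by rw [← hJn, h0, norm_zero]))
  have hfJ : ∀ w : Herm m, w 0 = 1 → SameLine (f w) (J w) := fun w hw => by
    rw [← h w hw]; exact sameLine_normalizedMap hf he hw
  have hJu0 : ‖J u 0‖ = ‖u 0‖ := by
    have := hJi (stdE 0) u
    rwa [hJ0, inner_stdE, inner_stdE] at this
  by_cases hu0 : u 0 = 0
  -- If `u` has first coordinate zero, test it against `e₀ + u`, where `f` is already known. Since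
  -- `f u` and `J u` have no `e₀`-component, the comparison becomes equality in Cauchy–Schwarz for
  -- `J u` and `f u`.
  · set w := stdE 0 + u with hw
    have hw0 : w 0 = 1 := by simp [hw, hu0]
    have h1 := hf.transProb_map w u (ne_zero_of_apply_zero hw0) hu
    rw [(hfJ w hw0).transProb_left, ← hJ w u, hw, hJadd, hJ0, transProb, transProb,
      inner_add_left, inner_add_left, inner_stdE, inner_stdE, (map_apply_eq_zero hf he hu 0).2 hu0]
      at h1
    have h2 : J u 0 = 0 := norm_eq_zero.1 (by rw [hJu0, hu0, norm_zero])
    rw [h2, zero_add, zero_add, ← hJ0, ← hJadd, ← hw] at h1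
    have h3 := transProb_self (hJne u hu)
    refine sameLine_of_transProb_eq_one (hJne u hu) (hf.ne_zero u hu) ?_
    rw [transProb] at h3 ⊢
    have n1 := norm_pos_iff.2 (hJne u hu)
    have n2 := norm_pos_iff.2 (hf.ne_zero u hu)
    have n3 := norm_pos_iff.2 (hJne w (ne_zero_of_apply_zero hw0))
    rw [div_eq_div_iff (by positivity) (by positivity)] at h1
    rw [div_eq_one_iff_eq (by positivity)] at h3 ⊢
    rw [h3] at h1
    have h4 : (‖J w‖ ^ 2 * ‖J u‖ ^ 2) * ‖inner ℂ (J u) (f u)‖ ^ 2 =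
        (‖J w‖ ^ 2 * ‖J u‖ ^ 2) * (‖J u‖ ^ 2 * ‖f u‖ ^ 2) := by linear_combination h1
    exact mul_left_cancel₀ (by positivity) h4
  · set w := (u 0)⁻¹ • u with hw
    have hw0 : w 0 = 1 := inv_mul_cancel₀ hu0
    have hwne := ne_zero_of_apply_zero hw0
    have huw : SameLine u w := ⟨_, inv_ne_zero hu0, rfl⟩
    have h1 : transProb u w = 1 := by rw [← huw.transProb_right, transProb_self hu]
    have h2 := sameLine_of_transProb_eq_one (hf.ne_zero u hu) (hf.ne_zero w hwne)
      (by rw [hf.transProb_map u w hu hwne, h1])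
    have h3 := sameLine_of_transProb_eq_one (hJne u hu) (hJne w hwne) (by rw [hJ, h1])
    exact h3.trans ((h2.trans (hfJ w hw0)).symm)

end Normalized

/-- Complex conjugation. -/
def conjE (u : Herm m) : Herm m := WithLp.toLp 2 (star fun k => u k)

@[simp] theorem conjE_apply (u : Herm m) (k : Fin m) : conjE u k = star (u k) := rfl

theorem inner_conjE (u w : Herm m) : inner ℂ (conjE u) (conjE w) = star (inner ℂ u w) := by
  rw [PiLp.inner_apply, PiLp.inner_apply, star_sum]
  refine Finset.sum_congr rfl fun k _ => ?_
  simp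

theorem norm_conjE (u : Herm m) : ‖conjE u‖ = ‖u‖ := by
  simp [EuclideanSpace.norm_eq]

theorem sameLine_or_conjE {f : Herm m → Herm m} (hf : PreservesTransProb f)
    (he : ∀ k, SameLine (stdE k) (f (stdE k)))
    (hone : ∀ k, k ≠ 0 → normalizedMap f (stdE 0 + stdE k) = stdE 0 + stdE k) :
    (∀ u, u ≠ 0 → SameLine u (f u)) ∨ ∀ u, u ≠ 0 → SameLine (conjE u) (f u) := by
  choose τ hτ h using exists_sign hf he hone
  by_cases hall : ∀ k, k ≠ 0 → τ k = 1
  · left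
    intro u hu
    refine sameLine_of_normalizedMap_eq hf he (J := id) (fun _ _ => rfl) (fun _ _ => rfl)
      (fun _ => rfl) rfl (fun v hv => ?_) hu
    ext k
    by_cases hk : k = 0
    · subst hk; rw [normalizedMap_zero hf he hv]; exact hv.symm
    · refine Complex.ext (normalizedMap_re hf he hone hv hk).1 ?_
      rw [h k v hv hk, hall k hk, one_mul]; rfl
  · right
    push Not at hall
    obtain ⟨k₀, hk₀, hne⟩ := hall
    have hk₀' := (hτ k₀).resolve_left hne
    have hall' : ∀ k, k ≠ 0 → τ k = -1 := by
      intro k hk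
      by_cases hkk : k = k₀
      · rw [hkk, hk₀']
      · rw [← hk₀']
        exact sign_unique hf he hone hk hk₀ hkk (hτ k) (hτ k₀) (fun u hu => h k u hu hk)
          (fun u hu => h k₀ u hu hk₀)
    intro u hu
    refine sameLine_of_normalizedMap_eq hf he (J := conjE) (fun _ _ => ?_) (fun _ _ => ?_)
      norm_conjE ?_ (fun v hv => ?_) hu
    · ext k; simp
    · rw [inner_conjE, norm_star]
    · ext k
      by_cases hk : k = 0
      · subst hk; simp
      · simp [stdE_of_ne hk]
    ext k
    by_cases hk : k = 0
    · subst hk; rw [normalizedMap_zero hf he hv]; simp [hv]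
    · apply Complex.ext
      · rw [(normalizedMap_re hf he hone hv hk).1]; simp
      · rw [h k v hv hk, hall' k hk]; simp

/-- Wigner's theorem. -/
theorem wigner {f : Herm m → Herm m} (hf : PreservesTransProb f) :
    ∃ L : Herm m ≃ₗᵢ[ℂ] Herm m,
      (∀ u, u ≠ 0 → SameLine (L u) (f u)) ∨ ∀ u, u ≠ 0 → SameLine (L (conjE u)) (f u) := by
  have hne : ∀ k, f (stdE k) ≠ 0 := fun k => hf.ne_zero _ (stdE_ne_zero k)
  have horth : ∀ k l, k ≠ l → inner ℂ (f (stdE k)) (f (stdE l)) = 0 := by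
    intro k l hkl
    have h := hf.transProb_map (stdE k) (stdE l) (stdE_ne_zero k) (stdE_ne_zero l)
    rw [transProb_stdE, stdE_of_ne hkl] at h
    have h1 := norm_pos_iff.2 (hne k)
    have h2 := norm_pos_iff.2 (hne l)
    rw [transProb, norm_zero, zero_pow two_ne_zero, zero_div,
      div_eq_zero_iff, or_iff_left (by positivity)] at h
    exact norm_eq_zero.1 (pow_eq_zero_iff two_ne_zero |>.1 h)
  set v : Fin m → Herm m := fun k => f (stdE 0 + stdE k) with hv
  have hsum : ∀ k, k ≠ 0 → (stdE 0 + stdE k : Herm m) ≠ 0 := fun k hk =>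
    ne_zero_of_apply_zero (by simp [stdE_of_ne (Ne.symm hk)])
  have hcoef : ∀ k l, k ≠ 0 → ‖inner ℂ (f (stdE l)) (v k)‖ ^ 2 / ‖f (stdE l)‖ ^ 2 =
      ‖(stdE 0 + stdE k : Herm m) l‖ ^ 2 * (‖v k‖ ^ 2 / ‖(stdE 0 + stdE k : Herm m)‖ ^ 2) := by
    intro k l hk
    have h := hf.transProb_map (stdE l) (stdE 0 + stdE k) (stdE_ne_zero l) (hsum k hk)
    have h1 := norm_pos_iff.2 (hne l)
    have h2 := norm_pos_iff.2 (hf.ne_zero _ (hsum k hk))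
    have h3 := norm_pos_iff.2 (hsum k hk)
    rw [transProb_stdE, transProb, div_eq_div_iff (by positivity) (by positivity)] at h
    rw [← mul_div_assoc, div_eq_div_iff (by positivity) (by positivity)]
    rw [h]
    ring
  set g : Fin m → Herm m := fun k => ((‖f (stdE k)‖⁻¹ : ℝ) : ℂ) • f (stdE k) with hg
  have hgi : ∀ l k, k ≠ 0 → ‖inner ℂ (g l) (v k)‖ ^ 2 =
      ‖(stdE 0 + stdE k : Herm m) l‖ ^ 2 * (‖v k‖ ^ 2 / ‖(stdE 0 + stdE k : Herm m)‖ ^ 2) := by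
    intro l k hk
    rw [← hcoef k l hk, hg, inner_smul_left, norm_mul, RCLike.norm_conj, Complex.norm_real,
      norm_inv, norm_norm, mul_pow, inv_pow, div_eq_inv_mul]
  have hpos : ∀ k, k ≠ 0 → 0 < ‖v k‖ ^ 2 / ‖(stdE 0 + stdE k : Herm m)‖ ^ 2 := by
    intro k hk
    have h2 := norm_pos_iff.2 (hf.ne_zero _ (hsum k hk))
    have h3 := norm_pos_iff.2 (hsum k hk)
    positivity
  have hgn : ∀ k, ‖g k‖ = 1 := fun k => by
    rw [hg, norm_smul, Complex.norm_real, norm_inv, norm_norm,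
      inv_mul_cancel₀ (norm_ne_zero_iff.2 (hne k))]
  -- The vector `f (e₀ + e_k)` has coefficients of equal modulus on `g 0` and `g k`. These phases
  -- turn the ratio of the coefficients into `1`.
  set a : Fin m → ℂ := fun k => if k = 0 then 1 else inner ℂ (g k) (v k) / inner ℂ (g 0) (v k) with ha
  have hab : ∀ k, k ≠ 0 → ‖inner ℂ (g k) (v k)‖ = ‖inner ℂ (g 0) (v k)‖ ∧
      inner ℂ (g 0) (v k) ≠ 0 := by
    intro k hk
    have e1 := hgi k k hk
    have e2 := hgi 0 k hk
    simp only [PiLp.add_apply, stdE_self, stdE_of_ne hk, stdE_of_ne (Ne.symm hk), zero_add,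
      add_zero, norm_one, one_pow, one_mul] at e1 e2
    refine ⟨(sq_eq_sq₀ (norm_nonneg _) (norm_nonneg _)).1 (e1.trans e2.symm), fun h0 => ?_⟩
    rw [h0, norm_zero] at e2
    have := hpos k hk
    norm_num at e2
    linarith
  have han : ∀ k, ‖a k‖ = 1 := by
    intro k
    by_cases hk : k = 0
    · simp [ha, hk]
    · obtain ⟨e1, e2⟩ := hab k hk
      simp only [ha, hk, if_false, norm_div, e1]
      exact div_self (norm_ne_zero_iff.2 e2)
  have hON : Orthonormal ℂ fun k => a k • g k := by
    refine ⟨fun k => by rw [norm_smul, han, hgn, one_mul], fun k l hkl => ?_⟩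
    simp only [hg, inner_smul_left, inner_smul_right, horth k l hkl, mul_zero]
  have hcard : Fintype.card (Fin m) = Module.finrank ℂ (Herm m) := by simp
  let b : OrthonormalBasis (Fin m) ℂ (Herm m) :=
    (basisOfOrthonormalOfCardEqFinrank hON hcard).toOrthonormalBasis (by
      rw [coe_basisOfOrthonormalOfCardEqFinrank]; exact hON)
  have hb : ∀ k, b k = a k • g k := fun k => by simp [b]
  -- In the adapted orthonormal basis the map fixes the lines of all `e_k` and of all `e₀ + e_k`,
  -- which is the normalised situation.
  set f' : Herm m → Herm m := fun u => b.repr (f u) with hf'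
  have hpres : PreservesTransProb f' := ⟨fun u hu h => hf.ne_zero u hu (by simpa [hf'] using h),
    fun u w hu hw => by
      rw [← hf.transProb_map u w hu hw]
      exact transProb_of_norm_inner (by simp [hf']) (by simp [hf']) (by simp [hf'])⟩
  have ha0 : ∀ k, a k ≠ 0 := fun k => norm_ne_zero_iff.1 (by rw [han]; norm_num)
  have hfE : ∀ k, SameLine (stdE k) (f' (stdE k)) := by
    intro k
    have h1 : SameLine (b k) (f (stdE k)) := by
      have hc : ((‖f (stdE k)‖⁻¹ : ℝ) : ℂ) ≠ 0 := by
        exact_mod_cast (inv_pos.2 (norm_pos_iff.2 (hne k))).ne'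
      refine SameLine.symm ⟨a k * ((‖f (stdE k)‖⁻¹ : ℝ) : ℂ), mul_ne_zero (ha0 k) hc, ?_⟩
      rw [hb, hg, smul_smul]
    have h2 := h1.map b.repr
    rw [b.repr_self] at h2
    exact h2
  have hone : ∀ k, k ≠ 0 → normalizedMap f' (stdE 0 + stdE k) = stdE 0 + stdE k := by
    intro k hk
    obtain ⟨e1, e2⟩ := hab k hk
    have hcoord : ∀ l, f' (stdE 0 + stdE k) l = star (a l) * inner ℂ (g l) (v k) := by
      intro l
      rw [hf', b.repr_apply_apply, hb, inner_smul_left]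
      rfl
    have h0 : f' (stdE 0 + stdE k) 0 = inner ℂ (g 0) (v k) := by
      rw [hcoord]; simp [ha]
    ext l
    change (f' (stdE 0 + stdE k) 0)⁻¹ * f' (stdE 0 + stdE k) l = _
    rw [h0, hcoord]
    by_cases hl0 : l = 0
    · subst hl0
      simp [ha, stdE_of_ne (Ne.symm hk), e2]
    by_cases hlk : l = k
    · subst hlk
      have h3 : star (inner ℂ (g l) (v l)) * inner ℂ (g l) (v l) =
          star (inner ℂ (g 0) (v l)) * inner ℂ (g 0) (v l) := by
        have := congrArg (fun r : ℝ => (r : ℂ) ^ 2) e1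
        simpa only [← Complex.conj_mul', ← starRingEnd_apply] using this
      have h4 : star (inner ℂ (g 0) (v l)) ≠ 0 := star_ne_zero.2 e2
      simp only [ha, hl0, if_false, PiLp.add_apply, stdE_self, stdE_of_ne hl0, zero_add, star_div₀]
      field_simp
      rw [h3, mul_comm]
    · have h5 := hgi l k hk
      simp only [PiLp.add_apply, stdE_of_ne hl0, stdE_of_ne hlk, add_zero, norm_zero] at h5
      have h6 : inner ℂ (g l) (v k) = 0 := by
        refine norm_eq_zero.1 (pow_eq_zero_iff two_ne_zero |>.1 ?_)
        rw [h5]; ring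
      simp [h6, stdE_of_ne hl0, stdE_of_ne hlk]
  refine ⟨b.repr.symm, ?_⟩
  rcases sameLine_or_conjE hpres hfE hone with h | h
  · left
    intro u hu
    have := (h u hu).map b.repr.symm
    simpa [hf'] using this
  · right
    intro u hu
    have := (h u hu).map b.repr.symm
    simpa [hf'] using this

end

section

/-! ## The curvature along a level -/

variable {m : ℕ} [NeZero m]

/-- The operator on the Hermitian space given by a matrix. -/
def opE (A : Matrix (Fin m) (Fin m) ℂ) : Herm m →L[ℂ] Herm m := Matrix.toEuclideanCLM (𝕜 := ℂ) A

theorem opE_apply (A : Matrix (Fin m) (Fin m) ℂ) (u : Herm m) (k : Fin m) :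
    opE A u k = (A *ᵥ u.ofLp) k := rfl

/-- The curvature of a level, up to a constant factor. -/
def levelCurv (A : Matrix (Fin m) (Fin m) ℂ) (u U W : Herm m) : ℝ :=
  (inner ℂ (opE A U) W).re -
    (inner ℂ (opE A u) (Complex.I • u)).re * (inner ℂ (Complex.I • U) W).re

theorem partE_matU (A : Matrix (Fin m) (Fin m) ℂ) (x : Amb m) :
    partE m (matU A x) = opE A (partE m x) := rfl

theorem partE_vertU (x : Amb m) : partE m (vertU x) = Complex.I • partE m x :=
  partE_blockMul _ _ _

theorem kappaComp_eq (j : LieT →ₗ[ℝ] su m) (k : Fin 2) (y X : Amb m) : kappaComp j k y X =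
    ‖partE m y‖ ^ 2 * (inner ℂ (opE (matJ j k) (partE m y)) (partE m X)).re -
      (inner ℂ (opE (matJ j k) (partE m y)) (Complex.I • partE m y)).re *
        (inner ℂ (Complex.I • partE m y) (partE m X)).re := by
  have h : ∀ l, vertU y (.inr l) = 0 := fun l => zero_mul _
  rw [kappaComp_apply, ← norm_partE]
  simp only [inner_eq_partE, partE_matU, partE_vertU, matU_inr, h, inner_zero_left,
    Finset.sum_const_zero, add_zero]

/-- This is the shape of `muAmb` along the line `u + t U` with `U ⊥ u`: the squared norms have no
linear term, and the subtracted product has a factor vanishing at `t = 0`. -/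
theorem hasDerivAt_quotient (N a b c d e g h : ℝ) (hN : N ≠ 0) :
    HasDerivAt (fun t : ℝ => ((N + t ^ 2 * a) ^ 2)⁻¹ *
      ((1 + t ^ 2 * a) * (b + t * c) - (d + t * e + t ^ 2 * g) * (t * h)))
      ((N ^ 2)⁻¹ * (c - d * h)) 0 := by
  have h1 : HasDerivAt (fun t : ℝ => t) 1 0 := hasDerivAt_id 0
  have h2 : ∀ x : ℝ, HasDerivAt (fun t : ℝ => t ^ 2 * x) 0 0 := fun x =>
    ((h1.pow 2).mul_const x).congr_deriv (by simp)
  have h3 := (((h2 a).const_add N).pow 2).inv (by simpa using hN)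
  have h4 := ((h2 a).const_add 1).mul ((h1.mul_const c).const_add b)
  have h5 := (((h1.mul_const e).const_add d).add (h2 g)).mul (h1.mul_const h)
  refine (h3.mul (h4.sub h5)).congr_deriv ?_
  simp

/-- Since `W ⊥ u`, the factor `⟨iu, W⟩` in `κ` vanishes at the base point, so only its variation
`⟨iU, W⟩` survives. The norms do not vary to first order because `U ⊥ u`. -/
theorem fderiv_muAmb_level (j : LieT →ₗ[ℝ] su m) {s : Fin 2 → ℝ} (hs : ∀ l, 0 < s l) {u U W : Herm m}
    (hu : ‖u‖ = 1) (hU : inner ℂ u U = 0) (hW : inner ℂ u W = 0) (k : Fin 2) :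
    fderiv ℝ (muAmb j) (levelVec s u) (ofE m U) (ofE m W) k =
      ((1 + ∑ l, s l ^ 2) ^ 2)⁻¹ * ((inner ℂ (opE (matJ j k) U) W).re -
        (inner ℂ (opE (matJ j k) u) (Complex.I • u)).re * (inner ℂ (Complex.I • U) W).re) := by
  have hu0 : u ≠ 0 := fun h => by simp [h] at hu
  have hy := levelVec_mem hs hu0
  have hN : 0 < 1 + ∑ l, s l ^ 2 := by
    have : 0 ≤ ∑ l, s l ^ 2 := Finset.sum_nonneg fun l _ => sq_nonneg _
    linarith
  have hd := hasDerivAt_comp_line (differentiableAt_muAmb j (ne_zero_of_mem_coneG hy.1)) (ofE m U)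
  have hd2 := ((ContinuousLinearMap.proj (R := ℝ) (φ := fun _ : Fin 2 => ℝ) k).comp
    (ContinuousLinearMap.apply ℝ LieT (ofE m W))).hasFDerivAt.comp_hasDerivAt (0 : ℝ) hd
  refine hd2.unique ?_
  have hp : ∀ t : ℝ, partE m (levelVec s u + t • ofE m U) = u + t • U := fun t => by simp
  have hnu : ∀ t : ℝ, ‖u + t • U‖ ^ 2 = 1 + t ^ 2 * ‖U‖ ^ 2 := fun t => by
    rw [← Complex.coe_smul, norm_add_sq (𝕜 := ℂ), inner_smul_right, hU, hu, norm_smul]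
    simp [mul_pow]
  have hny : ∀ t : ℝ, ‖levelVec s u + t • ofE m U‖ ^ 2 = (1 + ∑ l, s l ^ 2) + t ^ 2 * ‖U‖ ^ 2 := by
    intro t
    rw [norm_sq_eq_partE, hp, hnu]
    have : ∀ l, (levelVec s u + t • ofE m U) (.inr l) = (s l : ℂ) := fun l => by
      simp [levelVec_inr, hu]
    simp only [this, Complex.norm_real, Real.norm_eq_abs, sq_abs]
    ring
  have hIu : (inner ℂ (Complex.I • u) W).re = 0 := by rw [inner_smul_left, hW]; simp
  refine (hasDerivAt_quotient _ (‖U‖ ^ 2) (inner ℂ (opE (matJ j k) u) W).re _ _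
    ((inner ℂ (opE (matJ j k) u) (Complex.I • U)).re +
      (inner ℂ (opE (matJ j k) U) (Complex.I • u)).re)
    (inner ℂ (opE (matJ j k) U) (Complex.I • U)).re _ hN.ne').congr_of_eventuallyEq
    (Filter.Eventually.of_forall fun t => ?_)
  change muAmb j (levelVec s u + t • ofE m U) (ofE m W) k = _
  have h4 : ‖levelVec s u + t • ofE m U‖ ^ 4 = (‖levelVec s u + t • ofE m U‖ ^ 2) ^ 2 := by ring
  rw [muAmb_apply, h4, hny, kappaComp_eq, hp, hnu, partE_ofE]
  congr 1
  simp only [← Complex.coe_smul, map_add, map_smul, smul_add, inner_add_left, inner_add_right,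
    inner_smul_left, inner_smul_right, smul_comm Complex.I (_ : ℂ), Complex.conj_ofReal,
    Complex.add_re, Complex.re_ofReal_mul]
  have e1 : (starRingEnd ℂ Complex.I * inner ℂ u W).re = 0 := by rw [hW]; simp
  rw [e1]
  simp only [mul_left_comm Complex.I (t : ℂ), mul_add, Complex.add_re, Complex.re_ofReal_mul]
  ring

/-- Both terms of `fderiv_muAmb_level` are already antisymmetric in `U, W`, so antisymmetrising
doubles them. -/
theorem curvature_level (j : LieT →ₗ[ℝ] su m) {s : Fin 2 → ℝ} (hs : ∀ l, 0 < s l) {u U W : Herm m}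
    (hu : ‖u‖ = 1) (hU : inner ℂ u U = 0) (hW : inner ℂ u W = 0) (k : Fin 2) :
    curvature j (qL s u) ![(dB (levelVec s u) (ofE m U) : ModB m),
      (dB (levelVec s u) (ofE m W) : ModB m)] k =
      2 * ((1 + ∑ l, s l ^ 2) ^ 2)⁻¹ * levelCurv (matJ j k) u U W := by
  have hu0 : u ≠ 0 := fun h => by simp [h] at hu
  have h1 : curvature j (qL s u) ![(dB (levelVec s u) (ofE m U) : ModB m),
      (dB (levelVec s u) (ofE m W) : ModB m)] =
      fderiv ℝ (muAmb j) (levelVec s u) (ofE m U) (ofE m W) -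
        fderiv ℝ (muAmb j) (levelVec s u) (ofE m W) (ofE m U) :=
    curvature_apply j (levelVec_mem hs hu0) _ _
  rw [h1, Pi.sub_apply, fderiv_muAmb_level j hs hu hU hW, fderiv_muAmb_level j hs hu hW hU]
  have h2 : (inner ℂ (opE (matJ j k) W) U).re = -(inner ℂ (opE (matJ j k) U) W).re := by
    have h := inner_matU (conjTranspose_matJ j k) (ofE m W) (ofE m U)
    simp only [inner_eq_partE, partE_matU, partE_ofE, matU_inr, ofE_inr, inner_zero_left,
      Finset.sum_const_zero, add_zero] at h
    rw [h]
    exact congrArg Neg.neg (inner_re_symm (𝕜 := ℂ) _ _)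
  have h3 : (inner ℂ (Complex.I • W) U).re = -(inner ℂ (Complex.I • U) W).re := by
    rw [inner_smul_left, inner_smul_left, ← inner_conj_symm W U]
    simp only [Complex.conj_I, Complex.mul_re, Complex.neg_re, Complex.neg_im, Complex.I_re,
      Complex.I_im, Complex.conj_re, Complex.conj_im]
    ring
  rw [h2, h3, levelCurv]
  ring

/-- The `v`-component is `s` times `√(‖u‖² + t² ‖U‖²)`, which is stationary at `t = 0`. -/
theorem hasDerivAt_levelVec_line (s : Fin 2 → ℝ) {u U : Herm m} (hu : u ≠ 0)
    (hU : inner ℂ u U = 0) :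
    HasDerivAt (fun t : ℝ => levelVec s (u + t • U)) (ofE m U) 0 := by
  have hn := norm_pos_iff.2 hu
  have h1 : ∀ t : ℝ, ‖u + t • U‖ = Real.sqrt (‖u‖ ^ 2 + t ^ 2 * ‖U‖ ^ 2) := fun t => by
    rw [← Real.sqrt_sq (norm_nonneg (u + t • U)), ← Complex.coe_smul, norm_add_sq (𝕜 := ℂ),
      inner_smul_right, hU, norm_smul]
    simp [mul_pow]
  have h2 : HasDerivAt (fun t : ℝ => ‖u‖ ^ 2 + t ^ 2 * ‖U‖ ^ 2) 0 0 :=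
    (((((hasDerivAt_id (0 : ℝ)).pow 2).mul_const (‖U‖ ^ 2))).const_add _).congr_deriv (by simp)
  have h3 := h2.sqrt (by simpa using hn.ne')
  have h4 : (fun t : ℝ => levelVec s (u + t • U)) = fun t => ofE m u + t • ofE m U +
      Real.sqrt (‖u‖ ^ 2 + t ^ 2 * ‖U‖ ^ 2) • levelPoint 0 s := by
    funext t
    refine amb_ext' (fun k => ?_) fun l => ?_
    · simp [levelVec]
    · simp [levelVec, h1]
  rw [h4]
  refine ((((hasDerivAt_id (0 : ℝ)).smul_const (ofE m U)).const_add (ofE m u)).add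
    (h3.smul_const (levelPoint 0 s))).congr_deriv ?_
  simp

/-- The differential of a diffeomorphism that is linear along a level. -/
theorem mfderiv_level {s : Fin 2 → ℝ} (hs : ∀ l, 0 < s l) {Φ : DiffeoBase m} {B : Herm m → Herm m}
    (hB : ∀ u, u ≠ 0 → Φ (qL s u) = qL s (B u)) (hlin : ∀ (u U : Herm m) (t : ℝ),
      B (u + t • U) = B u + t • B U) {u U : Herm m} (hu : u ≠ 0) (hBu : B u ≠ 0)
    (hU : inner ℂ u U = 0) (hBU : inner ℂ (B u) (B U) = 0) :
    (dB (levelVec s (B u)) (ofE m (B U)) : ModB m) =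
      mfderiv 𝓘(ℝ, ModB m) 𝓘(ℝ, ModB m) Φ (qL s u) (dB (levelVec s u) (ofE m U) : ModB m) := by
  have hz : ∀ {v V : Herm m}, v ≠ 0 → inner ℂ v V = 0 →
      HasMFDerivAt 𝓘(ℝ, ℝ) 𝓘(ℝ, ModB m) (fun t : ℝ => qT (levelVec s (v + t • V))) 0
        ((dB (levelVec s v)).comp (ContinuousLinearMap.toSpanSingleton ℝ (ofE m V))) := by
    intro v V hv hV
    have h1 : HasMFDerivAt 𝓘(ℝ, ℝ) 𝓘(ℝ, Amb m) (fun t : ℝ => levelVec s (v + t • V)) 0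
        (ContinuousLinearMap.toSpanSingleton ℝ (ofE m V)) :=
      (hasDerivAt_levelVec_line s hv hV).hasFDerivAt.hasMFDerivAt
    have h2 : HasMFDerivAt 𝓘(ℝ, Amb m) 𝓘(ℝ, ModB m) qT (levelVec s (v + (0 : ℝ) • V))
        (dB (levelVec s v)) := by
      rw [zero_smul, add_zero]
      exact hasMFDerivAt_qT (levelVec_mem hs hv)
    exact HasMFDerivAt.comp (g := qT) (0 : ℝ) h2 h1
  set D : ModB m →L[ℝ] ModB m := mfderiv 𝓘(ℝ, ModB m) 𝓘(ℝ, ModB m) Φ (qL s u) with hD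
  have hΦ : HasMFDerivAt 𝓘(ℝ, ModB m) 𝓘(ℝ, ModB m) Φ (qT (levelVec s (u + (0 : ℝ) • U))) D := by
    rw [zero_smul, add_zero]
    exact ((Φ.contMDiff _).mdifferentiableAt (by simp)).hasMFDerivAt
  have h1 := HasMFDerivAt.comp (g := Φ) (0 : ℝ) hΦ (hz hu hU)
  have hne : ∀ t : ℝ, u + t • U ≠ 0 := fun t h => by
    have := congrArg (inner ℂ u) h
    rw [← Complex.coe_smul, inner_add_right, inner_smul_right, hU, inner_zero_right, mul_zero,
      add_zero] at this
    exact hu (inner_self_eq_zero.1 this)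
  have h2 : (Φ ∘ fun t : ℝ => qT (levelVec s (u + t • U))) =
      fun t : ℝ => qT (levelVec s (B u + t • B U)) := by
    funext t
    rw [← hlin]
    exact hB _ (hne t)
  rw [h2] at h1
  have h3 := hasMFDerivAt_unique (hz hBu hBU) h1
  have h4 : dB (levelVec s (B u)) ((1 : ℝ) • ofE m (B U)) =
      D (dB (levelVec s u) ((1 : ℝ) • ofE m U)) :=
    congrArg (fun L : ℝ →L[ℝ] ModB m => L 1) h3
  rw [one_smul, one_smul] at h4
  exact h4

/-- Comparison of the curvature forms along a level. -/
theorem levelCurv_eq {s : Fin 2 → ℝ} (hs : ∀ l, 0 < s l) {Φ : DiffeoBase m} {B : Herm m → Herm m}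
    (hB : ∀ u, u ≠ 0 → Φ (qL s u) = qL s (B u)) (hlin : ∀ (u U : Herm m) (t : ℝ),
      B (u + t • U) = B u + t • B U) (hnorm : ∀ u, ‖B u‖ = ‖u‖)
    (horth : ∀ u w, inner ℂ u w = 0 → inner ℂ (B u) (B w) = 0)
    {Ψ : LieT ≃L[ℝ] LieT} {σ : Equiv.Perm (Fin 2)} {ε : Fin 2 → ℝ}
    (hΨ : ∀ k, Ψ (basisZ k) = ε k • basisZ (σ k)) {j j' : LieT →ₗ[ℝ] su m}
    (h : curvature j = ((curvature j').pullback Φ).postcomp Ψ) {u U W : Herm m} (hu : ‖u‖ = 1)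
    (hU : inner ℂ u U = 0) (hW : inner ℂ u W = 0) (k : Fin 2) :
    levelCurv (matJ j (σ k)) u U W = ε k * levelCurv (matJ j' k) (B u) (B U) (B W) := by
  have hu0 : u ≠ 0 := fun h => by simp [h] at hu
  have hBu : ‖B u‖ = 1 := by rw [hnorm, hu]
  have hBu0 : B u ≠ 0 := fun h => by simp [h] at hBu
  have key : ∀ (b : Base m) (ξ η : ModB m), b = Φ (qL s u) →
      ξ = mfderiv 𝓘(ℝ, ModB m) 𝓘(ℝ, ModB m) Φ (qL s u) (dB (levelVec s u) (ofE m U) : ModB m) →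
      η = mfderiv 𝓘(ℝ, ModB m) 𝓘(ℝ, ModB m) Φ (qL s u) (dB (levelVec s u) (ofE m W) : ModB m) →
      curvature j (qL s u) ![(dB (levelVec s u) (ofE m U) : ModB m),
        (dB (levelVec s u) (ofE m W) : ModB m)] = Ψ (curvature j' b ![ξ, η]) := by
    rintro _ _ _ rfl rfl rfl
    have h1 := congrFun h (qL s u)
    refine (congrArg (fun θ : ModB m [⋀^Fin 2]→L[ℝ] LieT => θ ![dB (levelVec s u) (ofE m U),
      dB (levelVec s u) (ofE m W)]) h1).trans ?_
    refine congrArg (fun v => Ψ (curvature j' (Φ (qL s u)) v)) ?_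
    funext i
    fin_cases i <;> rfl
  have h1 := key (qL s (B u)) _ _ (hB u hu0).symm
    (mfderiv_level hs hB hlin hu0 hBu0 hU (horth _ _ hU))
    (mfderiv_level hs hB hlin hu0 hBu0 hW (horth _ _ hW))
  set K : LieT := curvature j' (qL s (B u)) ![(dB (levelVec s (B u)) (ofE m (B U)) : ModB m),
    (dB (levelVec s (B u)) (ofE m (B W)) : ModB m)] with hK
  -- Only the basis vector `Z_k` contributes to the component `σ k` of the signed permutation.
  have h2 : Ψ K (σ k) = ε k * K k := by
    have hKs : K = ∑ l, K l • basisZ l := by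
      funext i
      rw [Finset.sum_apply, Finset.sum_eq_single i (fun l _ hl => by simp [basisZ, hl.symm])
        (by simp)]
      simp [basisZ]
    conv_lhs => rw [hKs]
    rw [map_sum, Finset.sum_apply, Finset.sum_eq_single k (fun l _ hl => ?_) (by simp)]
    · rw [map_smul, hΨ]; simp [basisZ, mul_comm]
    · have : σ k ≠ σ l := fun h => hl (σ.injective h).symm
      rw [map_smul, hΨ]; simp [basisZ, this]
  have h3 := (congrFun h1 (σ k)).trans h2
  have hN : 0 < 1 + ∑ l, s l ^ 2 := by
    have : 0 ≤ ∑ l, s l ^ 2 := Finset.sum_nonneg fun l _ => sq_nonneg _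
    linarith
  have h4 : K k = _ := curvature_level j' hs hBu (horth _ _ hU) (horth _ _ hW) k
  have h5 := curvature_level j hs hu hU hW (σ k)
  rw [h4] at h3
  have h6 : 2 * ((1 + ∑ l, s l ^ 2) ^ 2)⁻¹ * levelCurv (matJ j (σ k)) u U W =
      2 * ((1 + ∑ l, s l ^ 2) ^ 2)⁻¹ * (ε k * levelCurv (matJ j' k) (B u) (B U) (B W)) := by
    refine h5.symm.trans (h3.trans ?_)
    ring
  exact mul_left_cancel₀ (by positivity) h6

end

section

/-! ## Unitary and antiunitary maps -/

variable {m : ℕ} [NeZero m]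

/-- `B` is a unitary map, possibly composed with the complex conjugation. -/
def UnitaryOrConj (B : Herm m → Herm m) : Prop :=
  ∃ A ∈ Matrix.unitaryGroup (Fin m) ℂ, (∀ u, B u = opE A u) ∨ ∀ u, B u = opE A (conjE u)

theorem opE_mul (A A' : Matrix (Fin m) (Fin m) ℂ) (u : Herm m) :
    opE (A * A') u = opE A (opE A' u) := by
  rw [opE, map_mul]; rfl

theorem opE_one (u : Herm m) : opE 1 u = u := by
  rw [opE, map_one]; rfl

theorem opE_sub (A A' : Matrix (Fin m) (Fin m) ℂ) (u : Herm m) :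
    opE (A - A') u = opE A u - opE A' u := by
  rw [opE, map_sub]; rfl

theorem opE_smul (c : ℂ) (A : Matrix (Fin m) (Fin m) ℂ) (u : Herm m) :
    opE (c • A) u = c • opE A u := by
  rw [opE, map_smul]; rfl

theorem opE_injective {A A' : Matrix (Fin m) (Fin m) ℂ} (h : ∀ u, opE A u = opE A' u) : A = A' :=
  (Matrix.toEuclideanCLM (n := Fin m) (𝕜 := ℂ)).injective (ContinuousLinearMap.ext h)

theorem inner_opE_left (A : Matrix (Fin m) (Fin m) ℂ) (u w : Herm m) :
    inner ℂ (opE A u) w = inner ℂ u (opE (star A) w) := by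
  rw [opE, opE, map_star, ContinuousLinearMap.star_eq_adjoint,
    ContinuousLinearMap.adjoint_inner_right]

theorem inner_opE_unitary {A : Matrix (Fin m) (Fin m) ℂ} (hA : A ∈ Matrix.unitaryGroup (Fin m) ℂ)
    (u w : Herm m) : inner ℂ (opE A u) (opE A w) = inner ℂ u w := by
  rw [inner_opE_left, ← opE_mul, Matrix.mem_unitaryGroup_iff'.1 hA, opE_one]

theorem exists_unitary (L : Herm m ≃ₗᵢ[ℂ] Herm m) :
    ∃ A ∈ Matrix.unitaryGroup (Fin m) ℂ, ∀ u, L u = opE A u := by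
  set T : Herm m →L[ℂ] Herm m := L.toLinearIsometry.toContinuousLinearMap with hT
  have hA : ∀ u, L u = opE ((Matrix.toEuclideanCLM (n := Fin m) (𝕜 := ℂ)).symm T) u := fun u => by
    rw [opE, StarAlgEquiv.apply_symm_apply]; rfl
  refine ⟨_, Matrix.mem_unitaryGroup_iff'.2 (opE_injective fun u => ?_), hA⟩
  refine ext_inner_right ℂ fun w => ?_
  rw [opE_mul, inner_opE_left, star_star, ← hA, ← hA, L.inner_map_map, opE_one]

theorem inner_self_conjE (u w : Herm m) :
    (inner ℂ (conjE u) (conjE w)).re = (inner ℂ u w).re := by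
  rw [inner_conjE]; rfl

theorem conjE_add (u w : Herm m) : conjE (u + w) = conjE u + conjE w := by
  ext k; simp

theorem conjE_smul (c : ℂ) (u : Herm m) : conjE (c • u) = star c • conjE u := by
  ext k; simp

theorem neg_transpose_mem_su {M : Matrix (Fin m) (Fin m) ℂ} (hM : M ∈ su m) : -Mᵀ ∈ su m := by
  obtain ⟨h1, h2⟩ := hM
  refine ⟨?_, by rw [Matrix.trace_neg, Matrix.trace_transpose, h2, neg_zero]⟩
  have h3 : Mᵀᴴ = Mᴴᵀ := rfl
  rw [Matrix.conjTranspose_neg, h3, h1, Matrix.transpose_neg]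

section

variable {B : Herm m → Herm m} (hB : UnitaryOrConj B)
include hB

theorem UnitaryOrConj.map_add_smul (u U : Herm m) (t : ℝ) : B (u + t • U) = B u + t • B U := by
  obtain ⟨A, -, h | h⟩ := hB
  · simp only [h, ← Complex.coe_smul, map_add, map_smul]
  · simp only [h, ← Complex.coe_smul, conjE_add, conjE_smul, map_add, map_smul]
    simp

theorem UnitaryOrConj.re_inner (u w : Herm m) : (inner ℂ (B u) (B w)).re = (inner ℂ u w).re := by
  obtain ⟨A, hA, h | h⟩ := hB
  · rw [h, h, inner_opE_unitary hA]
  · rw [h, h, inner_opE_unitary hA, inner_self_conjE]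

theorem UnitaryOrConj.inner_eq_zero (u w : Herm m) (h0 : inner ℂ u w = 0) :
    inner ℂ (B u) (B w) = 0 := by
  obtain ⟨A, hA, h | h⟩ := hB
  · rw [h, h, inner_opE_unitary hA, h0]
  · rw [h, h, inner_opE_unitary hA, inner_conjE, h0, star_zero]

theorem UnitaryOrConj.norm_map (u : Herm m) : ‖B u‖ = ‖u‖ := by
  have h := hB.re_inner u u
  have h1 := inner_self_eq_norm_sq (𝕜 := ℂ) (B u)
  have h2 := inner_self_eq_norm_sq (𝕜 := ℂ) u
  have h3 : ‖B u‖ ^ 2 = ‖u‖ ^ 2 := h1.symm.trans (h.trans h2)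
  exact (sq_eq_sq₀ (norm_nonneg _) (norm_nonneg _)).1 h3

theorem UnitaryOrConj.map_I_smul : ∃ η : ℝ, η * η = 1 ∧ ∀ u, B (Complex.I • u) =
    η • Complex.I • B u := by
  obtain ⟨A, hA, h | h⟩ := hB
  · exact ⟨1, by norm_num, fun u => by rw [h, h, map_smul, one_smul]⟩
  · refine ⟨-1, by norm_num, fun u => ?_⟩
    rw [h, h, conjE_smul, map_smul]
    simp

/-- An antiunitary map reverses the sign of `i`, hence of `⟨M u, iu⟩` and of `⟨iU, W⟩`. Their
product and the first term are unchanged. -/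
theorem UnitaryOrConj.levelCurv_map {M M' : Matrix (Fin m) (Fin m) ℂ}
    (h : ∀ u, opE M' (B u) = B (opE M u)) (u U W : Herm m) :
    levelCurv M' (B u) (B U) (B W) = levelCurv M u U W := by
  obtain ⟨η, hη, hI⟩ := hB.map_I_smul
  have hI' : ∀ u, Complex.I • B u = η • B (Complex.I • u) := fun u => by
    rw [hI, smul_smul, hη, one_smul]
  simp only [levelCurv, h, hI', ← Complex.coe_smul, inner_smul_left, inner_smul_right,
    Complex.conj_ofReal, Complex.re_ofReal_mul, hB.re_inner]
  linear_combination (-(Complex.I * inner ℂ (opE M u) u).re *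
    ((starRingEnd ℂ) Complex.I * inner ℂ U W).re) * hη

/-- The matrix is the conjugate of `M'` by the unitary part. In the antiunitary case it is also
conjugated entrywise, which for a skew-Hermitian matrix means `-Mᵀ`. -/
theorem UnitaryOrConj.exists_su {M' : Matrix (Fin m) (Fin m) ℂ} (hM' : M' ∈ su m) :
    ∃ M ∈ su m, ∀ u, opE M' (B u) = B (opE M u) := by
  obtain ⟨A, hA, hB⟩ := hB
  have hA1 := Matrix.mem_unitaryGroup_iff.1 hA
  set M := star A * M' * A with hMd
  have hM : M ∈ su m := by
    obtain ⟨h1, h2⟩ := hM'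
    refine ⟨?_, ?_⟩
    · simp only [hMd, Matrix.star_eq_conjTranspose, Matrix.conjTranspose_mul,
        Matrix.conjTranspose_conjTranspose, h1]
      simp [Matrix.mul_assoc]
    · rw [hMd, Matrix.trace_mul_comm, ← Matrix.mul_assoc, hA1, one_mul, h2]
  have hAM : ∀ u, opE M' (opE A u) = opE A (opE M u) := fun u => by
    rw [← opE_mul, ← opE_mul, hMd, ← mul_assoc, ← mul_assoc, hA1, one_mul]
  rcases hB with hB | hB
  · exact ⟨M, hM, fun u => by rw [hB, hB, hAM]⟩
  · refine ⟨-Mᵀ, neg_transpose_mem_su hM, fun u => ?_⟩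
    rw [hB, hB, hAM]
    congr 1
    ext k
    rw [conjE_apply, opE_apply, opE_apply, Matrix.mulVec, Matrix.mulVec, dotProduct, dotProduct,
      star_sum]
    refine Finset.sum_congr rfl fun l _ => ?_
    have h3 : star (M l k) = -M k l := congrFun (congrFun hM.1 k) l
    rw [conjE_apply, Matrix.neg_apply, Matrix.transpose_apply, star_mul', star_neg, h3, neg_neg]

end

/-! ## The curvature of a level determines the matrix -/

theorem inner_opE_of_su {D : Matrix (Fin m) (Fin m) ℂ} (hD : D ∈ su m) (u w : Herm m) :
    inner ℂ (opE D u) w = -inner ℂ u (opE D w) := by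
  have h : star D = (-1 : ℂ) • D := by rw [Matrix.star_eq_conjTranspose, hD.1]; simp
  rw [inner_opE_left, h, opE_smul, inner_smul_right]
  ring

theorem inner_opE_stdE (D : Matrix (Fin m) (Fin m) ℂ) (k l : Fin m) :
    inner ℂ (opE D (stdE k)) (stdE l) = star (D l k) := by
  rw [← inner_conj_symm, inner_stdE, opE_apply]
  simp [stdE]

/-- The quadratic form `⟨D x, i x⟩`. -/
def quadE (D : Matrix (Fin m) (Fin m) ℂ) (x : Herm m) : ℝ :=
  (inner ℂ (opE D x) (Complex.I • x)).re

theorem quadE_add {D : Matrix (Fin m) (Fin m) ℂ} (hD : D ∈ su m) (x y : Herm m) :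
    quadE D (x + y) = quadE D x + quadE D y - 2 * (inner ℂ (opE D x) y).im := by
  have h : inner ℂ (opE D y) x = -star (inner ℂ (opE D x) y) := by
    rw [inner_opE_of_su hD, ← inner_conj_symm, starRingEnd_apply]
  set a := inner ℂ (opE D x) y
  simp only [quadE, map_add, smul_add, inner_add_left, inner_smul_right, inner_add_right, h]
  simp
  ring

theorem quadE_smul (D : Matrix (Fin m) (Fin m) ℂ) (c : ℂ) (x : Herm m) :
    quadE D (c • x) = ‖c‖ ^ 2 * quadE D x := by
  rw [quadE, quadE, map_smul, smul_comm, inner_smul_left, inner_smul_right, ← mul_assoc,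
    Complex.conj_mul', ← Complex.ofReal_pow, Complex.re_ofReal_mul]

/-- Take `W = iU`: vanishing of the level curvature says that the quadratic form has the same
normalised value on any two orthogonal vectors. -/
theorem quadE_orthogonal {D : Matrix (Fin m) (Fin m) ℂ}
    (h : ∀ u U W : Herm m, ‖u‖ = 1 → inner ℂ u U = 0 → inner ℂ u W = 0 → levelCurv D u U W = 0)
    {x U : Herm m} (hx : x ≠ 0) (hU : inner ℂ x U = 0) :
    quadE D U * ‖x‖ ^ 2 = quadE D x * ‖U‖ ^ 2 := by
  have hn := norm_pos_iff.2 hx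
  have h1 := h (((‖x‖⁻¹ : ℝ) : ℂ) • x) U (Complex.I • U)
    (by rw [norm_smul, Complex.norm_real, norm_inv, norm_norm, inv_mul_cancel₀ hn.ne'])
    (by rw [inner_smul_left, hU, mul_zero])
    (by rw [inner_smul_left, inner_smul_right, hU, mul_zero, mul_zero])
  have h2 : (inner ℂ (Complex.I • U) (Complex.I • U)).re = ‖U‖ ^ 2 := by
    have := inner_self_eq_norm_sq (𝕜 := ℂ) (Complex.I • U)
    rw [norm_smul, Complex.norm_I, one_mul] at this
    exact this
  have h3 : quadE D U - quadE D (((‖x‖⁻¹ : ℝ) : ℂ) • x) * ‖U‖ ^ 2 = 0 := by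
    rw [← h2]; exact h1
  rw [quadE_smul, Complex.norm_real, norm_inv, norm_norm, inv_pow] at h3
  field_simp at h3
  linarith

/-- By `quadE_orthogonal` all diagonal entries coincide, so they vanish by trace zero. The
off-diagonal entries are then obtained by polarisation on orthogonal pairs of equal length. -/
theorem eq_zero_of_levelCurv {D : Matrix (Fin m) (Fin m) ℂ} (hD : D ∈ su m)
    (h : ∀ u U W : Herm m, ‖u‖ = 1 → inner ℂ u U = 0 → inner ℂ u W = 0 → levelCurv D u U W = 0) :
    D = 0 := by
  have hskew : ∀ k l, star (D l k) = -D k l := fun k l => congrFun (congrFun hD.1 k) l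
  have hdre : ∀ k, (D k k).re = 0 := fun k => by
    have := congrArg Complex.re (hskew k k)
    simp at this
    linarith
  have hq : ∀ k, quadE D (stdE k) = (D k k).im := fun k => by
    rw [quadE, inner_smul_right, inner_opE_stdE]; simp
  have hdeq : ∀ k, D k k = D 0 0 := by
    intro k
    by_cases hk : k = 0
    · rw [hk]
    · have h1 := quadE_orthogonal h (stdE_ne_zero (m := m) 0) (U := stdE k)
        (by rw [inner_stdE, stdE_of_ne (Ne.symm hk)])
      rw [hq, hq, norm_stdE, norm_stdE] at h1
      refine Complex.ext (by rw [hdre, hdre]) (by linarith)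
  have hdiag : ∀ k, D k k = 0 := by
    have h1 : D.trace = m * D 0 0 := by
      rw [Matrix.trace, Finset.sum_congr rfl fun k _ => (Matrix.diag_apply D k).trans (hdeq k)]
      simp
    rw [hD.2] at h1
    have h2 : (m : ℂ) ≠ 0 := Nat.cast_ne_zero.2 (NeZero.ne m)
    intro k
    rw [hdeq k]
    exact (mul_eq_zero.1 h1.symm).resolve_left h2
  -- The vectors `e_k + z e_l` and `e_k - z e_l` are orthogonal of norm `√2`. Equality of the
  -- quadratic form on them is `Im (z conj D_lk) = 0`, used below for `z = 1` and `z = i`.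
  have hoff : ∀ k l, k ≠ l → ∀ z : ℂ, ‖z‖ = 1 → (z * star (D l k)).im = 0 := by
    intro k l hkl z hz
    have hn : ∀ w : ℂ, ‖w‖ = 1 → ‖stdE k + w • stdE l‖ ^ 2 = 2 := fun w hw => by
      rw [norm_add_sq (𝕜 := ℂ), inner_smul_right, inner_stdE, stdE_of_ne hkl, norm_smul, norm_stdE,
        norm_stdE, hw]
      norm_num
    have hne : stdE k + z • stdE l ≠ 0 := fun h0 => by
      have := hn z hz
      rw [h0] at this
      norm_num at this
    have horth : inner ℂ (stdE k + z • stdE l) (stdE k + (-z) • stdE l) = 0 := by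
      simp only [inner_add_left, inner_add_right, inner_smul_left, inner_smul_right, inner_stdE,
        stdE_self, stdE_of_ne hkl, stdE_of_ne hkl.symm]
      have : (starRingEnd ℂ) z * z = 1 := by rw [Complex.conj_mul', hz]; norm_num
      linear_combination (-1 : ℂ) * this
    have h1 := quadE_orthogonal h hne horth
    rw [hn z hz, hn (-z) (by rw [norm_neg, hz]), quadE_add hD, quadE_add hD, inner_smul_right,
      inner_smul_right, inner_opE_stdE, quadE_smul, quadE_smul, norm_neg, hz] at h1
    rw [neg_mul, Complex.neg_im] at h1
    linarith
  ext k l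
  by_cases hkl : k = l
  · rw [hkl, hdiag]; rfl
  · have h1 := hoff l k (Ne.symm hkl) 1 (by simp)
    have h2 := hoff l k (Ne.symm hkl) Complex.I (by simp)
    apply Complex.ext
    · simpa using h2
    · simpa using h1

theorem levelCurv_sub_smul (A A' : Matrix (Fin m) (Fin m) ℂ) (r : ℝ) (u U W : Herm m) :
    levelCurv (A - r • A') u U W = levelCurv A u U W - r * levelCurv A' u U W := by
  have h : r • A' = (r : ℂ) • A' := (Complex.coe_smul r A').symm
  simp only [levelCurv, h, opE_sub, opE_smul, inner_sub_left, inner_smul_left, Complex.conj_ofReal,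
    Complex.sub_re, Complex.re_ofReal_mul]
  ring

theorem matJ_mem (j : LieT →ₗ[ℝ] su m) (k : Fin 2) : matJ j k ∈ su m := (j (basisZ k)).2

/-- An isometry that is linear along a level and relates the curvature forms intertwines the
linear maps. -/
theorem intertwines {s : Fin 2 → ℝ} (hs : ∀ l, 0 < s l) {Φ : DiffeoBase m} {B : Herm m → Herm m}
    (hB : ∀ u, u ≠ 0 → Φ (qL s u) = qL s (B u)) (hBu : UnitaryOrConj B)
    {Ψ : LieT ≃L[ℝ] LieT} {σ : Equiv.Perm (Fin 2)} {ε : Fin 2 → ℝ} (hε : ∀ k, ε k = 1 ∨ ε k = -1)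
    (hΨ : ∀ k, Ψ (basisZ k) = ε k • basisZ (σ k)) {j j' : LieT →ₗ[ℝ] su m}
    (h : curvature j = ((curvature j').pullback Φ).postcomp Ψ) (k : Fin 2) (u : Herm m) :
    opE (matJ j' k) (B u) = B (opE (ε k • matJ j (σ k)) u) := by
  obtain ⟨M, hM, hMB⟩ := hBu.exists_su (matJ_mem j' k)
  have hD : matJ j (σ k) - ε k • M ∈ su m :=
    (su m).sub_mem (matJ_mem j _) ((su m).smul_mem _ hM)
  have h0 := eq_zero_of_levelCurv hD fun u U W hu hU hW => by
    rw [levelCurv_sub_smul, levelCurv_eq hs hB hBu.map_add_smul hBu.norm_map hBu.inner_eq_zero hΨ h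
      hu hU hW, hBu.levelCurv_map hMB, sub_self]
  -- The matrix identity obtained from the curvature has the sign on the side of `M`; it moves
  -- across because `ε k ^ 2 = 1`.
  have h1 : ε k • matJ j (σ k) = M := by
    have hε2 : ε k * ε k = 1 := by rcases hε k with h | h <;> rw [h] <;> norm_num
    rw [sub_eq_zero.1 h0, smul_smul, hε2, one_smul]
  rw [h1, hMB]

/-! ## Isometries along a level are given by unitary or antiunitary maps -/

theorem qL_eq_of_sameLine {s : Fin 2 → ℝ} (hs : ∀ l, 0 < s l) {u w : Herm m} (hu : u ≠ 0)
    (h : SameLine u w) : qL s w = qL s u := by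
  obtain ⟨c, hc, rfl⟩ := h
  exact qL_smul hs hu hc

/-- Choosing a unit representative of each image line turns `Φ` on the level into a map of vectors
preserving transition probabilities, to which Wigner's theorem applies. -/
theorem exists_unitaryOrConj {s : Fin 2 → ℝ} (hs : ∀ l, 0 < s l) {Φ : DiffeoBase m}
    (hΦ : IsIsometryBase Φ) (hL : PreservesLevel s Φ) (hL' : PreservesLevel s Φ.symm) :
    ∃ B, UnitaryOrConj B ∧ ∀ u : Herm m, u ≠ 0 → Φ (qL s u) = qL s (B u) := by
  have h1 : ∀ u : Herm m, ∃ w : Herm m, u ≠ 0 → ‖w‖ = 1 ∧ Φ (qL s u) = qL s w := by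
    intro u
    by_cases hu : u = 0
    · exact ⟨0, fun h => absurd hu h⟩
    · obtain ⟨w, hw, hw'⟩ := exists_qL_eq (hL (qL s u) (levelB_qL hs hu))
      exact ⟨w, fun _ => ⟨hw, hw'.symm⟩⟩
  choose f hf using h1
  have hne : ∀ u, u ≠ 0 → f u ≠ 0 := fun u hu h => by
    have := (hf u hu).1
    rw [h, norm_zero] at this
    exact zero_ne_one this
  have hunit : ∀ u : Herm m, u ≠ 0 → ∃ u', ‖u'‖ = 1 ∧ SameLine u u' := fun u hu => by
    have hn := norm_pos_iff.2 hu
    have hc : ((‖u‖⁻¹ : ℝ) : ℂ) ≠ 0 := by exact_mod_cast (inv_pos.2 hn).ne'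
    exact ⟨((‖u‖⁻¹ : ℝ) : ℂ) • u,
      by rw [norm_smul, Complex.norm_real, norm_inv, norm_norm, inv_mul_cancel₀ hn.ne'], _, hc, rfl⟩
  have hpres : PreservesTransProb f := ⟨hne, fun u w hu hw => by
    obtain ⟨u', hu', hu1⟩ := hunit u hu
    obtain ⟨w', hw', hw1⟩ := hunit w hw
    rw [← transB_qL hs (hne u hu) (hne w hw), ← (hf u hu).2, ← (hf w hw).2,
      ← qL_eq_of_sameLine hs hu hu1, ← qL_eq_of_sameLine hs hw hw1, transB_map hs hΦ hL hL' hu' hw',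
      hu1.transProb_left, hw1.transProb_right]⟩
  obtain ⟨L, hLf⟩ := wigner hpres
  obtain ⟨A, hA, hAL⟩ := exists_unitary L
  rcases hLf with h | h
  · refine ⟨fun u => opE A u, ⟨A, hA, Or.inl fun _ => rfl⟩, fun u hu => ?_⟩
    change _ = qL s (opE A u)
    rw [(hf u hu).2, ← hAL]
    exact qL_eq_of_sameLine hs (by simpa using hu) (h u hu)
  · refine ⟨fun u => opE A (conjE u), ⟨A, hA, Or.inr fun _ => rfl⟩, fun u hu => ?_⟩
    change _ = qL s (opE A (conjE u))
    have hu' : conjE u ≠ 0 := fun h0 => hu (norm_eq_zero.1 (by rw [← norm_conjE, h0, norm_zero]))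
    rw [(hf u hu).2, ← hAL]
    exact qL_eq_of_sameLine hs (by simpa using hu') (h u hu)

end

section

/-! ## Induced isometries and the levels -/

variable {m : ℕ} [NeZero m]

/-- A diffeomorphism of the base induced by `F` is determined by `F`, so `Φ` is the isometry
provided by membership of `F` in `AutT`. -/
theorem isIsometryBase_of_mem {Φ : DiffeoBase m} (hΦ : Φ ∈ AutTBar m) : IsIsometryBase Φ := by
  obtain ⟨F, ⟨-, -, Φ', hΦ', hiso⟩, hF⟩ := hΦ
  have h : (Φ : Base m → Base m) = Φ' := by
    funext b
    obtain ⟨q, rfl⟩ := (isQuotientMap_projT m).surjective b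
    obtain ⟨h1, h2⟩ := hF q
    obtain ⟨h3, h4⟩ := hΦ' q
    rw [h2, h4]
  unfold IsIsometryBase at hiso ⊢
  rw [h, hiso]

/-- On the unit sphere `‖u‖² = 1 - ∑ |v_k|²`, so the levels of the base and the lengths of the torus
orbits determine each other. -/
theorem levelB_projT (q : hat m) (l : Fin 2) :
    levelB (projT q) l = Real.sqrt (levelQ (q : Quo m) l / (1 - ∑ k, levelQ (q : Quo m) k)) := by
  obtain ⟨x, hx, rfl⟩ := qHat_surjective q
  have h1 : projT (qHat (incl x)) = qT (incl x) := rfl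
  have hn := norm_pos_iff.2 (partE_ne_zero hx.1)
  have h2 := norm_sq_eq_partE (incl x)
  rw [norm_incl] at h2
  rw [h1, levelB_qT hx, coe_qHat hx]
  simp only [levelQ_qG hx.1, norm_incl, one_pow, div_one]
  have h3 : 1 - ∑ k, ‖incl x (.inr k)‖ ^ 2 = ‖partE m (incl x)‖ ^ 2 := by linarith
  rw [h3, ← div_pow, Real.sqrt_sq (by positivity)]

/-- An induced isometry permutes the levels. -/
theorem levelB_map {F : DiffeoQuo m} {Φ : DiffeoBase m} (hF : IsInducedBy F Φ)
    {σ : Equiv.Perm (Fin 2)} (h : ∀ q ∈ hat m, ∀ k, levelQ (F q) (σ k) = levelQ q k) (b : Base m)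
    (k : Fin 2) : levelB (Φ b) (σ k) = levelB b k := by
  obtain ⟨q, rfl⟩ := (isQuotientMap_projT m).surjective b
  obtain ⟨h1, h2⟩ := hF q
  rw [h2, levelB_projT, levelB_projT]
  have h3 : ∑ k, levelQ (F q) k = ∑ k, levelQ (q : Quo m) k := by
    rw [← Equiv.sum_comp σ]
    exact Finset.sum_congr rfl fun k _ => h q q.2 k
  change Real.sqrt (levelQ (F q) (σ k) / (1 - ∑ k, levelQ (F q) k)) = _
  rw [h3, h q q.2]

theorem exists_perm_levelB {Φ : DiffeoBase m} (hΦ : Φ ∈ AutTBar m) :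
    ∃ σ : Equiv.Perm (Fin 2), ∀ b k, levelB (Φ b) (σ k) = levelB b k := by
  obtain ⟨F, hF, hFΦ⟩ := hΦ
  obtain ⟨Ψ, hΨ⟩ := exists_isConjDifferential hF.1
  obtain ⟨σ, ε, -, -, h⟩ := exists_perm hF hΨ
  exact ⟨σ, levelB_map hFΦ h⟩

theorem isConjDifferential_of {F : DiffeoQuo m} {Ψ : LieT ≃L[ℝ] LieT}
    (h : IsDifferentialOfConj F Ψ) : IsConjDifferential F (Ψ : LieT →L[ℝ] LieT) := h

/-! ## Condition (N) -/

/-- Multiply by an `m`-th root of the inverse determinant, which has modulus one. -/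
theorem exists_specialUnitary {A : Matrix (Fin m) (Fin m) ℂ}
    (hA : A ∈ Matrix.unitaryGroup (Fin m) ℂ) :
    ∃ c : ℂ, c • A ∈ Matrix.specialUnitaryGroup (Fin m) ℂ := by
  have hdet : ‖A.det‖ = 1 := by
    have h := congrArg Matrix.det (Matrix.mem_unitaryGroup_iff.1 hA)
    rw [Matrix.det_mul, Matrix.star_eq_conjTranspose, Matrix.det_conjTranspose, Matrix.det_one] at h
    have h1 := congrArg norm h
    rw [norm_mul, norm_star, norm_one] at h1
    nlinarith [norm_nonneg A.det]
  obtain ⟨c, hc⟩ := IsAlgClosed.exists_pow_nat_eq (A.det)⁻¹ (Nat.pos_of_ne_zero (NeZero.ne m))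
  have hcn : ‖c‖ = 1 := by
    have h1 := congrArg norm hc
    rw [norm_pow, norm_inv, hdet, inv_one] at h1
    exact (pow_eq_one_iff_of_nonneg (norm_nonneg _) (NeZero.ne m)).1 h1
  have hdet0 : A.det ≠ 0 := norm_ne_zero_iff.1 (by rw [hdet]; norm_num)
  refine ⟨c, Matrix.mem_specialUnitaryGroup_iff.2 ⟨?_, ?_⟩⟩
  · rw [Matrix.mem_unitaryGroup_iff, star_smul, smul_mul_smul_comm,
      Matrix.mem_unitaryGroup_iff.1 hA]
    have : c * star c = 1 := by
      rw [← starRingEnd_apply, Complex.mul_conj', hcn]; norm_num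
    rw [this, one_smul]
  · rw [Matrix.det_smul, Fintype.card_fin, hc, inv_mul_cancel₀ hdet0]

theorem mem_setE {Ψ : LieT ≃L[ℝ] LieT} {σ : Equiv.Perm (Fin 2)} {ε : Fin 2 → ℝ}
    (hε : ∀ k, ε k = 1 ∨ ε k = -1) (hΨ : ∀ k, Ψ (basisZ k) = ε k • basisZ (σ k)) : Ψ ∈ setE := by
  intro k
  rw [hΨ]
  have h : σ k = 0 ∨ σ k = 1 := by
    generalize σ k = i
    fin_cases i <;> simp
  rcases hε k with h1 | h1 <;> rcases h with h2 | h2 <;> simp [h1, h2]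

theorem sum_basisZ (Z : LieT) : Z = ∑ k, Z k • basisZ k := by
  funext i
  rw [Finset.sum_apply, Finset.sum_eq_single i (fun l _ hl => by simp [basisZ, hl.symm])
    (by simp)]
  simp [basisZ]

theorem coe_map_eq_sum (j : LieT →ₗ[ℝ] su m) (Z : LieT) :
    (j Z : Matrix (Fin m) (Fin m) ℂ) = ∑ k, Z k • matJ j k := by
  conv_lhs => rw [sum_basisZ Z, map_sum]
  rw [Submodule.coe_sum]
  refine Finset.sum_congr rfl fun k _ => ?_
  rw [map_smul]
  rfl

theorem coe_map_eq_sum' (j : LieT →ₗ[ℝ] su m) {Ψ : LieT ≃L[ℝ] LieT} {σ : Equiv.Perm (Fin 2)}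
    {ε : Fin 2 → ℝ} (hΨ : ∀ k, Ψ (basisZ k) = ε k • basisZ (σ k)) (Z : LieT) :
    (j (Ψ Z) : Matrix (Fin m) (Fin m) ℂ) = ∑ k, Z k • ε k • matJ j (σ k) := by
  conv_lhs => rw [sum_basisZ Z, map_sum, map_sum]
  rw [Submodule.coe_sum]
  refine Finset.sum_congr rfl fun k _ => ?_
  rw [map_smul, hΨ, map_smul, map_smul]
  rfl

theorem real_smul_mulVec (r : ℝ) (M : Matrix (Fin m) (Fin m) ℂ) (v : Fin m → ℂ) :
    (r • M) *ᵥ v = r • M *ᵥ v := Matrix.smul_mulVec r M v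

/-- The scalar that makes `A` special unitary commutes with the matrices `j'_k`, so the intertwining
relation survives and extends from `Z₁, Z₂` to `𝔱` by real linearity. -/
theorem areEquivalent_of_intertwines {j j' : LieT →ₗ[ℝ] su m} {B : Herm m → Herm m}
    (hB : UnitaryOrConj B) {Ψ : LieT ≃L[ℝ] LieT} {σ : Equiv.Perm (Fin 2)} {ε : Fin 2 → ℝ}
    (hε : ∀ k, ε k = 1 ∨ ε k = -1) (hΨ : ∀ k, Ψ (basisZ k) = ε k • basisZ (σ k))
    (h : ∀ k u, opE (matJ j' k) (B u) = B (opE (ε k • matJ j (σ k)) u)) : AreEquivalent j j' := by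
  obtain ⟨A, hA, hBA⟩ := hB
  obtain ⟨c, hc⟩ := exists_specialUnitary hA
  -- The map `θ` is the identity or complex conjugation; only its real linearity matters.
  have key : ∀ θ : (Fin m → ℂ) → (Fin m → ℂ), (∀ u, (B u).ofLp = A *ᵥ θ u.ofLp) →
      (∀ (r : ℝ) v, θ (r • v) = r • θ v) → (∀ v w, θ (v + w) = θ v + θ w) →
      ∀ (Z : LieT) (u : Fin m → ℂ), (j' Z : Matrix (Fin m) (Fin m) ℂ) *ᵥ ((c • A) *ᵥ θ u) =
        (c • A) *ᵥ θ ((j (Ψ Z) : Matrix (Fin m) (Fin m) ℂ) *ᵥ u) := by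
    intro θ hθ hθs hθa Z u
    have hk : ∀ k, matJ j' k *ᵥ (A *ᵥ θ u) = A *ᵥ θ ((ε k • matJ j (σ k)) *ᵥ u) := by
      intro k
      have h1 := congrArg (fun v : Herm m => v.ofLp) (h k (WithLp.toLp 2 u))
      simp only [hθ] at h1
      have h2 : (opE (matJ j' k) (B (WithLp.toLp 2 u))).ofLp =
        matJ j' k *ᵥ (B (WithLp.toLp 2 u)).ofLp := rfl
      rw [h2, hθ] at h1
      exact h1
    rw [coe_map_eq_sum, coe_map_eq_sum' j hΨ, Fin.sum_univ_two, Fin.sum_univ_two]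
    simp only [Matrix.add_mulVec, real_smul_mulVec (Z _), Matrix.smul_mulVec c,
      Matrix.mulVec_smul _ c, hk, hθa, hθs, Matrix.mulVec_add, Matrix.mulVec_smul, smul_add,
      smul_comm c]
  rcases hBA with hBA | hBA
  · exact ⟨fun u => (c • A) *ᵥ u, ⟨_, hc, Or.inl fun _ => rfl⟩, Ψ, mem_setE hε hΨ,
      key id (fun u => by rw [hBA]; rfl) (fun _ _ => rfl) fun _ _ => rfl⟩
  · exact ⟨fun u => (c • A) *ᵥ star u, ⟨_, hc, Or.inr fun _ => rfl⟩, Ψ, mem_setE hε hΨ,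
      key star (fun u => by rw [hBA]; rfl) (fun r v => by rw [star_smul, star_trivial])
        fun v w => star_add v w⟩

theorem areEquivalent_of_curvature {j j' : LieT →ₗ[ℝ] su m} {Ψ : LieT ≃L[ℝ] LieT}
    (hΨ : Ψ ∈ setD m) {Φ : DiffeoBase m} (hΦ : Φ ∈ AutTBar m)
    (h : curvature j = ((curvature j').pullback Φ).postcomp Ψ) : AreEquivalent j j' := by
  obtain ⟨F, hF, hFΨ⟩ := hΨ
  obtain ⟨σ, ε, hε, hσ, -⟩ := exists_perm hF (isConjDifferential_of hFΨ)
  obtain ⟨τ, hτ⟩ := exists_perm_levelB hΦ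
  -- The level with `s₁ = s₂` is invariant under exchanging the two coordinates, so it is preserved
  -- whichever permutation `Φ` induces.
  have hL : PreservesLevel (fun _ => 1) Φ := fun b hb l => by
    rw [← τ.apply_symm_apply l, hτ, hb]
  have hL' : PreservesLevel (fun _ => 1) Φ.symm := fun b hb l => by
    rw [← hτ, Φ.apply_symm_apply, hb]
  obtain ⟨B, hB, hBΦ⟩ := exists_unitaryOrConj (fun _ => one_pos) (isIsometryBase_of_mem hΦ) hL hL'
  exact areEquivalent_of_intertwines hB hε hσ
    (intertwines (fun _ => one_pos) hBΦ hB hε hσ h)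

/-! ## Property (G) -/

/-- Subtracting the trace part gives an element of `𝔰𝔲(m)` that still commutes with both `j_{Z_k}`,
hence zero. -/
theorem exists_scalar_of_skew {j : LieT →ₗ[ℝ] su m} (hj : IsGeneric j)
    {X : Matrix (Fin m) (Fin m) ℂ} (hX : Xᴴ = -X) (hc : ∀ k, Commute X (matJ j k)) :
    ∃ c : ℂ, X = c • (1 : Matrix (Fin m) (Fin m) ℂ) := by
  have hm : (m : ℂ) ≠ 0 := Nat.cast_ne_zero.2 (NeZero.ne m)
  have htr : star X.trace = -X.trace := by
    rw [← Matrix.trace_conjTranspose, hX, Matrix.trace_neg]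
  refine ⟨X.trace / m, sub_eq_zero.1 (hj (X - (X.trace / m) • 1) ⟨?_, ?_⟩ fun k => ?_)⟩
  · rw [Matrix.conjTranspose_sub, Matrix.conjTranspose_smul, Matrix.conjTranspose_one, hX, star_div₀,
      htr]
    simp [neg_div]
    abel
  · rw [Matrix.trace_sub, Matrix.trace_smul, Matrix.trace_one, Fintype.card_fin, smul_eq_mul,
      div_mul_cancel₀ _ hm, sub_self]
  · exact (hc k).sub_left ((Commute.one_left _).smul_left _)

/-- The adjoint of `C` also commutes, because the `j_{Z_k}` are skew-Hermitian. The skew-Hermitian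
matrices `C - Cᴴ` and `i (C + Cᴴ)` are therefore scalar, and `C` is a combination of them. -/
theorem exists_scalar_of_commute {j : LieT →ₗ[ℝ] su m} (hj : IsGeneric j)
    {C : Matrix (Fin m) (Fin m) ℂ} (hc : ∀ k, Commute C (matJ j k)) :
    ∃ c : ℂ, C = c • (1 : Matrix (Fin m) (Fin m) ℂ) := by
  have hc' : ∀ k, Commute Cᴴ (matJ j k) := fun k => by
    have h := congrArg Matrix.conjTranspose (hc k)
    rw [Matrix.conjTranspose_mul, Matrix.conjTranspose_mul, conjTranspose_matJ, neg_mul,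
      mul_neg, neg_inj] at h
    exact h.symm
  obtain ⟨a, ha⟩ := exists_scalar_of_skew hj (X := C - Cᴴ)
    (by rw [Matrix.conjTranspose_sub, Matrix.conjTranspose_conjTranspose, neg_sub])
    fun k => (hc k).sub_left (hc' k)
  obtain ⟨b, hb⟩ := exists_scalar_of_skew hj (X := Complex.I • (C + Cᴴ))
    (by
      rw [Matrix.conjTranspose_smul, Matrix.conjTranspose_add, Matrix.conjTranspose_conjTranspose]
      simp [add_comm])
    fun k => ((hc k).add_left (hc' k)).smul_left _
  refine ⟨(a - Complex.I * b) / 2, ?_⟩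
  have h1 : C + Cᴴ = (-Complex.I * b) • (1 : Matrix (Fin m) (Fin m) ℂ) := by
    rw [mul_smul, ← hb, smul_smul]
    simp
  have h2 : (2 : ℂ) • C = (a - Complex.I * b) • (1 : Matrix (Fin m) (Fin m) ℂ) := by
    have : (2 : ℂ) • C = (C - Cᴴ) + (C + Cᴴ) := by rw [two_smul]; abel
    rw [this, ha, h1, ← add_smul]
    congr 1
    ring
  rw [div_eq_inv_mul, mul_smul, ← h2, smul_smul]
  simp

/-- Squaring removes the conjugation, so both types lead to a complex-linear map, to which the
commutant argument applies. -/
theorem UnitaryOrConj.exists_sq {B : Herm m → Herm m} (hB : UnitaryOrConj B) :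
    ∃ C : Matrix (Fin m) (Fin m) ℂ, ∀ u, B (B u) = opE C u := by
  obtain ⟨A, hA, h | h⟩ := hB
  · exact ⟨A * A, fun u => by rw [h, h, opE_mul]⟩
  · refine ⟨A * A.map star, fun u => ?_⟩
    rw [h, h, opE_mul]
    congr 1
    ext k
    rw [conjE_apply, opE_apply, opE_apply, Matrix.mulVec, Matrix.mulVec, dotProduct, dotProduct,
      star_sum]
    refine Finset.sum_congr rfl fun l _ => ?_
    rw [conjE_apply, Matrix.map_apply, star_mul', star_star]

theorem propertyG_of_isGeneric {j : LieT →ₗ[ℝ] su m} (hj : IsGeneric j) :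
    PropertyG (curvature j) := by
  intro Φ hΦ hpres t b
  obtain ⟨hmem, hadd, -⟩ := hΦ
  have hhalf : ∀ (r : ℝ) b, Φ r b = Φ (r / 2) (Φ (r / 2) b) := fun r b => by
    rw [← hadd, add_halves]
  -- `Φ_{t/2}` is the square of `Φ_{t/4}`, and a permutation of two indices has trivial square.
  have hlev : ∀ b l, levelB (Φ (t / 2) b) l = levelB b l := by
    intro b l
    obtain ⟨σ, hσ⟩ := exists_perm_levelB (hmem (t / 2 / 2))
    have hσ2 : σ (σ l) = l := by
      have : ∀ (τ : Equiv.Perm (Fin 2)) (i : Fin 2), τ (τ i) = i := by decide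
      exact this σ l
    conv_lhs => rw [← hσ2]
    rw [hhalf (t / 2), hσ, hσ]
  set s : Fin 2 → ℝ := levelB b with hs
  have hspos : ∀ l, 0 < s l := fun l =>
    div_pos (norm_pos_iff.2 ((repB_mem b).2 l)) (norm_pos_iff.2 (partE_ne_zero (repB_mem b).1))
  have hL : PreservesLevel s (Φ (t / 2)) := fun b hb l => by rw [hlev, hb]
  have hL' : PreservesLevel s (Φ (t / 2)).symm := fun b hb l => by
    rw [← hlev, (Φ (t / 2)).apply_symm_apply, hb]
  obtain ⟨B, hB, hBΦ⟩ := exists_unitaryOrConj hspos (isIsometryBase_of_mem (hmem _)) hL hL'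
  have hint := intertwines hspos hBΦ hB (Ψ := ContinuousLinearEquiv.refl ℝ LieT)
    (σ := Equiv.refl _) (ε := fun _ => 1) (fun _ => Or.inl rfl) (fun k => (one_smul ℝ _).symm)
    (j := j) (j' := j) (hpres (t / 2)).symm
  obtain ⟨C, hC⟩ := hB.exists_sq
  have hcomm : ∀ k, Commute C (matJ j k) := fun k => opE_injective fun u => by
    have hint' : ∀ u, opE (matJ j k) (B u) = B (opE (matJ j k) u) := fun u =>
      (hint k u).trans (by rw [one_smul]; rfl)
    rw [opE_mul, opE_mul, ← hC, ← hC, hint', hint']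
  obtain ⟨c, hc⟩ := exists_scalar_of_commute hj hcomm
  obtain ⟨u, hu, hub⟩ := exists_qL_eq (s := s) (b := b) fun _ => rfl
  have hu0 : u ≠ 0 := fun h => by simp [h] at hu
  have hne : ∀ v, v ≠ 0 → B v ≠ 0 := fun v hv h => hv (norm_eq_zero.1 (by
    rw [← hB.norm_map, h, norm_zero]))
  have hBB : B (B u) = c • u := by rw [hC, hc, opE_smul, opE_one]
  have hc0 : c ≠ 0 := fun h => hne _ (hne u hu0) (by rw [hBB, h, zero_smul])
  -- `Φ_t` acts on the level of `b` by `B²`, a nonzero scalar, and a scalar fixes every line.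
  rw [hhalf, ← hub, hBΦ u hu0, hBΦ _ (hne u hu0), hBB, qL_smul hspos hu0 hc0]

end

end SphereQuotient

end

theorem proposition6p4 (m : ℕ) (hm : 3 ≤ m)
    (j j' : SphereQuotient.LieT →ₗ[ℝ] SphereQuotient.su m) :
    (¬ SphereQuotient.AreEquivalent j j' →
      SphereQuotient.ConditionN (SphereQuotient.curvature j) (SphereQuotient.curvature j')) ∧
    (SphereQuotient.IsGeneric j' →
      SphereQuotient.PropertyG (SphereQuotient.curvature j')) := by
  have : NeZero m := ⟨by omega⟩
  refine ⟨fun hne => ?_, SphereQuotient.propertyG_of_isGeneric⟩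
  rintro ⟨Ψ, hΨ, Φ, hΦ, h⟩
  exact hne (SphereQuotient.areEquivalent_of_curvature hΨ hΦ h)
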